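/- Let $p>6$. Let $\mathcal G$ be a connected metric graph (loops and multiple edges allowed) with at most countably many edges, each of which is either bounded, identified with $[0,|e|]$, $0<|e|<\infty$, and with a vertex at each end, or a half-line $[0,+\infty)$ attached at a single vertex. Assume that every vertex has finite degree and that $\inf_e |e|>0$. Assume moreover that one of the following holds: * $\mathcal G$ has finitely many edges and at least one half-line; * $\mathcal G$ is periodic: it has infinitely many edges, their lengths are uniformly bounded from above, and some group $\mathbb Z^n$ acts freely on $\mathcal G$ by length-preserving graph automorphisms in such a way that the translates of finitely many edges cover $\mathcal G$. For $u\in H^1(\mathcal G)$ (continuous functions on $\mathcal G$ that, together with their weak derivative on the edges, belong to $L^2(\mathcal G)$) let $E(u,\mathcal G)=\frac12\|u'\|_{L^2(\mathcal G)}^2-\frac1p\|u\|_{L^p(\mathcal G)}^p$, and similarly on $\mathbb R$ and $\mathbb R^+$. For $\mu>0$ let $S_\mu$ be the set of all $u\in H^1(\mathcal G)$ with $\|u\|_{L^2(\mathcal G)}^2=\mu$ and $u>0$ on $\mathcal G$ for which there is $\lambda\in\mathbb R$ with $$u''+u^{p-1}=\lambda u\quad\text{on every edge},\qquad \sum_{e\succ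 v}\frac{du}{dx_e}(v)=0\quad\text{at every vertex } v,$$ where the sum runs over the edge ends at $v$ (both ends of a loop being counted) and the derivatives are taken in the direction entering the edge. Let $\phi_{\mu,1}$ be the soliton of mass $\mu$, i.e. the unique positive $\phi\in H^1(\mathbb R)$ with $\|\phi\|_{L^2(\mathbb R)}^2=\mu$ and $\phi(0)=\max\phi$ that solves $\phi''+\phi^{p-1}=\lambda\phi$ on $\mathbb R$ for some $\lambda>0$. A pendant is a bounded edge with a vertex of degree $1$. With the convention $\inf\emptyset=+\infty$: 1. If $\mathcal G$ has no pendant and $\mathcal G$ is not a single half-line, then $$\liminf_{\mu\to0^+}\ \inf_{u\in S_\mu}\frac{E(u,\mathcal G)}{E(\phi_{\mu,1},\mathbb R)}\ \ge 1.$$ 2. If $\mathcal G$ has at least one pendant, then $$\liminf_{\mu\to0^+}\ \inf_{u\in S_\mu}\frac{E(u,\mathcal G)}{E(\phi_{2\mu,1},\mathbb R^+)}\ \ge 1.$$ -/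

import Mathlib

open Filter Topology MeasureTheory Set
open scoped ENNReal ContDiff

/-- A metric graph with vertex set `V` and edge set `E` (loops and multiple edges are allowed).
A bounded edge `e` is identified with `[0, length e]`, the point `0` being the vertex `source e` and
the point `length e` being the vertex `target e`. An edge of infinite length is a half-line
`[0, +∞)`, attached to the graph at `source e` only. -/
structure MetricGraph (V E : Type*) where
  source : E → V
  target : E → Option V
  length : E → ℝ≥0∞
  length_pos : ∀ e, 0 < length e
  target_eq_none_iff : ∀ e, target e = none ↔ length e = ⊤

namespace MetricGraph

variable {V E : Type*} (G : MetricGraph V E)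

/-- The interval `[0, |e|]` (or `[0, +∞)` for a half-line). -/
def interval (e : E) : Set ℝ := {x | 0 ≤ x ∧ ENNReal.ofReal x ≤ G.length e}

/-- The vertices of the edge `e`. -/
def endpoints (e : E) : Set V := {v | G.source e = v ∨ G.target e = some v}

/-- The edge ends at the vertex `v`: `(e, false)` is the initial end of `e` (coordinate `0`),
`(e, true)` the terminal end (coordinate `|e|`). A loop at `v` has both its ends here. -/
def ends (v : V) : Set (E × Bool) :=
  {i | (i.2 = false ∧ G.source i.1 = v) ∨ (i.2 = true ∧ G.target i.1 = some v)}

/-- The coordinate of an edge end. -/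
noncomputable def endCoord (i : E × Bool) : ℝ := if i.2 then (G.length i.1).toReal else 0

/-- The degree of a vertex (meaningful when there are finitely many edge ends at it). -/
noncomputable def degree (v : V) : ℕ := (G.ends v).ncard

/-- Any two vertices are joined by a finite chain of bounded edges. -/
def Connected : Prop :=
  ∀ v w : V, Relation.EqvGen (fun a b => ∃ e, G.source e = a ∧ G.target e = some b) v w

/-- The class of metric graphs under consideration. -/
structure InClass : Prop where
  connected : G.Connected
  countable : Countable E
  finite_ends : ∀ v, (G.ends v).Finite
  length_lower_bound : 0 < ⨅ e, G.length e

/-- A graph with a half-line or with infinitely many edges. -/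
def Noncompact : Prop := (∃ e, G.length e = ⊤) ∨ Infinite E

/-- Periodic graph: infinitely many edges, with lengths uniformly bounded from above, and a free
action of some `ℤⁿ` by automorphisms of the metric graph that is cocompact, that is, such that the
translates of finitely many edges cover the graph. -/
def Periodic : Prop :=
  Infinite E ∧ (∃ L : ℝ, ∀ e, G.length e ≤ ENNReal.ofReal L) ∧
  ∃ (n : ℕ) (_ : AddAction (Fin n → ℤ) V) (_ : AddAction (Fin n → ℤ) E),
    (∀ (g : Fin n → ℤ) (e : E), G.length (g +ᵥ e) = G.length e) ∧
    (∀ (g : Fin n → ℤ) (e : E), G.endpoints (g +ᵥ e) = (fun v : V => g +ᵥ v) '' G.endpoints e) ∧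
    (∀ (g : Fin n → ℤ) (v : V), g +ᵥ v = v → g = 0) ∧
    (∀ (g : Fin n → ℤ) (e : E), g +ᵥ e = e → g = 0) ∧
    ∃ F : Set E, F.Finite ∧ ∀ e, ∃ g : Fin n → ℤ, ∃ f ∈ F, e = g +ᵥ f

/-- A pendant is a bounded edge with a vertex of degree one. -/
def HasPendant : Prop := ∃ e, G.length e ≠ ⊤ ∧ ∃ v ∈ G.endpoints e, G.degree v = 1

/-- The graph consists of one half-line and nothing else. -/
def IsHalfLine : Prop := Subsingleton E ∧ ∃ e, G.length e = ⊤

/-! A function on the graph is a family `u : E → ℝ → ℝ`, where `u e` is relevant on `interval e`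
only. -/

/-- Continuity on the graph: on every closed edge, with matching values at every vertex. -/
def ContinuousOnGraph (u : E → ℝ → ℝ) : Prop :=
  (∀ e, ContinuousOn (u e) (G.interval e)) ∧
  ∀ v, ∀ i ∈ G.ends v, ∀ j ∈ G.ends v, u i.1 (G.endCoord i) = u j.1 (G.endCoord j)

/-- `g` is the weak derivative of `f` in the open interval `interior I`. -/
def IsWeakDeriv (I : Set ℝ) (f g : ℝ → ℝ) : Prop :=
  ∀ η : ℝ → ℝ, ContDiff ℝ ∞ η → HasCompactSupport η → tsupport η ⊆ interior I →
    ∫ x in I, f x * deriv η x = - ∫ x in I, g x * η x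

/-- Square integrability over the whole graph. -/
def SquareIntegrable (f : E → ℝ → ℝ) : Prop :=
  (∀ e, MemLp (f e) 2 (volume.restrict (G.interval e))) ∧
  Summable fun e => ∫ x in G.interval e, f e x ^ 2

/-- The space `H¹` of the graph: continuous functions that are square integrable together with
their weak derivative. For the continuous representative the weak derivative on an edge is the
pointwise derivative, which then exists almost everywhere. -/
structure MemH1 (u : E → ℝ → ℝ) : Prop where
  continuous : G.ContinuousOnGraph u
  weakDeriv : ∀ e, IsWeakDeriv (G.interval e) (u e) (deriv (u e))
  sq_integrable : G.SquareIntegrable u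
  sq_integrable_deriv : G.SquareIntegrable fun e => deriv (u e)

/-- The mass, that is, the square of the `L²` norm. -/
noncomputable def mass (u : E → ℝ → ℝ) : ℝ := ∑' e, ∫ x in G.interval e, u e x ^ 2

/-- The energy `E(u, G) = ½ ‖u'‖₂² - (1/p) ‖u‖ₚᵖ`. -/
noncomputable def energy (p : ℝ) (u : E → ℝ → ℝ) : ℝ :=
  1 / 2 * (∑' e, ∫ x in G.interval e, deriv (u e) x ^ 2) -
    1 / p * ∑' e, ∫ x in G.interval e, |u e x| ^ p

/-- The derivative of `u` at an edge end, in the direction entering the edge. -/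
noncomputable def outDeriv (u : E → ℝ → ℝ) (i : E × Bool) : ℝ :=
  (if i.2 then -1 else 1) * derivWithin (u i.1) (G.interval i.1) (G.endCoord i)

/-- `u'' + u^(p-1) = lam u` on the edge `e`, up to the endpoints of `e`. -/
def SolvesOnEdge (p lam : ℝ) (u : E → ℝ → ℝ) (e : E) : Prop :=
  ∀ x ∈ G.interval e, DifferentiableWithinAt ℝ (u e) (G.interval e) x ∧
    HasDerivWithinAt (derivWithin (u e) (G.interval e)) (lam * u e x - u e x ^ (p - 1))
      (G.interval e) x

/-- Positive `H¹` solutions of the nonlinear Schrödinger equation with Kirchhoff conditions. -/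
structure IsPositiveSolution (p lam : ℝ) (u : E → ℝ → ℝ) : Prop where
  memH1 : G.MemH1 u
  pos : ∀ e, ∀ x ∈ G.interval e, 0 < u e x
  equation : ∀ e, G.SolvesOnEdge p lam u e
  kirchhoff : ∀ v, ∑ᶠ i ∈ G.ends v, G.outDeriv u i = 0

/-- The positive solutions of mass `μ`, for some real `lam`. -/
def solutionSet (p μ : ℝ) : Set (E → ℝ → ℝ) :=
  {u | G.mass u = μ ∧ ∃ lam : ℝ, G.IsPositiveSolution p lam u}

end MetricGraph

/-- The energy on an interval `I` of the real line. -/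
noncomputable def lineEnergy (p : ℝ) (I : Set ℝ) (f : ℝ → ℝ) : ℝ :=
  1 / 2 * (∫ x in I, deriv f x ^ 2) - 1 / p * ∫ x in I, |f x| ^ p

/-- The even positive `H¹` solution of `w'' + w^(p-1) = lam w` on the real line,
`(p lam / 2)^(1/(p-2)) sech^(2/(p-2)) ((p-2)/2 √lam x)`. -/
noncomputable def lineSolution (p lam : ℝ) (x : ℝ) : ℝ :=
  (p * lam / 2) ^ (1 / (p - 2)) * Real.cosh ((p - 2) / 2 * √lam * x) ^ (-(2 / (p - 2)))

/-- The frequency at which the solution on the real line has mass `μ`. -/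
noncomputable def solitonFrequency (p μ : ℝ) : ℝ :=
  (μ / ∫ x, lineSolution p 1 x ^ 2) ^ (2 * (p - 2) / (6 - p))

/-- The soliton `φ_{μ,1}` of mass `μ` on the real line. -/
noncomputable def soliton (p μ : ℝ) : ℝ → ℝ := lineSolution p (solitonFrequency p μ)

/-- `lineSolution` solves the equation, is positive and is maximal at the origin. -/
theorem lineSolution_spec {p lam : ℝ} (hp : 2 < p) (hlam : 0 < lam) :
    (∀ x, DifferentiableAt ℝ (lineSolution p lam) x ∧ HasDerivAt (deriv (lineSolution p lam))
      (lam * lineSolution p lam x - lineSolution p lam x ^ (p - 1)) x) ∧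
    (∀ x, 0 < lineSolution p lam x) ∧ ∀ x, lineSolution p lam x ≤ lineSolution p lam 0 := by
  have hp2 : 0 < p - 2 := by linarith
  have hA : 0 < p * lam / 2 := by positivity
  set A := (p * lam / 2) ^ (1 / (p - 2)) with hAdef
  have hA0 : 0 < A := Real.rpow_pos_of_pos hA _
  set b := (p - 2) / 2 * √lam with hb
  have hpos : ∀ x, 0 < lineSolution p lam x := fun x =>
    mul_pos hA0 (Real.rpow_pos_of_pos (Real.cosh_pos _) _)
  have hlin : ∀ x, HasDerivAt (fun y : ℝ => b * y) b x := fun x => by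
    simpa using (hasDerivAt_id x).const_mul b
  have hc : ∀ x, HasDerivAt (fun y => Real.cosh (b * y)) (Real.sinh (b * x) * b) x :=
    fun x => (hlin x).cosh
  have hs : ∀ x, HasDerivAt (fun y => Real.sinh (b * y)) (Real.cosh (b * x) * b) x :=
    fun x => (hlin x).sinh
  have hpw : ∀ r x, HasDerivAt (fun y => Real.cosh (b * y) ^ (r : ℝ))
      (Real.sinh (b * x) * b * r * Real.cosh (b * x) ^ (r - 1)) x :=
    fun r x => (hc x).rpow_const (Or.inl (Real.cosh_pos _).ne')
  set k := 2 / (p - 2) with hk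
  have hk0 : k * (p - 2) = 2 := by rw [hk]; field_simp
  have hd : ∀ x, HasDerivAt (lineSolution p lam)
      (A * (Real.sinh (b * x) * b * (-k) * Real.cosh (b * x) ^ (-k - 1))) x :=
    fun x => (hpw (-k) x).const_mul A
  have hderiv : deriv (lineSolution p lam) =
      fun x => A * (Real.sinh (b * x) * b * (-k) * Real.cosh (b * x) ^ (-k - 1)) :=
    funext fun x => (hd x).deriv
  refine ⟨fun x => ⟨(hd x).differentiableAt, ?_⟩, hpos, fun x => ?_⟩
  · rw [hderiv]
    have h := ((((hs x).mul_const b).mul_const (-k)).mul (hpw (-k - 1) x)).const_mul A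
    refine h.congr_deriv ?_
    symm
    have hC : 0 < Real.cosh (b * x) := Real.cosh_pos _
    have hsq : Real.cosh (b * x) ^ 2 = Real.sinh (b * x) ^ 2 + 1 := Real.cosh_sq _
    have e1 : Real.cosh (b * x) ^ (-k - 1) = Real.cosh (b * x) ^ (-k - 2) * Real.cosh (b * x) := by
      rw [show -k - 1 = (-k - 2) + 1 by ring, Real.rpow_add_one hC.ne']
    have e2 : Real.cosh (b * x) ^ (-k) = Real.cosh (b * x) ^ (-k - 2) * Real.cosh (b * x) ^ 2 := by
      rw [show -k = (-k - 2) + (2 : ℕ) by push_cast; ring, Real.rpow_add_natCast hC.ne']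
      ring_nf
    have eA : A ^ (p - 1) = p * lam / 2 * A := by
      rw [show p - 1 = (p - 2) + 1 by ring, Real.rpow_add_one hA0.ne', hAdef,
        ← Real.rpow_mul hA.le, one_div_mul_cancel hp2.ne', Real.rpow_one]
    have eL : lineSolution p lam x ^ (p - 1) =
        p * lam / 2 * A * Real.cosh (b * x) ^ (-k - 2) := by
      change (A * Real.cosh (b * x) ^ (-k)) ^ (p - 1) = _
      rw [Real.mul_rpow hA0.le (Real.rpow_nonneg hC.le _), eA, ← Real.rpow_mul hC.le]
      congr 2
      linear_combination -hk0
    rw [eL]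
    change lam * (A * Real.cosh (b * x) ^ (-k)) - _ = _
    rw [show -k - 1 - 1 = -k - 2 by ring, e1, e2]
    have hbk : b * k = √lam := by rw [hb]; linear_combination (√lam / 2) * hk0
    have hbk2 : b ^ 2 * k ^ 2 = lam := by
      rw [← mul_pow, hbk, Real.sq_sqrt hlam.le]
    have hb2k : b ^ 2 * k = lam * (p - 2) / 2 := by
      have : b ^ 2 * k = b ^ 2 * k ^ 2 * ((p - 2) / 2) := by
        linear_combination (-(b ^ 2 * k) / 2) * hk0
      rw [this, hbk2]; ring
    generalize Real.cosh (b * x) ^ (-k - 2) = Q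
    generalize Real.cosh (b * x) = C at *
    generalize Real.sinh (b * x) = S at *
    linear_combination (A * Q * b ^ 2 * k * (k + 1)) * hsq - A * Q * C ^ 2 * hbk2 + A * Q * hbk2 +
      A * Q * hb2k
  · change A * _ ≤ A * _
    refine mul_le_mul_of_nonneg_left ?_ hA0.le
    rw [mul_zero, Real.cosh_zero, Real.one_rpow]
    exact Real.rpow_le_one_of_one_le_of_nonpos (Real.one_le_cosh _) (by rw [neg_nonpos]; positivity)

theorem integrable_lineSolution_sq {p lam : ℝ} (hp : 2 < p) (hlam : 0 < lam) :
    Integrable fun x => lineSolution p lam x ^ 2 := by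
  have hp2 : 0 < p - 2 := by linarith
  set b := (p - 2) / 2 * √lam with hb
  have hb0 : 0 < b := by rw [hb]; have := Real.sqrt_pos.2 hlam; positivity
  set k := 2 / (p - 2) with hk
  have hk0 : 0 < k := by rw [hk]; positivity
  have hcont : Continuous (lineSolution p lam) := by
    have : lineSolution p lam = fun x => (p * lam / 2) ^ (1 / (p - 2)) * Real.cosh (b * x) ^ (-k) :=
      rfl
    rw [this]
    exact continuous_const.mul (((Real.continuous_cosh.comp (continuous_const_mul b))).rpow_const
      fun x => Or.inl (Real.cosh_pos _).ne')
  have hexp : Integrable fun x : ℝ => Real.exp (-(2 * k * b) * |x|) := by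
    have hc : 0 < 2 * k * b := by positivity
    rw [← integrableOn_univ, ← Iic_union_Ioi (a := (0 : ℝ)), integrableOn_union]
    constructor
    · refine (integrableOn_exp_mul_Iic hc 0).congr_fun (fun x hx => ?_) measurableSet_Iic
      simp only [abs_of_nonpos (mem_Iic.1 hx), neg_mul_neg]
    · refine (integrableOn_exp_mul_Ioi (neg_lt_zero.2 hc) 0).congr_fun (fun x hx => ?_)
        measurableSet_Ioi
      simp only [abs_of_pos (mem_Ioi.1 hx)]
  refine (hexp.const_mul (((p * lam / 2) ^ (1 / (p - 2))) ^ 2 * 2 ^ (2 * k))).mono'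
    (hcont.pow 2).aestronglyMeasurable (Eventually.of_forall fun x => ?_)
  rw [Real.norm_of_nonneg (sq_nonneg _)]
  change ((p * lam / 2) ^ (1 / (p - 2)) * Real.cosh (b * x) ^ (-k)) ^ 2 ≤ _
  rw [mul_pow, mul_assoc (((p * lam / 2) ^ (1 / (p - 2))) ^ 2)]
  refine mul_le_mul_of_nonneg_left ?_ (sq_nonneg _)
  have hC : Real.exp (b * |x|) / 2 ≤ Real.cosh (b * x) := by
    rw [← Real.cosh_abs, abs_mul, abs_of_pos hb0, Real.cosh_eq]
    have := Real.exp_pos (-(b * |x|))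
    linarith
  calc (Real.cosh (b * x) ^ (-k)) ^ 2 ≤ ((Real.exp (b * |x|) / 2) ^ (-k)) ^ 2 := by
        gcongr ?_ ^ 2
        exact Real.rpow_le_rpow_of_nonpos (by positivity) hC (by linarith)
    _ = 2 ^ (2 * k) * Real.exp (-(2 * k * b) * |x|) := by
        rw [← Real.rpow_natCast, ← Real.rpow_mul (by positivity), Real.div_rpow (by positivity)
          (by positivity), ← Real.exp_mul, div_eq_mul_inv, ← Real.rpow_neg (by positivity), mul_comm]
        congr 2 <;> push_cast <;> ring

/-- The soliton has the prescribed mass, and its frequency is positive. -/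
theorem soliton_mass {p μ : ℝ} (hp : 6 < p) (hμ : 0 < μ) :
    0 < solitonFrequency p μ ∧ ∫ x, soliton p μ x ^ 2 = μ := by
  have hp2 : 0 < p - 2 := by linarith
  have hp6 : 6 - p ≠ 0 := by linarith
  set m := ∫ x, lineSolution p 1 x ^ 2 with hm
  have hm0 : 0 < m := by
    have hcont : Continuous fun x => lineSolution p 1 x ^ 2 :=
      (continuous_iff_continuousAt.2 fun x =>
        ((lineSolution_spec (by linarith) one_pos).1 x).1.continuousAt).pow 2
    exact integral_pos_of_integrable_nonneg_nonzero hcont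
      (integrable_lineSolution_sq (by linarith) one_pos) (fun x => sq_nonneg _) (x := 0)
      (pow_pos ((lineSolution_spec (by linarith) one_pos).2.1 0) 2).ne'
  have hf : 0 < solitonFrequency p μ := Real.rpow_pos_of_pos (div_pos hμ hm0) _
  refine ⟨hf, ?_⟩
  have hscale : ∀ lam : ℝ, 0 < lam → ∀ x, lineSolution p lam x ^ 2 =
      lam ^ (2 / (p - 2)) * lineSolution p 1 (√lam * x) ^ 2 := by
    intro lam hlam x
    unfold lineSolution
    rw [Real.sqrt_one, mul_one, mul_one, ← mul_assoc ((p - 2) / 2) √lam x,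
      show p * lam / 2 = lam * (p / 2) by ring,
      Real.mul_rpow hlam.le (by positivity),
      show 2 / (p - 2) = 1 / (p - 2) * (2 : ℕ) by push_cast; ring,
      Real.rpow_mul hlam.le, Real.rpow_natCast]
    ring
  have hs : 0 < √(solitonFrequency p μ) := Real.sqrt_pos.2 hf
  unfold soliton
  simp_rw [hscale _ hf]
  rw [integral_const_mul, Measure.integral_comp_mul_left (fun y => lineSolution p 1 y ^ 2),
    ← hm, smul_eq_mul, abs_of_pos (inv_pos.2 hs), Real.sqrt_eq_rpow, ← Real.rpow_neg hf.le,
    ← mul_assoc, ← Real.rpow_add hf]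
  unfold solitonFrequency
  rw [← hm, ← Real.rpow_mul (div_pos hμ hm0).le,
    show 2 * (p - 2) / (6 - p) * (2 / (p - 2) + -(1 / 2)) = 1 by field_simp; ring,
    Real.rpow_one, div_mul_cancel₀ _ hm0.ne']

/-! The frequency `lam` of a positive solution of small mass `μ` must be large, and it then
determines both the mass and the energy up to lower order terms. Sign of `lam`: on a half-line the
mechanical energy `nlsEnergy` vanishes, which forces `lam > 0`. On a periodic graph a negative `lam`
makes `u` concave on the edges; testing the equation against slowly varying summable weights, which
exist because ℤⁿ is amenable, contradicts the Kirchhoff conditions (`nonneg_of_periodic`). Size of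
`lam`: with `lam ≥ 0`, the Nehari identity bounds the kinetic term by `M ^ (p - 2) * μ`, where `M`
is the maximum. The Gagliardo–Nirenberg inequality `max_sq_le` then gives `1 ≤ 2 * μ * M ^ ((p - 6)
/ 2)`, so `M` is large because `p > 6`. If `lam` were small compared with `M ^ (p - 2)`, the edge of
the maximum would carry a large mechanical energy; the Riccati equation for `u' / u` would then
prevent `u` from staying positive along a length `ℓ` (`energy_rpow_le`). Mass: the same Riccati
bound shows that on every edge the mechanical energy is at most a small multiple of its natural
scale, so `u` descends at most slightly faster than the soliton of frequency `lam`. At its maximum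
`u` is nearly as high as this soliton, and every piece of edge of length `ℓ / 2` has a point where
`u` is small. One descent costs at least nearly half of the mass of the soliton. If all degrees are
at least two, there are two disjoint descents, the second one possibly through a vertex, which cost
nearly the full mass. As the mass of the soliton decreases with its frequency for `p > 6`, this
bounds `lam` below by nearly the frequency of the soliton of mass `μ`, or `2 * μ`. Energy: the
Nehari identity and the integrated mechanical energy give `E ≥ μ * ((p - 6) / (2 * (p + 2)) * lam -
o(lam))`. The soliton satisfies this with equality and no error, and the two bounds combine in
`eventually_energy_ge`. -/

/-! ### Positive solutions of the stationary equation on an interval -/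

/-- `f > 0` solves `f'' + f ^ (p - 1) = lam f` on `I`, and `f'` is its derivative. -/
structure NLSOn (p lam : ℝ) (I : Set ℝ) (f f' : ℝ → ℝ) : Prop where
  fst : ∀ x ∈ I, HasDerivWithinAt f (f' x) I x
  snd : ∀ x ∈ I, HasDerivWithinAt f' (lam * f x - f x ^ (p - 1)) I x
  pos : ∀ x ∈ I, 0 < f x

/-- The mechanical energy, constant along solutions. -/
noncomputable def nlsEnergy (p lam s d : ℝ) : ℝ := d ^ 2 / 2 + s ^ p / p - lam * s ^ 2 / 2

theorem exists_sq_le_average {g : ℝ → ℝ} {a b : ℝ} (hab : a < b) (hg : ContinuousOn g (Icc a b)) :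
    ∃ y ∈ Icc a b, g y ^ 2 * (b - a) ≤ ∫ x in a..b, g x ^ 2 := by
  obtain ⟨y, hy, hmin⟩ := isCompact_Icc.exists_isMinOn (nonempty_Icc.2 hab.le) (hg.pow 2)
  refine ⟨y, hy, ?_⟩
  have h1 : ∫ x in a..b, g y ^ 2 ≤ ∫ x in a..b, g x ^ 2 := by
    refine intervalIntegral.integral_mono_on hab.le (by simp) ?_ fun x hx => hmin hx
    exact (hg.pow 2).intervalIntegrable_of_Icc hab.le
  simpa [mul_comm] using h1

theorem abs_sub_le_integral {F F' φ : ℝ → ℝ} {a b x y : ℝ}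
    (hF : ∀ z ∈ Icc a b, HasDerivWithinAt F (F' z) (Icc a b) z) (hφ : ContinuousOn φ (Icc a b))
    (hle : ∀ z ∈ Icc a b, |F' z| ≤ φ z) (hx : x ∈ Icc a b) (hy : y ∈ Icc a b) :
    |F y - F x| ≤ ∫ z in a..b, φ z := by
  wlog hxy : x ≤ y generalizing x y
  · rw [abs_sub_comm]; exact this hy hx (le_of_not_ge hxy)
  have hsub : Icc x y ⊆ Icc a b := Icc_subset_Icc hx.1 hy.2
  have hc : ContinuousOn F (Icc x y) := fun z hz => ((hF z (hsub hz)).mono hsub).continuousWithinAt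
  have hd : ∀ z ∈ Ioo x y, HasDerivAt F (F' z) z := fun z hz =>
    (hF z (hsub (Ioo_subset_Icc_self hz))).hasDerivAt
      (Icc_mem_nhds (hx.1.trans_lt hz.1) (hz.2.trans_le hy.2))
  have hint : IntegrableOn φ (Icc x y) := (hφ.mono hsub).integrableOn_Icc
  have hab : a ≤ b := hx.1.trans hx.2
  have h1 : F y - F x ≤ ∫ z in x..y, φ z :=
    intervalIntegral.sub_le_integral_of_hasDeriv_right_of_le hxy hc
      (fun z hz => (hd z hz).hasDerivWithinAt) hint
      fun z hz => (le_abs_self _).trans (hle z (hsub (Ioo_subset_Icc_self hz)))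
  have h2 : (-F) y - (-F) x ≤ ∫ z in x..y, φ z :=
    intervalIntegral.sub_le_integral_of_hasDeriv_right_of_le hxy hc.neg
      (fun z hz => (hd z hz).neg.hasDerivWithinAt) hint
      fun z hz => (neg_le_abs _).trans (hle z (hsub (Ioo_subset_Icc_self hz)))
  have h3 : ∫ z in x..y, φ z ≤ ∫ z in a..b, φ z := by
    refine intervalIntegral.integral_mono_interval hx.1 hxy hy.2 ?_
      (hφ.intervalIntegrable_of_Icc hab)
    rw [Filter.EventuallyLE, ae_restrict_iff' measurableSet_Ioc]
    exact Eventually.of_forall fun z hz => (abs_nonneg _).trans (hle z (Ioc_subset_Icc_self hz))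
  simp only [Pi.neg_apply] at h2
  exact abs_le.2 ⟨by linarith, by linarith⟩

/-- A Sobolev inequality on a bounded interval. -/
theorem sq_le_integral_add {g g' : ℝ → ℝ} {a b x : ℝ} (hab : a < b)
    (hg : ∀ z ∈ Icc a b, HasDerivWithinAt g (g' z) (Icc a b) z) (hg' : ContinuousOn g' (Icc a b))
    (hx : x ∈ Icc a b) :
    g x ^ 2 ≤ (1 / (b - a) + 1) * (∫ z in a..b, g z ^ 2) + ∫ z in a..b, g' z ^ 2 := by
  have hc : ContinuousOn g (Icc a b) := fun z hz => (hg z hz).continuousWithinAt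
  obtain ⟨y, hy, hy2⟩ := exists_sq_le_average hab hc
  -- Start from a point `y` where `g²` is at most its average and use `|(g²)'| = |2 g g'| ≤ g² +
  -- g'²`.
  have h := abs_sub_le_integral (F := fun z => g z ^ 2) (F' := fun z => 2 * g z * g' z)
    (φ := fun z => g z ^ 2 + g' z ^ 2) (x := y) (y := x) (fun z hz => by
      simpa using! (hg z hz).pow 2) ((hc.pow 2).add (hg'.pow 2))
    (fun z _ => abs_le.2 ⟨by nlinarith [sq_nonneg (g z + g' z)],
      by nlinarith [sq_nonneg (g z - g' z)]⟩) hy hx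
  have i1 : IntervalIntegrable (fun z => g z ^ 2) volume a b :=
    (hc.pow 2).intervalIntegrable_of_Icc hab.le
  have i2 : IntervalIntegrable (fun z => g' z ^ 2) volume a b :=
    (hg'.pow 2).intervalIntegrable_of_Icc hab.le
  rw [intervalIntegral.integral_add i1 i2] at h
  have h0 : g y ^ 2 ≤ 1 / (b - a) * ∫ z in a..b, g z ^ 2 := by
    rw [one_div, inv_mul_eq_div, le_div_iff₀ (by linarith)]; exact hy2
  have := le_abs_self (g x ^ 2 - g y ^ 2)
  linarith

namespace NLSOn

variable {p lam : ℝ} {I J : Set ℝ} {f f' : ℝ → ℝ}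

theorem mono (h : NLSOn p lam I f f') (hJ : J ⊆ I) : NLSOn p lam J f f' :=
  ⟨fun x hx => (h.fst x (hJ hx)).mono hJ, fun x hx => (h.snd x (hJ hx)).mono hJ,
    fun x hx => h.pos x (hJ hx)⟩

theorem continuousOn (h : NLSOn p lam I f f') : ContinuousOn f I :=
  fun x hx => (h.fst x hx).continuousWithinAt

theorem continuousOn_deriv (h : NLSOn p lam I f f') : ContinuousOn f' I :=
  fun x hx => (h.snd x hx).continuousWithinAt

theorem continuousOn_rpow (h : NLSOn p lam I f f') (r : ℝ) : ContinuousOn (fun x => f x ^ r) I :=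
  h.continuousOn.rpow_const fun x hx => Or.inl (h.pos x hx).ne'

theorem hasDerivAt_fst {a b x : ℝ} (h : NLSOn p lam (Icc a b) f f') (hx : x ∈ Ioo a b) :
    HasDerivAt f (f' x) x :=
  (h.fst x (Ioo_subset_Icc_self hx)).hasDerivAt (Icc_mem_nhds hx.1 hx.2)

theorem hasDerivAt_snd {a b x : ℝ} (h : NLSOn p lam (Icc a b) f f') (hx : x ∈ Ioo a b) :
    HasDerivAt f' (lam * f x - f x ^ (p - 1)) x :=
  (h.snd x (Ioo_subset_Icc_self hx)).hasDerivAt (Icc_mem_nhds hx.1 hx.2)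

theorem rpow_sub_one_mul {s : ℝ} (hs : 0 < s) (p : ℝ) : s ^ (p - 1) = s ^ (p - 2) * s := by
  rw [← Real.rpow_add_one hs.ne']; ring_nf

theorem rpow_eq_mul_sq {s : ℝ} (hs : 0 < s) (p : ℝ) : s ^ p = s ^ (p - 2) * s ^ 2 := by
  rw [← Real.rpow_natCast s 2, ← Real.rpow_add hs]; norm_num

/-- Conservation of energy. -/
theorem energy_eq (h : NLSOn p lam I f f') (hp : p ≠ 0) (hI : Convex ℝ I) {x y : ℝ} (hx : x ∈ I)
    (hy : y ∈ I) : nlsEnergy p lam (f x) (f' x) = nlsEnergy p lam (f y) (f' y) := by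
  have hd : ∀ z ∈ I, HasDerivWithinAt (fun z => nlsEnergy p lam (f z) (f' z)) 0 I z := by
    intro z hz
    have h1 := (((h.snd z hz).pow 2).div_const 2).add
      (((h.fst z hz).rpow_const (p := p) (Or.inl (h.pos z hz).ne')).div_const p)
    have h2 := h1.sub ((((h.fst z hz).pow 2).const_mul lam).div_const 2)
    refine h2.congr_deriv ?_
    simp only [Nat.cast_ofNat, Nat.add_one_sub_one, pow_one]
    field_simp
    ring
  have := hI.norm_image_sub_le_of_norm_hasDerivWithin_le hd (C := 0) (by simp) hx hy
  rw [zero_mul, norm_le_zero_iff, sub_eq_zero] at this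
  exact this.symm

/-! ### The Riccati equation and bounds on the mechanical energy -/

/-- Positivity allows division by `f`, which turns the equation into a Riccati equation for `v = f'
/ f`. Both bounds on the energy constant come from it. -/
theorem hasDerivAt_log_deriv {a b x : ℝ} (h : NLSOn p lam (Icc a b) f f') (hx : x ∈ Ioo a b) :
    HasDerivAt (fun z => f' z / f z) (lam - f x ^ (p - 2) - (f' x / f x) ^ 2) x := by
  have hpos := h.pos x (Ioo_subset_Icc_self hx)
  refine ((h.hasDerivAt_snd hx).div (h.hasDerivAt_fst hx) hpos.ne').congr_deriv ?_
  rw [rpow_sub_one_mul hpos]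
  field_simp

theorem continuousOn_log_deriv (h : NLSOn p lam I f f') : ContinuousOn (fun z => f' z / f z) I :=
  h.continuousOn_deriv.div h.continuousOn fun x hx => (h.pos x hx).ne'

/-- Eliminates `v²` from the Riccati equation, leaving `v' = -(1 - 2 / p) f ^ (p - 2) - 2 C / f²`.
-/
theorem log_deriv_sq {C s d : ℝ} (hs : 0 < s) (hp : p ≠ 0) (hC : nlsEnergy p lam s d = C) :
    (d / s) ^ 2 = lam - 2 / p * s ^ (p - 2) + 2 * C / s ^ 2 := by
  rw [← hC, nlsEnergy, rpow_eq_mul_sq hs p]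
  field_simp
  ring

/-- At a point where `f²` is at most its average, drop the two nonnegative terms of the energy. -/
theorem energy_ge {a b C : ℝ} (h : NLSOn p lam (Icc a b) f f') (hp : 0 < p) (hlam : 0 ≤ lam)
    (hab : a < b) (hC : ∀ x ∈ Icc a b, nlsEnergy p lam (f x) (f' x) = C) :
    -(lam / (2 * (b - a)) * ∫ x in a..b, f x ^ 2) ≤ C := by
  obtain ⟨y, hy, hy2⟩ := exists_sq_le_average hab h.continuousOn
  rw [← hC y hy, nlsEnergy]
  have h1 : 0 ≤ f y ^ p := Real.rpow_nonneg (h.pos y hy).le p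
  have h2 : 0 ≤ f y ^ p / p := by positivity
  have h3 : lam / (2 * (b - a)) * (f y ^ 2 * (b - a)) ≤
      lam / (2 * (b - a)) * ∫ x in a..b, f x ^ 2 :=
    mul_le_mul_of_nonneg_left hy2 (div_nonneg hlam (by linarith))
  have h4 : lam / (2 * (b - a)) * (f y ^ 2 * (b - a)) = lam * f y ^ 2 / 2 := by
    have : b - a ≠ 0 := by linarith
    field_simp
  nlinarith [sq_nonneg (f' y)]

/-- A solution with negative energy has a small energy density compared to its mass. -/
theorem neg_energy_le {a b C : ℝ} (h : NLSOn p lam (Icc a b) f f') (hp : 6 < p) (hlam : 0 < lam)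
    (hab : a < b) (hC : ∀ x ∈ Icc a b, nlsEnergy p lam (f x) (f' x) = C) :
    2 * -C * (b - a) ^ 2 ≤ (∫ x in a..b, f x ^ 2) *
      (2 * √lam + (p * lam / 2) ^ ((p - 4) / (p - 2)) * ∫ x in a..b, f x ^ 2) := by
  set J := ∫ x in a..b, f x ^ 2 with hJ
  set D := (p * lam / 2) ^ ((p - 4) / (p - 2)) with hD
  have hD0 : 0 ≤ D := by positivity
  have hJ0 : 0 < J := intervalIntegral.intervalIntegral_pos_of_pos_on
    ((h.continuousOn.pow 2).intervalIntegrable_of_Icc hab.le)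
    (fun x hx => pow_pos (h.pos x (Ioo_subset_Icc_self hx)) 2) hab
  rcases le_or_gt 0 C with hC0 | hC0
  · have : 0 ≤ J * (2 * √lam + D * J) := by positivity
    nlinarith [sq_nonneg (b - a)]
  -- For `C < 0` the formula for `v²` bounds both `v` and `f`. So `v` varies by at most `2√lam`,
  -- whereas `v'` is at least `2|C| / f²` up to a multiple of `f²`.
  have hv : ∀ x ∈ Icc a b, |f' x / f x| ≤ √lam := by
    intro x hx
    have hs := h.pos x hx
    rw [← Real.sqrt_sq_eq_abs]
    refine Real.sqrt_le_sqrt ?_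
    rw [log_deriv_sq hs (by linarith) (hC x hx)]
    have h1 : 0 ≤ 2 / p * f x ^ (p - 2) := by positivity
    have h2 : 2 * C / f x ^ 2 ≤ 0 := div_nonpos_of_nonpos_of_nonneg (by linarith) (by positivity)
    linarith
  have hq : ∀ x ∈ Icc a b, f x ^ (p - 2) ≤ D * f x ^ 2 := by
    intro x hx
    have hs := h.pos x hx
    have h1 : 0 ≤ lam - 2 / p * f x ^ (p - 2) + 2 * C / f x ^ 2 := by
      rw [← log_deriv_sq hs (by linarith) (hC x hx)]; positivity
    have h2 : 2 * C / f x ^ 2 ≤ 0 := div_nonpos_of_nonpos_of_nonneg (by linarith) (by positivity)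
    have h3 : f x ^ (p - 2) ≤ p * lam / 2 := by
      have h4 : 2 / p * f x ^ (p - 2) ≤ lam := by linarith
      rw [div_mul_eq_mul_div, div_le_iff₀ (by linarith)] at h4
      linarith
    have h5 : f x ^ (p - 4) ≤ D := by
      have h6 : f x ^ (p - 4) = (f x ^ (p - 2)) ^ ((p - 4) / (p - 2)) := by
        rw [← Real.rpow_mul hs.le, mul_div_cancel₀ _ (by linarith : p - 2 ≠ 0)]
      rw [h6]
      exact Real.rpow_le_rpow (by positivity) h3 (div_nonneg (by linarith) (by linarith))
    rw [rpow_eq_mul_sq hs (p - 2), show p - 2 - 2 = p - 4 by ring]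
    exact mul_le_mul_of_nonneg_right h5 (by positivity)
  -- The inverse of the mean of `f²`. The tangent line `1 / s ≥ 2α - α² s` at `s = 1 / α` replaces
  -- `∫ 1 / f² ≥ (b - a)² / J`, the Cauchy–Schwarz inequality.
  set α := (b - a) / J with hα
  have hα0 : 0 < α := div_pos (by linarith) hJ0
  have key := intervalIntegral.integral_le_sub_of_hasDeriv_right_of_le hab.le
    h.continuousOn_log_deriv (fun x hx => (h.hasDerivAt_log_deriv hx).hasDerivWithinAt)
    (φ := fun x => 4 * -C * α - (D + 2 * -C * α ^ 2) * f x ^ 2)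
    (continuousOn_const.sub (continuousOn_const.mul (h.continuousOn.pow 2))).integrableOn_Icc
    (fun x hx => by
      have hx' := Ioo_subset_Icc_self hx
      have hs := h.pos x hx'
      rw [log_deriv_sq hs (by linarith) (hC x hx')]
      have h1 := hq x hx'
      have h2 : 2 * -C * (2 * α - α ^ 2 * f x ^ 2) ≤ 2 * -C / f x ^ 2 := by
        rw [mul_div_assoc]
        simp only [mul_assoc]
        refine mul_le_mul_of_nonneg_left (mul_le_mul_of_nonneg_left ?_ (by linarith)) (by norm_num)
        rw [← one_div, le_div_iff₀ (by positivity)]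
        nlinarith [sq_nonneg (α * f x ^ 2 - 1)]
      have h3 : 0 ≤ 2 / p * f x ^ (p - 2) := by positivity
      have h4 : 2 * -C / f x ^ 2 = -(2 * C / f x ^ 2) := by ring
      nlinarith)
  have i1 : IntervalIntegrable (fun x => f x ^ 2) volume a b :=
    (h.continuousOn.pow 2).intervalIntegrable_of_Icc hab.le
  rw [intervalIntegral.integral_sub (by simp) (i1.const_mul _),
    intervalIntegral.integral_const_mul (D + 2 * -C * α ^ 2), intervalIntegral.integral_const,
    ← hJ, smul_eq_mul] at key
  have hb := (abs_le.1 (hv b (right_mem_Icc.2 hab.le))).2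
  have ha := (abs_le.1 (hv a (left_mem_Icc.2 hab.le))).1
  have hαJ : α * J = b - a := div_mul_cancel₀ _ hJ0.ne'
  have e1 : (b - a) * (4 * -C * α) - (D + 2 * -C * α ^ 2) * J =
      2 * -C * (b - a) * α - D * J := by
    rw [← hαJ]; ring
  rw [e1] at key
  have e2 : 2 * -C * (b - a) ^ 2 = J * (2 * -C * (b - a) * α) := by
    rw [pow_two, ← hαJ]; ring
  rw [e2]
  exact mul_le_mul_of_nonneg_left (by linarith) hJ0.le

/-- A solution that stays positive on a long interval has small energy. -/
theorem energy_rpow_le {a b C Λ : ℝ} (h : NLSOn p lam (Icc a b) f f') (hp : 6 < p)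
    (hab : a < b) (hC : ∀ x ∈ Icc a b, nlsEnergy p lam (f x) (f' x) = C) (hC0 : 0 < C)
    (hΛ : lam ≤ Λ) (hΛ2 : (2 * Real.pi / (b - a)) ^ 2 ≤ Λ) :
    C ^ ((p - 2) / p) ≤ 8 * Real.pi * √Λ / (b - a) := by
  have hπ := Real.pi_pos
  have hℓ : 0 < b - a := by linarith
  have hΛ0 : 0 < Λ := lt_of_lt_of_le (by positivity) hΛ2
  set B := C ^ ((p - 2) / p) / 2 with hB
  have hB0 : 0 < B := by positivity
  set S := √Λ with hS
  have hS0 : 0 < S := Real.sqrt_pos.2 hΛ0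
  have hS2 : S ^ 2 = Λ := Real.sq_sqrt hΛ0.le
  have hSl : 2 * Real.pi / (b - a) ≤ S := Real.le_sqrt_of_sq_le hΛ2
  -- The weight for which `(1 - κ)(-B) + κ(Λ - v²) = -κ(Λ + v²)`: it merges the two upper bounds
  -- `-B` and `Λ - v²` of `v'`.
  set κ := B / (B + 2 * Λ) with hκ
  have hκ0 : 0 < κ := by positivity
  -- The right side is `-v'`. If `f ^ p ≤ C` the second term is large, otherwise the first one is.
  have hq : ∀ x ∈ Icc a b, B ≤ (1 - 2 / p) * f x ^ (p - 2) + 2 * C / f x ^ 2 := by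
    intro x hx
    have hs := h.pos x hx
    have hr : 0 < C ^ ((p - 2) / p) := by positivity
    have h2p : 2 / p ≤ 1 / 2 := by rw [div_le_div_iff₀ (by linarith) (by norm_num)]; linarith
    have hpos1 : 0 ≤ 2 * C / f x ^ 2 := by positivity
    have hpos2 : 0 < f x ^ (p - 2) := by positivity
    rcases le_total (f x ^ p) C with hc | hc
    · have h1 : f x ≤ C ^ (1 / p) := by
        have := Real.rpow_le_rpow (by positivity) hc (show 0 ≤ 1 / p by positivity)
        rwa [← Real.rpow_mul hs.le, mul_one_div_cancel (by linarith : p ≠ 0), Real.rpow_one] at this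
      have h2 : f x ^ 2 ≤ C ^ (2 / p) := by
        have := pow_le_pow_left₀ hs.le h1 2
        rwa [← Real.rpow_natCast (C ^ (1 / p)), ← Real.rpow_mul hC0.le,
          show 1 / p * ((2 : ℕ) : ℝ) = 2 / p by push_cast; ring] at this
      have h3 : C ^ ((p - 2) / p) ≤ C / f x ^ 2 := by
        rw [le_div_iff₀ (by positivity)]
        calc C ^ ((p - 2) / p) * f x ^ 2 ≤ C ^ ((p - 2) / p) * C ^ (2 / p) := by gcongr
          _ = C := by
            rw [← Real.rpow_add hC0, ← add_div, sub_add_cancel, div_self (by linarith : p ≠ 0),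
              Real.rpow_one]
      have h4 : 2 * C / f x ^ 2 = 2 * (C / f x ^ 2) := by ring
      have h5 : 0 ≤ (1 - 2 / p) * f x ^ (p - 2) := mul_nonneg (by linarith) hpos2.le
      rw [hB]; linarith
    · have h1 : C ^ ((p - 2) / p) ≤ f x ^ (p - 2) := by
        have := Real.rpow_le_rpow hC0.le hc
          (show 0 ≤ (p - 2) / p from div_nonneg (by linarith) (by linarith))
        rwa [← Real.rpow_mul hs.le, mul_div_cancel₀ _ (by linarith : p ≠ 0)] at this
      have h2 : 1 / 2 * f x ^ (p - 2) ≤ (1 - 2 / p) * f x ^ (p - 2) :=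
        mul_le_mul_of_nonneg_right (by linarith) hpos2.le
      rw [hB]; linarith
  have hder : ∀ x ∈ Ioo a b, lam - f x ^ (p - 2) - (f' x / f x) ^ 2 ≤
      -(κ * (Λ + (f' x / f x) ^ 2)) := by
    intro x hx
    have hx' := Ioo_subset_Icc_self hx
    have hs := h.pos x hx'
    have h1 := hq x hx'
    have h2 := log_deriv_sq hs (by linarith) (hC x hx')
    have h3 : 0 < f x ^ (p - 2) := by positivity
    set w := lam - f x ^ (p - 2) - (f' x / f x) ^ 2 with hw
    have h4 : w ≤ -B := by rw [hw, h2]; linarith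
    have h5 : w ≤ Λ - (f' x / f x) ^ 2 := by rw [hw]; linarith
    have e : κ * (B + 2 * Λ) = B := div_mul_cancel₀ _ (by positivity)
    have hκ1 : κ ≤ 1 := (div_le_one (by positivity)).2 (by linarith)
    have h6 : (1 - κ) * w ≤ (1 - κ) * -B := mul_le_mul_of_nonneg_left h4 (by linarith)
    have h7 : κ * w ≤ κ * (Λ - (f' x / f x) ^ 2) := mul_le_mul_of_nonneg_left h5 hκ0.le
    have h8 : (1 - κ) * B = 2 * κ * Λ := by linear_combination -e
    linarith
  -- The angle `arctan (v / S)` decreases at speed at least `κ S` and cannot leave an interval of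
  -- length `π`; this limits the length on which `f` stays positive.
  have key := intervalIntegral.sub_le_integral_of_hasDeriv_right_of_le hab.le
    (g := fun x => Real.arctan (f' x / f x / S))
    (Real.continuous_arctan.comp_continuousOn (h.continuousOn_log_deriv.div_const S))
    (fun x hx => ((h.hasDerivAt_log_deriv hx).div_const S).arctan.hasDerivWithinAt)
    (φ := fun _ => -(κ * S)) continuousOn_const.integrableOn_Icc
    (fun x hx => by
      rw [div_mul_div_comm, one_mul, div_le_iff₀ (by positivity)]
      refine (hder x hx).trans (le_of_eq ?_)
      rw [← hS2]; field_simp)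
  rw [intervalIntegral.integral_const, smul_eq_mul] at key
  have ha := Real.arctan_lt_pi_div_two (f' a / f a / S)
  have hb := Real.neg_pi_div_two_lt_arctan (f' b / f b / S)
  have h1 : (b - a) * (κ * S) ≤ Real.pi := by simp only [mul_neg] at key; linarith
  have h2 : 2 * Real.pi ≤ S * (b - a) := by rwa [div_le_iff₀ hℓ] at hSl
  have h3 : (b - a) * (B * S) ≤ Real.pi * (B + 2 * Λ) := by
    have e : κ * (B + 2 * Λ) = B := div_mul_cancel₀ _ (by positivity)
    calc (b - a) * (B * S) = (b - a) * (κ * S) * (B + 2 * Λ) := by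
          linear_combination -(b - a) * S * e
      _ ≤ _ := mul_le_mul_of_nonneg_right h1 (by positivity)
  have h4 : B * (b - a) ≤ 4 * Real.pi * S := by
    have h5 : B * S * (b - a) ≤ 4 * Real.pi * S * S := by
      have : Real.pi * B ≤ B * (S * (b - a)) / 2 := by nlinarith
      rw [← hS2] at h3
      nlinarith
    nlinarith
  rw [le_div_iff₀ hℓ]
  have : C ^ ((p - 2) / p) = 2 * B := by rw [hB]; ring
  rw [this]; linarith

/-! ### Integral identities on bounded edges and on half-lines -/

theorem hasDerivAt_mul_deriv {x : ℝ} (hf : HasDerivAt f (f' x) x)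
    (hf' : HasDerivAt f' (lam * f x - f x ^ (p - 1)) x) (hpos : 0 < f x) :
    HasDerivAt (fun z => f z * f' z) (f' x ^ 2 + lam * f x ^ 2 - f x ^ p) x := by
  refine (hf.mul hf').congr_deriv ?_
  rw [rpow_sub_one_mul hpos, rpow_eq_mul_sq hpos p]
  ring

/-- The equation tested against `f` itself. The boundary terms are the ones that Kirchhoff's
condition cancels on a graph. -/
theorem integral_identity_Icc {a b : ℝ} (h : NLSOn p lam (Icc a b) f f') (hab : a ≤ b) :
    (∫ x in Icc a b, f' x ^ 2) + lam * (∫ x in Icc a b, f x ^ 2) - (∫ x in Icc a b, f x ^ p) =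
      f b * f' b - f a * f' a := by
  have i1 : IntervalIntegrable (fun x => f' x ^ 2) volume a b :=
    (h.continuousOn_deriv.pow 2).intervalIntegrable_of_Icc hab
  have i2 : IntervalIntegrable (fun x => f x ^ 2) volume a b :=
    (h.continuousOn.pow 2).intervalIntegrable_of_Icc hab
  have i3 : IntervalIntegrable (fun x => f x ^ p) volume a b :=
    (h.continuousOn_rpow p).intervalIntegrable_of_Icc hab
  have key := intervalIntegral.integral_eq_sub_of_hasDerivAt_of_le hab
    (h.continuousOn.mul h.continuousOn_deriv)
    (fun x hx => hasDerivAt_mul_deriv (h.hasDerivAt_fst hx) (h.hasDerivAt_snd hx)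
      (h.pos x (Ioo_subset_Icc_self hx))) ((i1.add (i2.const_mul lam)).sub i3)
  rw [intervalIntegral.integral_sub (i1.add (i2.const_mul lam)) i3,
    intervalIntegral.integral_add i1 (i2.const_mul lam), intervalIntegral.integral_const_mul] at key
  simpa only [Pi.mul_apply, integral_Icc_eq_integral_Ioc, ← intervalIntegral.integral_of_le hab] using key

/-- Together with the identity obtained by testing against `f`, this second relation between kinetic
term, mass and power determines the energy up to the error `C * (b - a)`. -/
theorem integral_energy_Icc {a b C : ℝ} (h : NLSOn p lam (Icc a b) f f') (hab : a ≤ b)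
    (hC : ∀ x ∈ Icc a b, nlsEnergy p lam (f x) (f' x) = C) :
    (∫ x in Icc a b, f' x ^ 2) / 2 + (∫ x in Icc a b, f x ^ p) / p -
      lam * (∫ x in Icc a b, f x ^ 2) / 2 = C * (b - a) := by
  have i1 : IntegrableOn (fun x => f' x ^ 2) (Icc a b) :=
    (h.continuousOn_deriv.pow 2).integrableOn_Icc
  have i2 : IntegrableOn (fun x => f x ^ 2) (Icc a b) := (h.continuousOn.pow 2).integrableOn_Icc
  have i3 : IntegrableOn (fun x => f x ^ p) (Icc a b) := (h.continuousOn_rpow p).integrableOn_Icc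
  have i4 : IntegrableOn (fun x => f' x ^ 2 / 2 + f x ^ p / p) (Icc a b) :=
    (i1.div_const 2).add (i3.div_const p)
  have e : ∫ x in Icc a b, nlsEnergy p lam (f x) (f' x) = ∫ x in Icc a b, C :=
    setIntegral_congr_fun measurableSet_Icc hC
  simp only [nlsEnergy] at e
  rw [integral_sub i4 ((i2.const_mul lam).div_const 2),
    integral_add (i1.div_const 2) (i3.div_const p)] at e
  simp only [integral_div, integral_const_mul] at e
  rw [e]
  simp [hab, mul_comm]

section HalfLine

variable {a M : ℝ}

theorem integrableOn_rpow (h : NLSOn p lam I f f') (hI : MeasurableSet I) (hp : 2 < p)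
    (hM : ∀ x ∈ I, f x ≤ M) (h1 : IntegrableOn (fun x => f x ^ 2) I) :
    IntegrableOn (fun x => f x ^ p) I ∧
      (∫ x in I, f x ^ p) ≤ M ^ (p - 2) * ∫ x in I, f x ^ 2 := by
  have hle : ∀ x ∈ I, f x ^ p ≤ M ^ (p - 2) * f x ^ 2 := fun x hx => by
    have hs := h.pos x hx
    rw [rpow_eq_mul_sq hs p]
    exact mul_le_mul_of_nonneg_right (Real.rpow_le_rpow hs.le (hM x hx) (by linarith))
      (by positivity)
  have hi : IntegrableOn (fun x => f x ^ p) I := by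
    refine (h1.const_mul (M ^ (p - 2))).mono'
      ((h.continuousOn_rpow p).aestronglyMeasurable hI) ?_
    rw [ae_restrict_iff' hI]
    exact Eventually.of_forall fun x hx => by
      rw [Real.norm_of_nonneg (Real.rpow_nonneg (h.pos x hx).le p)]
      exact hle x hx
  refine ⟨hi, ?_⟩
  rw [← integral_const_mul]
  exact setIntegral_mono_on hi (h1.const_mul _) hI hle

theorem integral_identity_Ici (h : NLSOn p lam (Ici a) f f') (hp : 2 < p)
    (hM : ∀ x ∈ Ici a, f x ≤ M) (h1 : IntegrableOn (fun x => f x ^ 2) (Ici a))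
    (h2 : IntegrableOn (fun x => f' x ^ 2) (Ici a)) :
    (∫ x in Ici a, f' x ^ 2) + lam * (∫ x in Ici a, f x ^ 2) - (∫ x in Ici a, f x ^ p) =
      - (f a * f' a) := by
  have h3 := (h.integrableOn_rpow measurableSet_Ici hp hM h1).1
  have hd : ∀ x ∈ Ioi a, HasDerivAt (fun z => f z * f' z) (f' x ^ 2 + lam * f x ^ 2 - f x ^ p) x :=
    fun x hx =>
      have hx' : x ∈ Ici a := Ioi_subset_Ici_self hx
      hasDerivAt_mul_deriv ((h.fst x hx').hasDerivAt (Ici_mem_nhds hx))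
        ((h.snd x hx').hasDerivAt (Ici_mem_nhds hx)) (h.pos x hx')
  have h4 : IntegrableOn (fun x => f x * f' x) (Ici a) := by
    refine (h1.add h2).mono' ((h.continuousOn.mul h.continuousOn_deriv).aestronglyMeasurable
      measurableSet_Ici) (Eventually.of_forall fun x => ?_)
    rw [Real.norm_eq_abs]
    exact abs_le.2 ⟨by simp only [Pi.add_apply]; nlinarith [sq_nonneg (f x + f' x), sq_nonneg (f x - f' x)],
      by simp only [Pi.add_apply]; nlinarith [sq_nonneg (f x - f' x), sq_nonneg (f x + f' x)]⟩
  have h5 : IntegrableOn (fun x => f' x ^ 2 + lam * f x ^ 2 - f x ^ p) (Ici a) :=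
    (h2.add (h1.const_mul lam)).sub h3
  have ht := tendsto_zero_of_hasDerivAt_of_integrableOn_Ioi hd (h5.mono_set Ioi_subset_Ici_self)
    (h4.mono_set Ioi_subset_Ici_self)
  have key := integral_Ioi_of_hasDerivAt_of_tendsto
    ((h.continuousOn.mul h.continuousOn_deriv) a self_mem_Ici) hd
    (h5.mono_set Ioi_subset_Ici_self) ht
  have h6 : IntegrableOn (fun x => f' x ^ 2 + lam * f x ^ 2) (Ici a) := h2.add (h1.const_mul lam)
  rw [← integral_Ici_eq_integral_Ioi, integral_sub h6 h3,
    integral_add h2 (h1.const_mul lam), integral_const_mul, zero_sub] at key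
  exact key

/-- The conserved energy is integrable over a half-line, and a constant is so only if it vanishes.
-/
theorem energy_eq_zero (h : NLSOn p lam (Ici a) f f') (hp : 2 < p)
    (hM : ∀ x ∈ Ici a, f x ≤ M) (h1 : IntegrableOn (fun x => f x ^ 2) (Ici a))
    (h2 : IntegrableOn (fun x => f' x ^ 2) (Ici a)) {x : ℝ} (hx : x ∈ Ici a) :
    nlsEnergy p lam (f x) (f' x) = 0 := by
  have h3 := (h.integrableOn_rpow measurableSet_Ici hp hM h1).1
  have h4 : IntegrableOn (fun z => nlsEnergy p lam (f z) (f' z)) (Ici a) :=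
    ((h2.div_const 2).add (h3.div_const p)).sub ((h1.const_mul lam).div_const 2)
  have h5 : IntegrableOn (fun _ => nlsEnergy p lam (f x) (f' x)) (Ici a) :=
    h4.congr_fun (fun z hz => h.energy_eq (by linarith) (convex_Ici a) hz hx) measurableSet_Ici
  rw [integrableOn_const_iff] at h5
  simpa using h5

theorem integral_energy_Ici (h : NLSOn p lam (Ici a) f f') (hp : 2 < p)
    (hM : ∀ x ∈ Ici a, f x ≤ M) (h1 : IntegrableOn (fun x => f x ^ 2) (Ici a))
    (h2 : IntegrableOn (fun x => f' x ^ 2) (Ici a)) :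
    (∫ x in Ici a, f' x ^ 2) / 2 + (∫ x in Ici a, f x ^ p) / p -
      lam * (∫ x in Ici a, f x ^ 2) / 2 = 0 := by
  have h3 := (h.integrableOn_rpow measurableSet_Ici hp hM h1).1
  have h4 : IntegrableOn (fun x => f' x ^ 2 / 2 + f x ^ p / p) (Ici a) :=
    (h2.div_const 2).add (h3.div_const p)
  have e : ∫ x in Ici a, nlsEnergy p lam (f x) (f' x) = ∫ x in Ici a, (0 : ℝ) :=
    setIntegral_congr_fun measurableSet_Ici fun x hx => h.energy_eq_zero hp hM h1 h2 hx
  simp only [nlsEnergy] at e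
  rw [integral_sub h4 ((h1.const_mul lam).div_const 2),
    integral_add (h2.div_const 2) (h3.div_const p)] at e
  simpa only [integral_div, integral_const_mul, integral_zero] using e

end HalfLine

/-- A concave solution tested against an affine function that varies little. -/
theorem le_of_affine_test {a b φ₀ φ₁ m ε : ℝ} (h : NLSOn p lam (Icc a b) f f')
    (hlam : lam < 0) (hab : a < b) (hm : 0 < m) (h0 : m ≤ φ₀) (h1 : m ≤ φ₁)
    (hε : |φ₁ - φ₀| ≤ ε * m) :
    (-lam - 2 * ε / (b - a) ^ 2) * m * (∫ x in a..b, f x) ≤ φ₀ * f' a - φ₁ * f' b := by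
  have hℓ : 0 < b - a := by linarith
  have hcI : IntegrableOn (fun x => f x) (Icc a b) := h.continuousOn.integrableOn_Icc
  have hid : ∀ x, HasDerivAt (fun z : ℝ => z) 1 x := fun x => hasDerivAt_id x
  -- The trapezoid rule for the concave `f`: this primitive has derivative `f + (x - a)(b - x) f'' /
  -- 2 ≤ f`.
  have trap := intervalIntegral.sub_le_integral_of_hasDeriv_right_of_le hab.le
    (g := fun x => (x - (a + b) / 2) * f x + (x - a) * (b - x) / 2 * f' x)
    (((by fun_prop : ContinuousOn (fun x : ℝ => x - (a + b) / 2) (Icc a b)).mul h.continuousOn).add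
      ((by fun_prop : ContinuousOn (fun x : ℝ => (x - a) * (b - x) / 2) (Icc a b)).mul
        h.continuousOn_deriv))
    (fun x hx => (((((hid x).sub_const ((a + b) / 2)).mul (h.hasDerivAt_fst hx)).add
      (((((hid x).sub_const a).mul ((hid x).const_sub b)).div_const 2).mul
        (h.hasDerivAt_snd hx))).hasDerivWithinAt))
    hcI (fun x hx => by
      have hs := h.pos x (Ioo_subset_Icc_self hx)
      have h2 : 0 < f x ^ (p - 1) := by positivity
      have h3 : lam * f x - f x ^ (p - 1) ≤ 0 := by nlinarith
      have h4 : 0 ≤ (x - a) * (b - x) / 2 := by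
        have := hx.1; have := hx.2
        exact div_nonneg (mul_nonneg (by linarith) (by linarith)) (by norm_num)
      have h5 := mul_nonpos_of_nonneg_of_nonpos h4 h3
      simp only [Pi.mul_apply]
      linarith)
  set s := (φ₁ - φ₀) / (b - a) with hs
  have hsl : s * (b - a) = φ₁ - φ₀ := div_mul_cancel₀ _ hℓ.ne'
  -- With `φ` affine from `φ₀` to `φ₁`, the derivative of `φ' f - φ f'` is `-φ f'' ≥ -lam φ f ≥ -lam
  -- m f`. The boundary term `s * (f b - f a)` is then absorbed by means of the trapezoid bound.
  have key := intervalIntegral.integral_le_sub_of_hasDeriv_right_of_le hab.le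
    (g := fun x => s * f x - (φ₀ + s * (x - a)) * f' x)
    ((continuousOn_const.mul h.continuousOn).sub
      ((by fun_prop : ContinuousOn (fun x : ℝ => φ₀ + s * (x - a)) (Icc a b)).mul
        h.continuousOn_deriv))
    (fun x hx => ((((h.hasDerivAt_fst hx).const_mul s).sub
      ((((((hid x).sub_const a).const_mul s).const_add φ₀).mul
        (h.hasDerivAt_snd hx)))).hasDerivWithinAt))
    (φ := fun x => -lam * m * f x) (hcI.const_mul _) (fun x hx => by
      have hs := h.pos x (Ioo_subset_Icc_self hx)
      have h2 : 0 < f x ^ (p - 1) := by positivity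
      have h4 : m ≤ φ₀ + s * (x - a) := by
        have h5 : φ₀ + s * (x - a) = (φ₀ * (b - x) + φ₁ * (x - a)) / (b - a) := by
          field_simp; linear_combination (x - a) * hsl
        rw [h5, le_div_iff₀ hℓ]
        nlinarith [hx.1, hx.2]
      have h6 : -lam * m * f x ≤ -lam * f x * (φ₀ + s * (x - a)) := by
        have : 0 ≤ -lam * f x := mul_nonneg (by linarith) hs.le
        nlinarith
      nlinarith)
  rw [intervalIntegral.integral_const_mul] at key
  have hf0 := h.pos a (left_mem_Icc.2 hab.le)
  have hf1 := h.pos b (right_mem_Icc.2 hab.le)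
  have htrap : (b - a) * (f a + f b) ≤ 2 * ∫ x in a..b, f x := by linarith
  have h7 : s * (f b - f a) ≤ 2 * ε / (b - a) ^ 2 * m * ∫ x in a..b, f x := by
    have h8 : s * (f b - f a) ≤ ε * m / (b - a) * (f a + f b) := by
      have h9 : |s| ≤ ε * m / (b - a) := by
        rw [hs, abs_div, abs_of_pos hℓ]
        exact div_le_div_of_nonneg_right hε hℓ.le
      calc s * (f b - f a) ≤ |s| * |f b - f a| := by rw [← abs_mul]; exact le_abs_self _
        _ ≤ _ := mul_le_mul h9 (abs_le.2 ⟨by linarith, by linarith⟩) (abs_nonneg _)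
          ((abs_nonneg s).trans h9)
    have h10 : 0 ≤ ε * m := (abs_nonneg _).trans hε
    calc s * (f b - f a) ≤ ε * m / (b - a) * (f a + f b) := h8
      _ = ε * m / (b - a) ^ 2 * ((b - a) * (f a + f b)) := by field_simp
      _ ≤ ε * m / (b - a) ^ 2 * (2 * ∫ x in a..b, f x) :=
        mul_le_mul_of_nonneg_left htrap (by positivity)
      _ = _ := by ring
  simp only [sub_self, mul_zero, add_zero, hsl] at key
  linarith

end NLSOn

/-! ### The soliton on the line -/

section Soliton

variable {p lam : ℝ}

theorem nlsOn_lineSolution (hp : 2 < p) (hlam : 0 < lam) :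
    NLSOn p lam univ (lineSolution p lam) (deriv (lineSolution p lam)) :=
  have h := lineSolution_spec hp hlam
  ⟨fun x _ => (h.1 x).1.hasDerivAt.hasDerivWithinAt, fun x _ => (h.1 x).2.hasDerivWithinAt,
    fun x _ => h.2.1 x⟩

theorem lineSolution_zero_rpow (hp : 2 < p) (hlam : 0 < lam) :
    lineSolution p lam 0 ^ (p - 2) = p * lam / 2 := by
  have hA : 0 < p * lam / 2 := by have : 0 < p := by linarith
                                  positivity
  rw [lineSolution, mul_zero, Real.cosh_zero, Real.one_rpow, mul_one, ← Real.rpow_mul hA.le,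
    one_div_mul_cancel (by linarith : p - 2 ≠ 0), Real.rpow_one]

/-- The energy is conserved, and it vanishes at the origin by the value of the maximum. -/
theorem deriv_lineSolution_sq (hp : 2 < p) (hlam : 0 < lam) (x : ℝ) :
    deriv (lineSolution p lam) x ^ 2 =
      lam * lineSolution p lam x ^ 2 - 2 / p * lineSolution p lam x ^ p := by
  have h := lineSolution_spec hp hlam
  have hmax : deriv (lineSolution p lam) 0 = 0 :=
    IsLocalMax.deriv_eq_zero (Eventually.of_forall h.2.2)
  have he := (nlsOn_lineSolution hp hlam).energy_eq (by linarith) convex_univ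
    (mem_univ x) (mem_univ 0)
  rw [hmax, nlsEnergy, nlsEnergy, NLSOn.rpow_eq_mul_sq (h.2.1 0) p,
    lineSolution_zero_rpow hp hlam] at he
  have hp0 : p ≠ 0 := by linarith
  have e : p * lam / 2 * lineSolution p lam 0 ^ 2 / p = lam * lineSolution p lam 0 ^ 2 / 2 := by
    field_simp
  rw [e] at he
  linear_combination 2 * he

theorem lineSolution_abs (x : ℝ) : lineSolution p lam |x| = lineSolution p lam x := by
  unfold lineSolution
  rw [← Real.cosh_abs ((p - 2) / 2 * √lam * |x|), ← Real.cosh_abs ((p - 2) / 2 * √lam * x),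
    abs_mul, abs_abs, ← abs_mul]

theorem lineSolution_strictAntiOn (hp : 2 < p) (hlam : 0 < lam) :
    StrictAntiOn (lineSolution p lam) (Ici 0) := by
  intro x hx y hy hxy
  have hp2 : 0 < p - 2 := by linarith
  have hs := Real.sqrt_pos.2 hlam
  have hb : 0 < (p - 2) / 2 * √lam := by positivity
  refine mul_lt_mul_of_pos_left ?_ (by positivity)
  refine Real.rpow_lt_rpow_of_neg (Real.cosh_pos _) ?_ (by rw [neg_lt_zero]; positivity)
  rw [Real.cosh_lt_cosh, abs_mul _ x, abs_mul _ y, abs_of_nonneg (mem_Ici.1 hx),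
    abs_of_nonneg (mem_Ici.1 hy)]
  exact mul_lt_mul_of_pos_left hxy (abs_pos.2 hb.ne')

theorem integrable_lineSolution_rpow (hp : 2 < p) (hlam : 0 < lam) :
    Integrable fun x => lineSolution p lam x ^ p := by
  have h := (nlsOn_lineSolution hp hlam).integrableOn_rpow MeasurableSet.univ hp
    (fun x _ => (lineSolution_spec hp hlam).2.2 x) (integrable_lineSolution_sq hp hlam).integrableOn
  exact integrableOn_univ.1 h.1

theorem integrable_deriv_lineSolution_sq (hp : 2 < p) (hlam : 0 < lam) :
    Integrable fun x => deriv (lineSolution p lam) x ^ 2 := by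
  simp_rw [deriv_lineSolution_sq hp hlam]
  exact ((integrable_lineSolution_sq hp hlam).const_mul _).sub
    ((integrable_lineSolution_rpow hp hlam).const_mul _)

/-- Testing the equation against the solution and integrating the zero mechanical energy give two
linear relations; they express the kinetic term and the power through `lam` times the mass. -/
theorem lineEnergy_univ_lineSolution (hp : 2 < p) (hlam : 0 < lam) :
    lineEnergy p univ (lineSolution p lam) =
      (p - 6) / (2 * (p + 2)) * (lam * ∫ x, lineSolution p lam x ^ 2) := by
  have h := lineSolution_spec hp hlam
  have i1 := integrable_lineSolution_sq hp hlam
  have i2 := integrable_deriv_lineSolution_sq hp hlam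
  have i3 := integrable_lineSolution_rpow hp hlam
  have hc := (nlsOn_lineSolution hp hlam)
  have i4 : Integrable fun x => lineSolution p lam x * deriv (lineSolution p lam) x := by
    refine (i1.add i2).mono' ?_ (Eventually.of_forall fun x => ?_)
    · exact (continuousOn_univ.1 (hc.continuousOn.mul hc.continuousOn_deriv)).aestronglyMeasurable
    · rw [Real.norm_eq_abs]
      generalize hu : lineSolution p lam x = u
      generalize hv : deriv (lineSolution p lam) x = v
      simp only [Pi.add_apply, hu, hv]
      exact abs_le.2 ⟨by nlinarith [sq_nonneg (u + v), sq_nonneg (u - v)],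
        by nlinarith [sq_nonneg (u + v), sq_nonneg (u - v)]⟩
  have i5 : Integrable fun x => deriv (lineSolution p lam) x ^ 2 + lam * lineSolution p lam x ^ 2 :=
    i2.add (i1.const_mul lam)
  have e1 := integral_eq_zero_of_hasDerivAt_of_integrable
    (fun x => NLSOn.hasDerivAt_mul_deriv (h.1 x).1.hasDerivAt (h.1 x).2 (h.2.1 x))
    (i5.sub i3) i4
  rw [integral_sub i5 i3, integral_add i2 (i1.const_mul lam), integral_const_mul] at e1
  have e2 : ∫ x, deriv (lineSolution p lam) x ^ 2 =
      lam * (∫ x, lineSolution p lam x ^ 2) - 2 / p * ∫ x, lineSolution p lam x ^ p := by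
    simp_rw [deriv_lineSolution_sq hp hlam]
    rw [integral_sub (i1.const_mul _) (i3.const_mul _), integral_const_mul, integral_const_mul]
  have e3 : ∫ x, |lineSolution p lam x| ^ p = ∫ x, lineSolution p lam x ^ p := by
    simp_rw [abs_of_pos (h.2.1 _)]
  rw [lineEnergy, setIntegral_univ, setIntegral_univ, e3]
  set P := ∫ x, lineSolution p lam x ^ p
  set m := ∫ x, lineSolution p lam x ^ 2
  set T := ∫ x, deriv (lineSolution p lam) x ^ 2
  have hp0 : p ≠ 0 := by linarith
  have hp2 : p + 2 ≠ 0 := by linarith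
  have e4 : P = 2 * p / (p + 2) * (lam * m) := by
    field_simp
    field_simp at e2
    linear_combination e2 - p * e1
  have e5 : T = P - lam * m := by linarith
  rw [e5, e4]
  field_simp
  ring

theorem lineEnergy_Ioi_lineSolution (hp : 2 < p) (hlam : 0 < lam) :
    lineEnergy p (Ioi 0) (lineSolution p lam) = lineEnergy p univ (lineSolution p lam) / 2 := by
  have e1 : ∫ x, deriv (lineSolution p lam) x ^ 2 =
      2 * ∫ x in Ioi 0, deriv (lineSolution p lam) x ^ 2 := by
    simp_rw [deriv_lineSolution_sq hp hlam]
    rw [← integral_comp_abs (f := fun x => lam * lineSolution p lam x ^ 2 -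
      2 / p * lineSolution p lam x ^ p)]
    simp_rw [lineSolution_abs]
  have e2 : ∫ x, |lineSolution p lam x| ^ p = 2 * ∫ x in Ioi 0, |lineSolution p lam x| ^ p := by
    rw [← integral_comp_abs (f := fun x => |lineSolution p lam x| ^ p)]
    simp_rw [lineSolution_abs]
  rw [lineEnergy, lineEnergy, setIntegral_univ, setIntegral_univ, e1, e2]
  ring

theorem lineEnergy_univ_soliton {μ : ℝ} (hp : 6 < p) (hμ : 0 < μ) :
    lineEnergy p univ (soliton p μ) = (p - 6) / (2 * (p + 2)) * (solitonFrequency p μ * μ) := by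
  have h := soliton_mass hp hμ
  rw [soliton, lineEnergy_univ_lineSolution (by linarith) h.1]
  congr 2
  exact h.2

theorem lineEnergy_Ioi_soliton {μ : ℝ} (hp : 6 < p) (hμ : 0 < μ) :
    lineEnergy p (Ioi 0) (soliton p (2 * μ)) =
      (p - 6) / (2 * (p + 2)) * (solitonFrequency p (2 * μ) * μ) := by
  have h := soliton_mass hp (by positivity : 0 < 2 * μ)
  rw [soliton, lineEnergy_Ioi_lineSolution (by linarith) h.1, ← soliton,
    lineEnergy_univ_soliton hp (by positivity)]
  ring

theorem integral_lineSolution_sq_pos (hp : 2 < p) (hlam : 0 < lam) :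
    0 < ∫ x, lineSolution p lam x ^ 2 :=
  integral_pos_of_integrable_nonneg_nonzero
    (continuousOn_univ.1 ((nlsOn_lineSolution hp hlam).continuousOn.pow 2))
    (integrable_lineSolution_sq hp hlam) (fun _ => sq_nonneg _) (x := 0)
    (pow_pos ((lineSolution_spec hp hlam).2.1 0) 2).ne'

/-- A function `H` of the level with `|(H ∘ s)'| ≤ s ^ 2` along all solutions `s` of energy at most
`c`, and whose total variation along the soliton is almost the mass. -/
theorem exists_level_function {ε : ℝ} (hp : 6 < p) (hε : 0 < ε) (hε1 : ε < 1) :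
    ∃ c t₁ t₂ : ℝ, ∃ H h : ℝ → ℝ, 0 < c ∧ 0 < t₁ ∧ 0 < t₂ ∧ t₂ ^ (p - 2) < p / 2 ∧
      (∀ t, HasDerivAt H (h t) t) ∧ (∀ t, 0 ≤ h t) ∧
      (∀ s d, 0 < s → d ^ 2 ≤ s ^ 2 - 2 / p * s ^ p + 2 * c → h s * |d| ≤ s ^ 2) ∧
      (1 - ε) * (∫ x, lineSolution p 1 x ^ 2) ≤ 2 * (H t₂ - H t₁) := by
  have hp2 : 2 < p := by linarith
  have hspec := lineSolution_spec hp2 one_pos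
  have hsol := nlsOn_lineSolution hp2 one_pos
  have hanti := lineSolution_strictAntiOn hp2 one_pos
  set φ := lineSolution p 1 with hφ
  have hcont : Continuous φ := continuousOn_univ.1 hsol.continuousOn
  have hcont2 : Continuous fun x => φ x ^ 2 := hcont.pow 2
  have hint : Integrable fun x => φ x ^ 2 := integrable_lineSolution_sq hp2 one_pos
  set m := ∫ x, φ x ^ 2 with hm
  have hm0 : 0 < m := integral_lineSolution_sq_pos hp2 one_pos
  have hhalf : ∫ x in Ioi 0, φ x ^ 2 = m / 2 := by
    have := integral_comp_abs (f := fun x => φ x ^ 2)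
    simp only [hφ, lineSolution_abs] at this
    rw [hm, hφ, this]; ring
  have hA := hspec.2.1 0
  -- a compact interval carrying most of the mass
  obtain ⟨x₁, x₂, hx1, hx12, hmass⟩ : ∃ x₁ x₂ : ℝ, 0 < x₁ ∧ x₁ < x₂ ∧
      (1 - ε / 2) * (m / 2) ≤ ∫ x in x₁..x₂, φ x ^ 2 := by
    have ht := intervalIntegral_tendsto_integral_Ioi (f := fun x => φ x ^ 2) (b := id) (l := atTop) 0
      hint.integrableOn tendsto_id
    rw [hhalf] at ht
    have hev := (ht.eventually (lt_mem_nhds (show m / 2 - ε * m / 8 < m / 2 by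
      have := mul_pos hε hm0; linarith))).and (eventually_ge_atTop (1 : ℝ))
    obtain ⟨x₂, hx2, hx21⟩ := hev.exists
    -- Since `φ ≤ φ 0`, discarding `[0, x₁]` loses at most `ε * m / 8`; the tail beyond `x₂` loses
    -- as much again.
    set x₁ := min (1 / 2) (ε * m / (8 * φ 0 ^ 2)) with hx1
    have hx10 : 0 < x₁ := lt_min (by norm_num) (by positivity)
    have hx1h : x₁ ≤ 1 / 2 := min_le_left _ _
    refine ⟨x₁, x₂, hx10, by linarith, ?_⟩
    have h1 : ∫ x in (0 : ℝ)..x₁, φ x ^ 2 ≤ ∫ x in (0 : ℝ)..x₁, φ 0 ^ 2 :=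
      intervalIntegral.integral_mono_on hx10.le (hcont2.intervalIntegrable _ _) (by simp)
        fun x _ => pow_le_pow_left₀ (hspec.2.1 x).le (hspec.2.2 x) 2
    have h2 : x₁ * φ 0 ^ 2 ≤ ε * m / 8 := by
      have h3 : x₁ ≤ ε * m / (8 * φ 0 ^ 2) := min_le_right _ _
      rw [le_div_iff₀ (by positivity)] at h3
      linarith
    simp only [intervalIntegral.integral_const, sub_zero, smul_eq_mul] at h1
    have h4 := intervalIntegral.integral_add_adjacent_intervals
      (hcont2.intervalIntegrable (μ := volume) 0 x₁) (hcont2.intervalIntegrable x₁ x₂)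
    simp only [id] at hx2
    linarith
  have hx2 : 0 < x₂ := hx1.trans hx12
  have hsq : ∀ x, deriv φ x ^ 2 = φ x ^ 2 - 2 / p * φ x ^ p := fun x => by
    have := deriv_lineSolution_sq hp2 one_pos x
    rwa [one_mul] at this
  have hA2 : φ 0 ^ (p - 2) = p / 2 := by
    have := lineSolution_zero_rpow hp2 one_pos
    rwa [mul_one] at this
  have hlt : ∀ x, 0 < x → φ x ^ (p - 2) < p / 2 := fun x hx => by
    rw [← hA2]
    exact Real.rpow_lt_rpow (hspec.2.1 x).le (hanti self_mem_Ici hx.le hx) (by linarith)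
  have hpos : ∀ x, 0 < x → 0 < deriv φ x ^ 2 := fun x hx => by
    have hs := hspec.2.1 x
    rw [hsq, NLSOn.rpow_eq_mul_sq hs p]
    have h1 : 2 / p * φ x ^ (p - 2) < 2 / p * (p / 2) :=
      mul_lt_mul_of_pos_left (hlt x hx) (by positivity)
    have h2 : 2 / p * (p / 2) = 1 := by field_simp
    have : 0 < φ x ^ 2 * (1 - 2 / p * φ x ^ (p - 2)) := mul_pos (by positivity) (by linarith)
    linarith
  obtain ⟨y, hy, hymin⟩ := isCompact_Icc.exists_isMinOn (nonempty_Icc.2 hx12.le)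
    (show ContinuousOn (fun x => deriv φ x ^ 2) (Icc x₁ x₂) from
      (hsol.continuousOn_deriv.mono (subset_univ _)).pow 2)
  set K := deriv φ y ^ 2 with hK
  have hK0 : 0 < K := hpos y (hx1.trans_le hy.1)
  set θ := 1 - ε / 2 with hθ
  have hθ0 : 0 < θ := by linarith
  have hθ1 : θ < 1 := by linarith
  have hθ2 : θ ^ 2 < 1 := by nlinarith
  -- Chosen so that `θ² (φ'² + 2c) ≤ φ'²` wherever `φ'² ≥ K`: an energy excess `c` speeds up the
  -- descent by a factor `1 / θ` at most.
  set c := K * (1 - θ ^ 2) / (2 * θ ^ 2) with hc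
  have hc0 : 0 < c := div_pos (mul_pos hK0 (by linarith)) (by positivity)
  have hcθ : 2 * c * θ ^ 2 = K * (1 - θ ^ 2) := by rw [hc]; field_simp
  -- The largest `d²` admissible at level `s`. The maximum with `K` keeps `D` positive for all `s`
  -- and is inactive along the soliton on `[x₁, x₂]`.
  set D : ℝ → ℝ := fun s => max (s ^ 2 - 2 / p * s ^ p) K + 2 * c with hD
  have hD0 : ∀ s, 0 < D s := fun s => by
    have : K ≤ max (s ^ 2 - 2 / p * s ^ p) K := le_max_right _ _
    simp only [hD]; linarith
  have hDc : Continuous D := by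
    have h1 : Continuous fun s : ℝ => s ^ p := Real.continuous_rpow_const (by linarith)
    exact ((((continuous_id.pow 2).sub (continuous_const.mul h1)).max continuous_const).add
      continuous_const)
  -- Mass per unit of level for the fastest admissible descent.
  set h : ℝ → ℝ := fun s => s ^ 2 / √(D s) with hh
  have hhc : Continuous h := (continuous_id.pow 2).div (Real.continuous_sqrt.comp hDc)
    fun s => (Real.sqrt_pos.2 (hD0 s)).ne'
  refine ⟨c, φ x₂, φ x₁, fun t => ∫ s in (0 : ℝ)..t, h s, h, hc0, hspec.2.1 _, hspec.2.1 _,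
    hlt x₁ hx1, fun t => ?_, fun t => by positivity, fun s d hs hd => ?_, ?_⟩
  · exact intervalIntegral.integral_hasDerivAt_right (hhc.intervalIntegrable _ _)
      (hhc.stronglyMeasurableAtFilter _ _) hhc.continuousAt
  · have h1 : |d| ≤ √(D s) := by
      rw [← Real.sqrt_sq_eq_abs]
      refine Real.sqrt_le_sqrt (hd.trans ?_)
      have := le_max_left (s ^ 2 - 2 / p * s ^ p) K
      simp only [hD]; linarith
    rw [hh]
    have h2 := Real.sqrt_pos.2 (hD0 s)
    rw [div_mul_eq_mul_div, div_le_iff₀ h2]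
    exact mul_le_mul_of_nonneg_left h1 (sq_nonneg s)
  · have key := intervalIntegral.integral_le_sub_of_hasDeriv_right_of_le hx12.le
      (g := fun x => -∫ s in (0 : ℝ)..φ x, h s) (g' := fun x => -(h (φ x) * deriv φ x))
      (φ := fun x => θ * φ x ^ 2)
      (((intervalIntegral.continuous_primitive (fun a b => hhc.intervalIntegrable a b) 0).comp
        hcont).neg.continuousOn)
      (fun x _ => by
        have h1 := intervalIntegral.integral_hasDerivAt_right (hhc.intervalIntegrable 0 (φ x))
          (hhc.stronglyMeasurableAtFilter volume (𝓝 (φ x))) hhc.continuousAt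
        exact (h1.comp x (hspec.1 x).1.hasDerivAt).neg.hasDerivWithinAt)
      (continuous_const.mul hcont2).continuousOn.integrableOn_Icc
      (fun x hx => by
        have hx0 : 0 < x := hx1.trans hx.1
        have hKx : K ≤ deriv φ x ^ 2 := hymin (Ioo_subset_Icc_self hx)
        have hneg : deriv φ x ≤ 0 := by
          have h1 : AntitoneOn φ (Ioi 0) := hanti.antitoneOn.mono Ioi_subset_Ici_self
          have h2 := h1.derivWithin_nonpos (x := x)
          rwa [derivWithin_of_mem_nhds (Ioi_mem_nhds hx0)] at h2
        have hDx : D (φ x) = deriv φ x ^ 2 + 2 * c := by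
          simp only [hD]
          rw [← hsq x, max_eq_left hKx]
        have h3 : θ * √(D (φ x)) ≤ -deriv φ x := by
          rw [← abs_of_nonpos hneg, ← Real.sqrt_sq_eq_abs]
          refine Real.le_sqrt_of_sq_le ?_
          rw [mul_pow, Real.sq_sqrt (hD0 _).le, hDx]
          nlinarith
        have h2 := Real.sqrt_pos.2 (hD0 (φ x))
        have h4 : -(h (φ x) * deriv φ x) = φ x ^ 2 * -deriv φ x / √(D (φ x)) := by
          rw [hh]; ring
        rw [h4, le_div_iff₀ h2]
        nlinarith [sq_nonneg (φ x)])
    rw [intervalIntegral.integral_const_mul] at key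
    have h5 : θ * (θ * (m / 2)) ≤ θ * ∫ x in x₁..x₂, φ x ^ 2 :=
      mul_le_mul_of_nonneg_left hmass hθ0.le
    have h6 : (1 - ε) * m ≤ θ ^ 2 * m := by
      refine mul_le_mul_of_nonneg_right ?_ hm0.le
      rw [hθ]; nlinarith [sq_nonneg ε]
    nlinarith

end Soliton

/-! ### Positive solutions on a metric graph -/

/-- First order condition valid at boundary points of `I` too, as needed at the ends of an edge. -/
theorem mul_sub_nonpos_of_isMaxOn {f : ℝ → ℝ} {I : Set ℝ} {d x y : ℝ} (hI : Convex ℝ I)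
    (hf : HasDerivWithinAt f d I x) (hmax : IsMaxOn f I x) (hx : x ∈ I) (hy : y ∈ I) :
    (y - x) * d ≤ 0 := by
  have h := (hmax.localize).hasFDerivWithinAt_nonpos hf.hasFDerivWithinAt
    (sub_mem_posTangentConeAt_of_segment_subset (hI.segment_subset hx hy))
  simpa using h

/-- Used with `ι = Bool` to sum over edge ends, and with a finite set of representatives to sum over
the edges of a periodic graph. -/
theorem summable_of_comp_fst {E ι : Type*} [Finite ι] {w : E → ℝ} (hw : Summable w) :
    Summable fun i : E × ι => w i.1 := by
  have := Fintype.ofFinite ι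
  rw [← (Equiv.prodComm ι E).summable_iff]
  refine (summable_prod_of_nonneg (f := fun i : ι × E => |w i.2|) (fun _ => abs_nonneg _)).2
    ⟨fun _ => hw.abs, by exact (hasSum_fintype _).summable⟩ |>.of_abs

namespace MetricGraph

variable {V E : Type*} {G : MetricGraph V E} {p lam ℓ M : ℝ} {u : E → ℝ → ℝ} {e : E}

/-! ### Edges, edge ends and the quantities attached to an edge -/

theorem interval_of_ne_top (he : G.length e ≠ ⊤) : G.interval e = Icc 0 (G.length e).toReal := by
  ext x
  simp only [interval, Set.mem_ofPred_eq, mem_Icc]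
  refine and_congr_right fun _ => ?_
  rw [ENNReal.ofReal_le_iff_le_toReal he]

theorem interval_of_eq_top (he : G.length e = ⊤) : G.interval e = Ici 0 := by
  ext x
  simp [interval, he]

theorem measurableSet_interval (e : E) : MeasurableSet (G.interval e) := by
  by_cases he : G.length e = ⊤
  · rw [interval_of_eq_top he]; exact measurableSet_Ici
  · rw [interval_of_ne_top he]; exact measurableSet_Icc

theorem convex_interval (e : E) : Convex ℝ (G.interval e) := by
  by_cases he : G.length e = ⊤
  · rw [interval_of_eq_top he]; exact convex_Ici 0
  · rw [interval_of_ne_top he]; exact convex_Icc _ _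

theorem zero_mem_interval (e : E) : (0 : ℝ) ∈ G.interval e := by simp [interval]

theorem Icc_subset_interval {x y : ℝ} (hx : x ∈ G.interval e) (hy : y ∈ G.interval e) :
    Icc x y ⊆ G.interval e := (convex_interval e).ordConnected.out hx hy

/-- Every edge has length at least `ℓ`. -/
def LengthGE (G : MetricGraph V E) (ℓ : ℝ) : Prop := ∀ e, ENNReal.ofReal ℓ ≤ G.length e

theorem exists_lengthGE (h : 0 < ⨅ e, G.length e) : ∃ ℓ, 0 < ℓ ∧ G.LengthGE ℓ := by
  obtain ⟨r, hr, hlt⟩ := ENNReal.lt_iff_exists_nnreal_btwn.1 h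
  refine ⟨r, by simpa using hr, fun e => ?_⟩
  rw [ENNReal.ofReal_coe_nnreal]
  exact hlt.le.trans (iInf_le _ e)

theorem LengthGE.le_toReal (hG : G.LengthGE ℓ) (he : G.length e ≠ ⊤) :
    ℓ ≤ (G.length e).toReal := (ENNReal.ofReal_le_iff_le_toReal he).1 (hG e)

theorem mem_interval_of_le (hG : G.LengthGE ℓ) {x : ℝ} (h0 : 0 ≤ x) (hx : x ≤ ℓ) :
    x ∈ G.interval e := ⟨h0, (ENNReal.ofReal_le_ofReal hx).trans (hG e)⟩

theorem exists_Icc_subset (hG : G.LengthGE ℓ) (hℓ : 0 < ℓ) {x : ℝ} (hx : x ∈ G.interval e) :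
    ∃ a, x ∈ Icc a (a + ℓ) ∧ Icc a (a + ℓ) ⊆ G.interval e := by
  by_cases h : x ≤ ℓ
  · refine ⟨0, ⟨hx.1, by linarith⟩, Icc_subset_interval (zero_mem_interval e) ?_⟩
    exact mem_interval_of_le hG (by linarith) (by linarith)
  · refine ⟨x - ℓ, ⟨by linarith, by linarith⟩, Icc_subset_interval ?_ (by simpa using hx)⟩
    exact ⟨by linarith, (ENNReal.ofReal_le_ofReal (by linarith)).trans hx.2⟩

/-- The derivative along an edge, one-sided at its ends. -/
noncomputable def edgeDeriv (G : MetricGraph V E) (u : E → ℝ → ℝ) (e : E) : ℝ → ℝ :=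
  derivWithin (u e) (G.interval e)

/-- The squared `L²` norm on an edge. -/
noncomputable def edgeMass (G : MetricGraph V E) (u : E → ℝ → ℝ) (e : E) : ℝ :=
  ∫ x in G.interval e, u e x ^ 2

/-- The squared `L²` norm of the derivative on an edge. -/
noncomputable def edgeKinetic (G : MetricGraph V E) (u : E → ℝ → ℝ) (e : E) : ℝ :=
  ∫ x in G.interval e, G.edgeDeriv u e x ^ 2

/-- The `p`-th power of the `Lᵖ` norm on an edge. -/
noncomputable def edgePower (G : MetricGraph V E) (p : ℝ) (u : E → ℝ → ℝ) (e : E) : ℝ :=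
  ∫ x in G.interval e, u e x ^ p

/-- The vertex at an edge end, if there is one. -/
def endVertex (G : MetricGraph V E) (i : E × Bool) : Option V :=
  if i.2 then G.target i.1 else some (G.source i.1)

theorem mem_ends_iff {v : V} {i : E × Bool} : i ∈ G.ends v ↔ G.endVertex i = some v := by
  obtain ⟨e, b⟩ := i
  cases b <;> simp [ends, endVertex]

theorem length_ne_top_of_mem_ends {v : V} (h : (e, true) ∈ G.ends v) : G.length e ≠ ⊤ := by
  rw [mem_ends_iff] at h
  intro he
  have := (G.target_eq_none_iff e).2 he
  simp [endVertex, this] at h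

theorem exists_mem_ends_true (he : G.length e ≠ ⊤) : ∃ v, (e, true) ∈ G.ends v := by
  have h : G.target e ≠ none := fun h => he ((G.target_eq_none_iff e).1 h)
  obtain ⟨v, hv⟩ := Option.ne_none_iff_exists'.1 h
  exact ⟨v, by rw [mem_ends_iff]; simp [endVertex, hv]⟩

theorem mem_ends_false (e : E) : (e, false) ∈ G.ends (G.source e) := by
  rw [mem_ends_iff]; simp [endVertex]

theorem endCoord_false (e : E) : G.endCoord (e, false) = 0 := by simp [endCoord]

theorem endCoord_true (e : E) : G.endCoord (e, true) = (G.length e).toReal := by simp [endCoord]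

theorem endCoord_mem {v : V} {i : E × Bool} (hi : i ∈ G.ends v) :
    G.endCoord i ∈ G.interval i.1 := by
  obtain ⟨e, b⟩ := i
  cases b
  · rw [endCoord_false]; exact zero_mem_interval e
  · have he := length_ne_top_of_mem_ends hi
    rw [endCoord_true, interval_of_ne_top he]
    exact right_mem_Icc.2 ENNReal.toReal_nonneg

/-- The energy is defined with `deriv`, the equation with `derivWithin`; they can differ only at the
ends of the edge. -/
theorem ae_deriv_eq_edgeDeriv (u : E → ℝ → ℝ) (e : E) :
    ∀ᵐ x ∂(volume.restrict (G.interval e)), deriv (u e) x = G.edgeDeriv u e x := by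
  have h0 : ∀ᵐ x : ℝ, x ≠ 0 := by simp [ae_iff]
  have h1 : ∀ᵐ x : ℝ, x ≠ (G.length e).toReal := by simp [ae_iff]
  rw [ae_restrict_iff' (measurableSet_interval e)]
  filter_upwards [h0, h1] with x hx0 hx1 hx
  rw [edgeDeriv, derivWithin_of_mem_nhds]
  by_cases he : G.length e = ⊤
  · rw [interval_of_eq_top he] at hx ⊢
    exact Ici_mem_nhds (lt_of_le_of_ne hx hx0.symm)
  · rw [interval_of_ne_top he] at hx ⊢
    exact Icc_mem_nhds (lt_of_le_of_ne hx.1 hx0.symm) (lt_of_le_of_ne hx.2 hx1)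

theorem integral_deriv_sq_eq (u : E → ℝ → ℝ) (e : E) :
    ∫ x in G.interval e, deriv (u e) x ^ 2 = G.edgeKinetic u e :=
  integral_congr_ae ((ae_deriv_eq_edgeDeriv u e).mono fun x hx => by simp only [hx])

/-! ### Pointwise bounds, maximum point and Nehari identity -/

namespace IsPositiveSolution

theorem nlsOn (h : G.IsPositiveSolution p lam u) (e : E) :
    NLSOn p lam (G.interval e) (u e) (G.edgeDeriv u e) :=
  ⟨fun x hx => (h.equation e x hx).1.hasDerivWithinAt, fun x hx => (h.equation e x hx).2, h.pos e⟩

theorem integrableOn_sq (h : G.IsPositiveSolution p lam u) (e : E) :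
    IntegrableOn (fun x => u e x ^ 2) (G.interval e) :=
  (h.memH1.sq_integrable.1 e).integrable_sq

theorem integrableOn_deriv_sq (h : G.IsPositiveSolution p lam u) (e : E) :
    IntegrableOn (fun x => G.edgeDeriv u e x ^ 2) (G.interval e) :=
  (h.memH1.sq_integrable_deriv.1 e).integrable_sq.congr
    ((ae_deriv_eq_edgeDeriv u e).mono fun x hx => by simp only [hx])

theorem summable_edgeMass (h : G.IsPositiveSolution p lam u) : Summable (G.edgeMass u) :=
  h.memH1.sq_integrable.2

theorem summable_edgeKinetic (h : G.IsPositiveSolution p lam u) : Summable (G.edgeKinetic u) :=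
  h.memH1.sq_integrable_deriv.2.congr fun e => (integral_deriv_sq_eq u e)

theorem edgeMass_nonneg (u : E → ℝ → ℝ) (e : E) : 0 ≤ G.edgeMass u e :=
  integral_nonneg fun _ => sq_nonneg _

theorem edgeKinetic_nonneg (u : E → ℝ → ℝ) (e : E) : 0 ≤ G.edgeKinetic u e :=
  integral_nonneg fun _ => sq_nonneg _

theorem edgePower_nonneg (h : G.IsPositiveSolution p lam u) (e : E) : 0 ≤ G.edgePower p u e :=
  setIntegral_nonneg (measurableSet_interval e) fun x hx => Real.rpow_nonneg (h.pos e x hx).le p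

theorem mass_eq (u : E → ℝ → ℝ) : G.mass u = ∑' e, G.edgeMass u e := rfl

theorem energy_eq (h : G.IsPositiveSolution p lam u) :
    G.energy p u = 1 / 2 * (∑' e, G.edgeKinetic u e) - 1 / p * ∑' e, G.edgePower p u e := by
  rw [energy]
  congr 2
  · exact (tsum_congr fun e => integral_deriv_sq_eq u e)
  · exact tsum_congr fun e => setIntegral_congr_fun (measurableSet_interval e) fun x hx => by
      simp only [abs_of_pos (h.pos e x hx)]

theorem integral_le_edgeMass (h : G.IsPositiveSolution p lam u) {a b : ℝ} (hab : a ≤ b)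
    (hsub : Icc a b ⊆ G.interval e) : ∫ x in a..b, u e x ^ 2 ≤ G.edgeMass u e := by
  rw [intervalIntegral.integral_of_le hab, ← integral_Icc_eq_integral_Ioc]
  exact setIntegral_mono_set (h.integrableOn_sq e) (Eventually.of_forall fun _ => sq_nonneg _)
    hsub.eventuallyLE

theorem integral_le_edgeKinetic (h : G.IsPositiveSolution p lam u) {a b : ℝ} (hab : a ≤ b)
    (hsub : Icc a b ⊆ G.interval e) :
    ∫ x in a..b, G.edgeDeriv u e x ^ 2 ≤ G.edgeKinetic u e := by
  rw [intervalIntegral.integral_of_le hab, ← integral_Icc_eq_integral_Ioc]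
  exact setIntegral_mono_set (h.integrableOn_deriv_sq e)
    (Eventually.of_forall fun _ => sq_nonneg _) hsub.eventuallyLE

/-- Sobolev on a piece of length exactly `ℓ`, so that the constant is the same for all edges. -/
theorem sq_le_edge (h : G.IsPositiveSolution p lam u) (hG : G.LengthGE ℓ) (hℓ : 0 < ℓ) {x : ℝ}
    (hx : x ∈ G.interval e) :
    u e x ^ 2 ≤ (1 / ℓ + 1) * G.edgeMass u e + G.edgeKinetic u e := by
  obtain ⟨a, hxa, hsub⟩ := exists_Icc_subset hG hℓ hx
  have hn := (h.nlsOn e).mono hsub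
  have h1 := sq_le_integral_add (by linarith) hn.fst hn.continuousOn_deriv hxa
  rw [add_sub_cancel_left] at h1
  have h2 := h.integral_le_edgeMass (e := e) (by linarith) hsub
  have h3 := h.integral_le_edgeKinetic (e := e) (by linarith) hsub
  have h4 : 0 ≤ 1 / ℓ + 1 := by positivity
  nlinarith [mul_le_mul_of_nonneg_left h2 h4]

/-- Sobolev applied to `u'`, with `u''` read off the equation. It makes the squared derivatives at
all edge ends summable, so that sums over ends may be rearranged. -/
theorem edgeDeriv_sq_le_edge (h : G.IsPositiveSolution p lam u) (hp : 2 < p) (hG : G.LengthGE ℓ)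
    (hℓ : 0 < ℓ) (hM : ∀ e, ∀ x ∈ G.interval e, u e x ≤ M) {x : ℝ} (hx : x ∈ G.interval e) :
    G.edgeDeriv u e x ^ 2 ≤
      (1 / ℓ + 1) * G.edgeKinetic u e + (|lam| + M ^ (p - 2)) ^ 2 * G.edgeMass u e := by
  obtain ⟨a, hxa, hsub⟩ := exists_Icc_subset hG hℓ hx
  have hn := (h.nlsOn e).mono hsub
  have hc : ContinuousOn (fun z => lam * u e z - u e z ^ (p - 1)) (Icc a (a + ℓ)) :=
    (continuousOn_const.mul hn.continuousOn).sub (hn.continuousOn_rpow (p - 1))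
  have h1 := sq_le_integral_add (by linarith) hn.snd hc hxa
  rw [add_sub_cancel_left] at h1
  have h2 := h.integral_le_edgeMass (e := e) (by linarith) hsub
  have h3 := h.integral_le_edgeKinetic (e := e) (by linarith) hsub
  have h4 : 0 ≤ 1 / ℓ + 1 := by positivity
  have h5 : ∫ z in a..(a + ℓ), (lam * u e z - u e z ^ (p - 1)) ^ 2 ≤
      ∫ z in a..(a + ℓ), (|lam| + M ^ (p - 2)) ^ 2 * u e z ^ 2 := by
    refine intervalIntegral.integral_mono_on (by linarith)
      ((hc.pow 2).intervalIntegrable_of_Icc (by linarith))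
      ((continuousOn_const.mul (hn.continuousOn.pow 2)).intervalIntegrable_of_Icc (by linarith))
      fun z hz => ?_
    have hs := hn.pos z hz
    rw [NLSOn.rpow_sub_one_mul hs, ← sub_mul, mul_pow]
    refine mul_le_mul_of_nonneg_right ?_ (sq_nonneg _)
    have h6 : u e z ^ (p - 2) ≤ M ^ (p - 2) :=
      Real.rpow_le_rpow hs.le (hM e z (hsub hz)) (by linarith)
    have h7 : 0 ≤ u e z ^ (p - 2) := by positivity
    have h8 := neg_abs_le lam
    have h9 := le_abs_self lam
    exact sq_le_sq' (by linarith) (by linarith)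
  rw [intervalIntegral.integral_const_mul] at h5
  have h6 := mul_le_mul_of_nonneg_left h2 (sq_nonneg (|lam| + M ^ (p - 2)))
  nlinarith [mul_le_mul_of_nonneg_left h3 h4]

theorem tendsto_zero_of_eq_top (h : G.IsPositiveSolution p lam u) (he : G.length e = ⊤) :
    Tendsto (fun x => u e x ^ 2) atTop (𝓝 0) := by
  have hI := interval_of_eq_top he
  have hn := h.nlsOn e
  have h1 := h.integrableOn_sq e
  have h2 := h.integrableOn_deriv_sq e
  rw [hI] at hn h1 h2
  refine tendsto_zero_of_hasDerivAt_of_integrableOn_Ioi (a := 0)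
    (f' := fun x => 2 * u e x * G.edgeDeriv u e x) (fun x hx => ?_) ?_
    (h1.mono_set Ioi_subset_Ici_self)
  · have hx' : x ∈ Ici (0 : ℝ) := Ioi_subset_Ici_self hx
    simpa using! ((hn.fst x hx').hasDerivAt (Ici_mem_nhds hx)).pow 2
  · refine IntegrableOn.mono_set ?_ Ioi_subset_Ici_self
    refine (h1.add h2).mono' (((continuousOn_const.mul hn.continuousOn).mul
      hn.continuousOn_deriv).aestronglyMeasurable measurableSet_Ici)
      (Eventually.of_forall fun x => ?_)
    rw [Real.norm_eq_abs]
    simp only [Pi.add_apply]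
    exact abs_le.2 ⟨by nlinarith [sq_nonneg (u e x + G.edgeDeriv u e x)],
      by nlinarith [sq_nonneg (u e x - G.edgeDeriv u e x)]⟩

theorem exists_isMaxOn_edge (h : G.IsPositiveSolution p lam u) (e : E) :
    ∃ x ∈ G.interval e, IsMaxOn (u e) (G.interval e) x := by
  have hc := (h.nlsOn e).continuousOn
  by_cases he : G.length e = ⊤
  · have h0 := h.pos e 0 (zero_mem_interval e)
    have ht := (h.tendsto_zero_of_eq_top he).eventually
      (gt_mem_nhds (show 0 < u e 0 ^ 2 by positivity))
    have ht2 : ∀ᶠ x in atTop, u e x ≤ u e 0 := by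
      filter_upwards [ht] with x hx
      exact (lt_of_pow_lt_pow_left₀ 2 h0.le hx).le
    obtain ⟨R, hR⟩ := eventually_atTop.1 ht2
    have hI := interval_of_eq_top he
    rw [hI] at hc ⊢
    refine hc.exists_isMaxOn' isClosed_Ici (x₀ := 0) self_mem_Ici ?_
    rw [eventually_inf_principal]
    filter_upwards [(isCompact_Icc (a := 0) (b := R)).compl_mem_cocompact] with x hx hx0
    refine hR x (le_of_lt (not_le.1 fun hxR => hx ⟨hx0, hxR⟩))
  · rw [interval_of_ne_top he] at hc ⊢
    exact isCompact_Icc.exists_isMaxOn (nonempty_Icc.2 ENNReal.toReal_nonneg) hc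

/-- A positive solution attains its maximum. -/
theorem exists_max [Nonempty E] (h : G.IsPositiveSolution p lam u) (hG : G.LengthGE ℓ)
    (hℓ : 0 < ℓ) :
    ∃ e₀, ∃ x₀ ∈ G.interval e₀, ∀ e, ∀ x ∈ G.interval e, u e x ≤ u e₀ x₀ := by
  classical
  obtain ⟨e₁⟩ := ‹Nonempty E›
  choose x hx hmax using h.exists_isMaxOn_edge
  -- The squared edge maxima are bounded by a summable family, so only finitely many edges compete
  -- with `e₁`.
  have hw := (h.summable_edgeMass.mul_left (1 / ℓ + 1)).add h.summable_edgeKinetic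
  have hpos := h.pos e₁ _ (hx e₁)
  have hev := hw.tendsto_cofinite_zero.eventually
    (gt_mem_nhds (show 0 < u e₁ (x e₁) ^ 2 by positivity))
  have hfin := eventually_cofinite.1 hev
  obtain ⟨e₀, he₀, hmax₀⟩ := (insert e₁ hfin.toFinset).exists_max_image (fun e => u e (x e))
    ⟨e₁, Finset.mem_insert_self _ _⟩
  refine ⟨e₀, x e₀, hx e₀, fun e y hy => ?_⟩
  by_cases hmem : e ∈ insert e₁ hfin.toFinset
  · exact (hmax e hy).trans (hmax₀ e hmem)
  · refine le_trans ?_ (hmax₀ e₁ (Finset.mem_insert_self _ _))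
    have h1 : (1 / ℓ + 1) * G.edgeMass u e + G.edgeKinetic u e < u e₁ (x e₁) ^ 2 := by
      by_contra hcon
      exact hmem (Finset.mem_insert_of_mem (hfin.mem_toFinset.2 hcon))
    exact (lt_of_pow_lt_pow_left₀ 2 hpos.le ((h.sq_le_edge hG hℓ hy).trans_lt h1)).le

theorem finsum_ends_eq_sum (hfin : ∀ v, (G.ends v).Finite) (h : G.IsPositiveSolution p lam u)
    (v : V) : ∑ i ∈ (hfin v).toFinset, G.outDeriv u i = 0 := by
  rw [← h.kirchhoff v, finsum_mem_eq_finite_toFinset_sum _ (hfin v)]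

/-- At a maximum point the derivative vanishes, also if that point is a vertex. -/
theorem edgeDeriv_eq_zero_of_max (hfin : ∀ v, (G.ends v).Finite)
    (h : G.IsPositiveSolution p lam u) {x : ℝ} (hx : x ∈ G.interval e)
    (hmax : ∀ e', ∀ y ∈ G.interval e', u e' y ≤ u e x) : G.edgeDeriv u e x = 0 := by
  have hd := (h.nlsOn e).fst x hx
  have hmaxe : IsMaxOn (u e) (G.interval e) x := fun y hy => hmax e y hy
  have hvertex : ∀ v, ∀ i ∈ G.ends v, i.1 = e → G.endCoord i = x → G.edgeDeriv u e x = 0 := by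
    rintro v ⟨e', b⟩ hi rfl rfl
    -- All outgoing derivatives at a maximal vertex are nonpositive and add up to zero, hence all
    -- vanish.
    have hle : ∀ j ∈ G.ends v, G.outDeriv u j ≤ 0 := by
      rintro ⟨e₁, b₁⟩ hj
      have hjx := endCoord_mem hj
      have hval := h.memH1.continuous.2 v _ hj _ hi
      have hmax₁ : IsMaxOn (u e₁) (G.interval e₁) (G.endCoord (e₁, b₁)) := fun y hy => by
        have := hmax e₁ y hy
        simp only at hval
        simp only [Set.mem_ofPred_eq, hval]
        exact this
      have hd₁ := (h.nlsOn e₁).fst _ hjx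
      have hop := (endCoord_mem hj)
      cases b₁
      · by_cases he : G.length e₁ = ⊤
        · have h1 := mul_sub_nonpos_of_isMaxOn (y := 1) (convex_interval e₁) hd₁ hmax₁ hjx
            (by rw [interval_of_eq_top he]; simp)
          simpa [outDeriv, endCoord_false, edgeDeriv] using h1
        · have hL := ENNReal.toReal_pos (G.length_pos e₁).ne' he
          have h1 := mul_sub_nonpos_of_isMaxOn (y := (G.length e₁).toReal)
            (convex_interval e₁) hd₁ hmax₁ hjx
            (by rw [interval_of_ne_top he]; exact right_mem_Icc.2 hL.le)
          rw [endCoord_false, sub_zero] at h1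
          simp only [outDeriv, endCoord_false, Bool.false_eq_true, if_false, one_mul]
          exact nonpos_of_mul_nonpos_right h1 hL
      · have he := length_ne_top_of_mem_ends hj
        have hL := ENNReal.toReal_pos (G.length_pos e₁).ne' he
        have h1 := mul_sub_nonpos_of_isMaxOn (y := 0) (convex_interval e₁) hd₁ hmax₁ hjx
          (zero_mem_interval e₁)
        rw [endCoord_true] at h1
        simp only [outDeriv, endCoord_true, if_true]
        have h2 : 0 ≤ G.edgeDeriv u e₁ (G.length e₁).toReal := by nlinarith
        simpa [edgeDeriv] using h2
    have hsum := finsum_ends_eq_sum hfin h v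
    rw [Finset.sum_eq_zero_iff_of_nonpos fun j hj => hle j ((hfin v).mem_toFinset.1 hj)] at hsum
    have h1 := hsum _ ((hfin v).mem_toFinset.2 hi)
    cases b <;> simpa [outDeriv, edgeDeriv] using h1
  by_cases h0 : x = 0
  · exact hvertex _ _ (mem_ends_false e) rfl (by rw [endCoord_false, h0])
  have hx0 : 0 < x := lt_of_le_of_ne hx.1 (Ne.symm h0)
  have hinterior : G.interval e ∈ 𝓝 x → G.edgeDeriv u e x = 0 := fun hn => by
    rw [edgeDeriv, derivWithin_of_mem_nhds hn]
    exact (hmaxe.isLocalMax hn).deriv_eq_zero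
  by_cases he : G.length e = ⊤
  · exact hinterior (by rw [interval_of_eq_top he]; exact Ici_mem_nhds hx0)
  by_cases h1 : x = (G.length e).toReal
  · obtain ⟨v, hv⟩ := exists_mem_ends_true he
    exact hvertex v _ hv rfl (by rw [endCoord_true, h1])
  · refine hinterior ?_
    rw [interval_of_ne_top he] at hx ⊢
    exact Icc_mem_nhds hx0 (lt_of_le_of_ne hx.2 h1)

/-- The Kirchhoff condition tested against a function on the vertices. -/
theorem tsum_ends_eq_zero (hfin : ∀ v, (G.ends v).Finite) (h : G.IsPositiveSolution p lam u)
    {b : E × Bool → ℝ} (hb : Summable b) (c : V → ℝ)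
    (hc : ∀ v, ∀ i ∈ G.ends v, b i = c v * G.outDeriv u i)
    (hnone : ∀ i, G.endVertex i = none → b i = 0) : ∑' i, b i = 0 := by
  -- Group the ends by their vertex. The fibre over `none` consists of the ends of half-lines at
  -- infinity.
  have h1 := hb.hasSum.tsum_fiberwise G.endVertex
  refine h1.unique ?_
  convert hasSum_zero using 2 with o
  rcases o with _ | v
  · refine (tsum_congr fun i => ?_).trans tsum_zero
    exact hnone i.1 i.2
  · have hset : G.endVertex ⁻¹' {some v} = ((hfin v).toFinset : Set (E × Bool)) := by
      ext i; simp [mem_ends_iff]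
    rw [hset, Finset.tsum_subtype' (hfin v).toFinset b,
      Finset.sum_congr rfl fun i hi => hc v i ((hfin v).mem_toFinset.1 hi), ← Finset.mul_sum,
      finsum_ends_eq_sum hfin h v, mul_zero]

theorem tsum_ends_eq {b : E × Bool → ℝ} (hb : Summable b) :
    Summable (fun e => b (e, true) + b (e, false)) ∧
      ∑' i, b i = ∑' e, (b (e, true) + b (e, false)) := by
  have h1 : ∀ e, HasSum (fun c => b (e, c)) (b (e, true) + b (e, false)) := fun e => by
    have := hasSum_fintype fun c => b (e, c)
    rwa [Fintype.sum_bool] at this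
  have h2 := hb.hasSum.prod_fiberwise h1
  exact ⟨h2.summable, h2.tsum_eq.symm⟩

theorem outDeriv_sq {u : E → ℝ → ℝ} (i : E × Bool) :
    G.outDeriv u i ^ 2 = G.edgeDeriv u i.1 (G.endCoord i) ^ 2 := by
  rw [outDeriv, mul_pow, edgeDeriv]
  split_ifs <;> norm_num

theorem integral_identity_edge (h : G.IsPositiveSolution p lam u) (hp : 2 < p)
    (hM : ∀ e, ∀ x ∈ G.interval e, u e x ≤ M) (e : E) :
    G.edgeKinetic u e + lam * G.edgeMass u e - G.edgePower p u e =
      -((if G.length e = ⊤ then 0 else u e (G.endCoord (e, true)) * G.outDeriv u (e, true)) +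
        u e (G.endCoord (e, false)) * G.outDeriv u (e, false)) := by
  have hn := h.nlsOn e
  have h1 := h.integrableOn_sq e
  have h2 := h.integrableOn_deriv_sq e
  by_cases he : G.length e = ⊤
  · have hMe := hM e
    rw [interval_of_eq_top he] at hn h1 h2 hMe
    have := hn.integral_identity_Ici hp hMe h1 h2
    simp only [edgeKinetic, edgeMass, edgePower, if_pos he, interval_of_eq_top he, this,
      endCoord_false, outDeriv]
    simp [edgeDeriv, interval_of_eq_top he]
  · rw [interval_of_ne_top he] at hn
    have := hn.integral_identity_Icc ENNReal.toReal_nonneg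
    simp only [edgeKinetic, edgeMass, edgePower, if_neg he, interval_of_ne_top he, this,
      endCoord_false, outDeriv, endCoord_true]
    simp [edgeDeriv, interval_of_ne_top he]
    ring

theorem edgePower_le (h : G.IsPositiveSolution p lam u) (hp : 2 < p)
    (hM : ∀ e, ∀ x ∈ G.interval e, u e x ≤ M) (e : E) :
    G.edgePower p u e ≤ M ^ (p - 2) * G.edgeMass u e :=
  ((h.nlsOn e).integrableOn_rpow (measurableSet_interval e) hp (hM e) (h.integrableOn_sq e)).2

theorem summable_edgePower (h : G.IsPositiveSolution p lam u) (hp : 2 < p)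
    (hM : ∀ e, ∀ x ∈ G.interval e, u e x ≤ M) : Summable (G.edgePower p u) :=
  Summable.of_nonneg_of_le h.edgePower_nonneg (h.edgePower_le hp hM)
    (h.summable_edgeMass.mul_left _)

theorem summable_outDeriv_sq_bound (h : G.IsPositiveSolution p lam u) :
    Summable fun i : E × Bool => (1 / ℓ + 1) * G.edgeKinetic u i.1 +
      (|lam| + M ^ (p - 2)) ^ 2 * G.edgeMass u i.1 :=
  summable_of_comp_fst ((h.summable_edgeKinetic.mul_left _).add (h.summable_edgeMass.mul_left _))

/-- The Nehari identity. -/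
theorem nehari (hfin : ∀ v, (G.ends v).Finite) (h : G.IsPositiveSolution p lam u) (hp : 2 < p)
    (hG : G.LengthGE ℓ) (hℓ : 0 < ℓ) (hM : ∀ e, ∀ x ∈ G.interval e, u e x ≤ M) :
    (∑' e, G.edgeKinetic u e) + lam * (∑' e, G.edgeMass u e) - ∑' e, G.edgePower p u e = 0 := by
  classical
  -- Boundary terms of the integration by parts. The end at infinity must be masked, since
  -- `endCoord` gives it the coordinate `(⊤ : ℝ≥0∞).toReal = 0`.
  set b : E × Bool → ℝ := fun i => if G.endVertex i = none then 0 else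
    u i.1 (G.endCoord i) * G.outDeriv u i with hb
  have hmem : ∀ i, G.endVertex i ≠ none → G.endCoord i ∈ G.interval i.1 := fun i hi => by
    obtain ⟨v, hv⟩ := Option.ne_none_iff_exists'.1 hi
    exact endCoord_mem (mem_ends_iff.2 hv)
  have hsum : Summable b := by
    refine Summable.of_norm_bounded ((summable_of_comp_fst ((h.summable_edgeMass.mul_left (1 / ℓ + 1)).add
      h.summable_edgeKinetic)).add (h.summable_outDeriv_sq_bound (ℓ := ℓ) (M := M))) fun i => ?_
    simp only [hb]
    split_ifs with hi
    · have h1 := edgeMass_nonneg (G := G) u i.1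
      have h2 := edgeKinetic_nonneg (G := G) u i.1
      rw [norm_zero]
      positivity
    · have h1 := h.sq_le_edge hG hℓ (hmem i hi)
      have h2 := h.edgeDeriv_sq_le_edge hp hG hℓ hM (hmem i hi)
      rw [← outDeriv_sq] at h2
      rw [Real.norm_eq_abs]
      generalize u i.1 (G.endCoord i) = s at *
      generalize G.outDeriv u i = d at *
      have h3 : |s * d| ≤ s ^ 2 + d ^ 2 :=
        abs_le.2 ⟨by nlinarith [sq_nonneg (s + d), sq_nonneg (s - d)],
          by nlinarith [sq_nonneg (s + d), sq_nonneg (s - d)]⟩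
      linarith
  have hzero : ∑' i, b i = 0 := by
    refine tsum_ends_eq_zero hfin h hsum
      (fun v => if hv : (G.ends v).Nonempty then u hv.some.1 (G.endCoord hv.some) else 0)
      (fun v i hi => ?_) fun i hi => by simp only [hb, if_pos hi]
    have hv : (G.ends v).Nonempty := ⟨i, hi⟩
    have h1 := mem_ends_iff.1 hi
    simp only [hb, h1, dif_pos hv, reduceCtorEq, if_false]
    rw [h.memH1.continuous.2 v i hi _ hv.some_mem]
  rw [(tsum_ends_eq hsum).2] at hzero
  have hedge : ∀ e, G.edgeKinetic u e + lam * G.edgeMass u e - G.edgePower p u e =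
      -(b (e, true) + b (e, false)) := fun e => by
    rw [h.integral_identity_edge hp hM e]
    simp [hb, endVertex, G.target_eq_none_iff e]
  have h1 := h.summable_edgeMass.mul_left lam
  rw [← tsum_mul_left, ← h.summable_edgeKinetic.tsum_add h1,
    ← (h.summable_edgeKinetic.add h1).tsum_sub (h.summable_edgePower hp hM), tsum_congr hedge,
    tsum_neg, hzero, neg_zero]

end IsPositiveSolution

end MetricGraph

/-! ### Summable slowly varying weights on periodic graphs -/

/-- Products of summable families of one variable are summable over the integer lattice. -/
theorem summable_prod_pi {n : ℕ} {α : Type*} {a : α → ℝ} (ha : Summable a) (h0 : ∀ k, 0 ≤ a k) :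
    Summable fun g : Fin n → α => ∏ i, a (g i) := by
  classical
  refine summable_of_sum_le (c := ∏ _i : Fin n, ∑' k, a k)
    (fun g => Finset.prod_nonneg fun i _ => h0 _) fun s => ?_
  calc ∑ g ∈ s, ∏ i, a (g i)
      ≤ ∑ g ∈ Fintype.piFinset fun i => s.image fun g => g i, ∏ i, a (g i) := by
        refine Finset.sum_le_sum_of_subset_of_nonneg (fun g hg => ?_)
          fun g _ _ => Finset.prod_nonneg fun i _ => h0 _
        rw [Fintype.mem_piFinset]
        exact fun i => Finset.mem_image_of_mem _ hg
    _ = ∏ i, ∑ k ∈ s.image fun g => g i, a k := by rw [Finset.prod_univ_sum]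
    _ ≤ _ := Finset.prod_le_prod (fun i _ => Finset.sum_nonneg fun k _ => h0 k)
        fun i _ => ha.sum_le_tsum _ fun k _ => h0 k

theorem summable_exp_neg_abs_int {ε : ℝ} (hε : 0 < ε) :
    Summable fun k : ℤ => Real.exp (-(ε * |(k : ℝ)|)) := by
  have h : Summable fun k : ℕ => Real.exp (-(ε * k)) := by
    have := Real.summable_exp_nat_mul_iff.2 (neg_lt_zero.2 hε)
    refine this.congr fun k => ?_
    congr 1; ring
  refine Summable.of_nat_of_neg ?_ ?_ <;> simpa using h

theorem summable_exp_neg_sum_abs {n : ℕ} {ε : ℝ} (hε : 0 < ε) :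
    Summable fun g : Fin n → ℤ => Real.exp (-(ε * ∑ i, |(g i : ℝ)|)) := by
  refine (summable_prod_pi (summable_exp_neg_abs_int hε) fun k => (Real.exp_pos _).le).congr
    fun g => ?_
  rw [← Real.exp_sum, Finset.sum_neg_distrib, Finset.mul_sum]

namespace MetricGraph

variable {V E : Type*} {G : MetricGraph V E} {p lam ℓ M : ℝ} {u : E → ℝ → ℝ} {e : E}

/-- A vertex with no edge end is related to no other vertex, whereas every vertex is joined to the
source of some edge. -/
theorem ends_nonempty [Nonempty E] (hconn : G.Connected) (v : V) : (G.ends v).Nonempty := by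
  obtain ⟨e₁⟩ := ‹Nonempty E›
  have key : ∀ a b : V, Relation.EqvGen (fun a b => ∃ e, G.source e = a ∧ G.target e = some b) a b →
      ((G.ends a).Nonempty ↔ (G.ends b).Nonempty) := by
    intro a b hab
    induction hab with
    | rel a b h =>
      obtain ⟨e, ha, hb⟩ := h
      exact iff_of_true ⟨(e, false), by rw [mem_ends_iff]; simp [endVertex, ha]⟩
        ⟨(e, true), by rw [mem_ends_iff]; simp [endVertex, hb]⟩
    | refl => rfl
    | symm _ _ _ ih => exact ih.symm
    | trans _ _ _ _ _ ih1 ih2 => exact ih1.trans ih2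
  exact (key _ _ (hconn (G.source e₁) v)).1 ⟨_, mem_ends_false e₁⟩

theorem mem_endpoints_iff {v : V} : v ∈ G.endpoints e ↔ ∃ b, (e, b) ∈ G.ends v := by
  simp [endpoints, mem_ends_iff, endVertex]

theorem finite_endpoints (e : E) : (G.endpoints e).Finite := by
  refine Set.Finite.subset (s := some ⁻¹' {some (G.source e), G.target e})
    ((Set.toFinite _).preimage (Option.some_injective V).injOn) ?_
  rintro v (h | h)
  · simp [h]
  · simp [h]

theorem finite_adjacent (hfin : ∀ v, (G.ends v).Finite) (e : E) :
    {e' | (G.endpoints e ∩ G.endpoints e').Nonempty}.Finite := by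
  refine ((finite_endpoints (G := G) e).biUnion fun v _ => (hfin v).image Prod.fst).subset ?_
  rintro e' ⟨v, hv, hv'⟩
  obtain ⟨b, hb⟩ := mem_endpoints_iff.1 hv'
  exact mem_biUnion hv ⟨(e', b), hb, rfl⟩

/-- On a periodic graph there are positive summable weights which vary slowly. -/
theorem Periodic.exists_weight (hper : G.Periodic) (hfin : ∀ v, (G.ends v).Finite) {η : ℝ}
    (hη : 0 < η) : ∃ ψ : E → ℝ, Summable ψ ∧ (∀ e, 0 < ψ e) ∧
      ∀ e e', (G.endpoints e ∩ G.endpoints e').Nonempty → ψ e ≤ (1 + η) * ψ e' := by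
  obtain ⟨-, -, n, iV, iE, -, hend, -, hfree, F, hF, hcov⟩ := hper
  choose g f hfF hgf using hcov
  set wt : (Fin n → ℤ) → ℝ := fun g => ∑ i, |(g i : ℝ)| with hwt
  -- The translations between adjacent edges form a finite set, by local finiteness and freeness; so
  -- the lattice index of an edge changes by a bounded amount `|D|` from one edge to the next.
  have hA : {k : Fin n → ℤ | ∃ a ∈ F, ∃ b ∈ F,
      (G.endpoints a ∩ G.endpoints (k +ᵥ b)).Nonempty}.Finite := by
    refine (hF.biUnion fun a _ => hF.biUnion fun b _ =>
      (finite_adjacent hfin a).preimage (f := fun k : Fin n → ℤ => k +ᵥ b) ?_).subset ?_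
    · intro k _ k' _ hkk
      have h1 : (-k' + k) +ᵥ b = b := by
        rw [add_vadd]
        simp only at hkk
        rw [hkk, neg_vadd_vadd]
      have := hfree _ _ h1
      rwa [neg_add_eq_zero, eq_comm] at this
    · rintro k ⟨a, ha, b, hb, hab⟩
      exact mem_biUnion ha (mem_biUnion hb hab)
  obtain ⟨D, hD⟩ := (hA.image wt).bddAbove
  have hadj : ∀ e e', (G.endpoints e ∩ G.endpoints e').Nonempty → wt (g e') ≤ wt (g e) + |D| := by
    rintro e e' ⟨v, hv, hv'⟩
    have hmem : -g e + g e' ∈ {k : Fin n → ℤ | ∃ a ∈ F, ∃ b ∈ F,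
        (G.endpoints a ∩ G.endpoints (k +ᵥ b)).Nonempty} := by
      refine ⟨f e, hfF e, f e', hfF e', -g e +ᵥ v, ?_, ?_⟩
      · have h1 : f e = -g e +ᵥ e := by
          have h2 := congrArg (fun z => -g e +ᵥ z) (hgf e)
          simp only [neg_vadd_vadd] at h2
          exact h2.symm
        rw [h1, hend]
        exact mem_image_of_mem _ hv
      · rw [add_vadd, ← hgf e', hend]
        exact mem_image_of_mem _ hv'
    have h1 : wt (-g e + g e') ≤ D := hD (mem_image_of_mem _ hmem)
    have h2 : wt (g e') ≤ wt (g e) + wt (-g e + g e') := by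
      simp only [hwt, ← Finset.sum_add_distrib]
      refine Finset.sum_le_sum fun i _ => ?_
      calc |(g e' i : ℝ)| = |(g e i : ℝ) + (-g e i + g e' i : ℝ)| := by congr 1; ring
        _ ≤ _ := by
          refine (abs_add_le _ _).trans (le_of_eq ?_)
          simp
    linarith [le_abs_self D]
  -- The decay rate at which a step of length `|D|` changes the weight `exp (-ε |g|)` by a factor `1
  -- + η` at most. Any positive rate is summable on ℤⁿ.
  set ε := Real.log (1 + η) / (|D| + 1) with hε
  have hlog : 0 < Real.log (1 + η) := Real.log_pos (by linarith)
  have hD1 : 0 < |D| + 1 := by positivity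
  have hε0 : 0 < ε := div_pos hlog hD1
  have hεD : ε * |D| ≤ Real.log (1 + η) := by
    have : ε * (|D| + 1) = Real.log (1 + η) := div_mul_cancel₀ _ hD1.ne'
    linarith
  refine ⟨fun e => Real.exp (-(ε * wt (g e))), ?_, fun e => Real.exp_pos _, fun e e' h => ?_⟩
  · have : Finite F := hF
    have h1 := summable_of_comp_fst (ι := F) (summable_exp_neg_sum_abs (n := n) hε0)
    refine h1.comp_injective (i := fun e => (g e, (⟨f e, hfF e⟩ : F))) fun e e' h => ?_
    simp only [Prod.mk.injEq, Subtype.mk.injEq] at h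
    rw [hgf e, hgf e', h.1, h.2]
  · have h1 : 1 + η = Real.exp (Real.log (1 + η)) := (Real.exp_log (by linarith)).symm
    rw [h1, ← Real.exp_add]
    refine Real.exp_le_exp.2 ?_
    have h2 := mul_le_mul_of_nonneg_left (hadj e e' h) hε0.le
    linarith

namespace IsPositiveSolution

/-! ### The sign of the frequency -/

/-- The mechanical energy vanishes on a half-line, while for `lam ≤ 0` it would be positive. -/
theorem pos_of_length_eq_top (h : G.IsPositiveSolution p lam u) (hp : 2 < p)
    (hM : ∀ e, ∀ x ∈ G.interval e, u e x ≤ M) (he : G.length e = ⊤) : 0 < lam := by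
  have hn := h.nlsOn e
  have h1 := h.integrableOn_sq e
  have h2 := h.integrableOn_deriv_sq e
  have hMe := hM e
  rw [interval_of_eq_top he] at hn h1 h2 hMe
  have hC := hn.energy_eq_zero hp hMe h1 h2 (self_mem_Ici : (0 : ℝ) ∈ Ici 0)
  have hs := hn.pos 0 self_mem_Ici
  have h3 : 0 < u e 0 ^ p / p := by positivity
  rw [nlsEnergy] at hC
  by_contra hlam
  have : lam * u e 0 ^ 2 ≤ 0 := mul_nonpos_of_nonpos_of_nonneg (not_lt.1 hlam) (sq_nonneg _)
  nlinarith [sq_nonneg (G.edgeDeriv u e 0)]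

/-- The group of periods being amenable, there is no positive solution of negative frequency. -/
theorem nonneg_of_periodic (hconn : G.Connected) (hfin : ∀ v, (G.ends v).Finite)
    (hper : G.Periodic) (h : G.IsPositiveSolution p lam u) (hp : 2 < p) (hG : G.LengthGE ℓ)
    (hℓ : 0 < ℓ) (hM : ∀ e, ∀ x ∈ G.interval e, u e x ≤ M) : 0 ≤ lam := by
  by_contra! hlam
  have hinf : Infinite E := hper.1
  have hne : ∀ e, G.length e ≠ ⊤ := fun e => by
    obtain ⟨L, hL⟩ := hper.2.1
    exact ne_top_of_le_ne_top ENNReal.ofReal_ne_top (hL e)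
  -- The variation must satisfy `6 η / ℓ² < -lam`, for the coefficient in `le_of_affine_test` with
  -- `ε = 3 * η` to be positive.
  set η := min 1 (-lam * ℓ ^ 2 / 16) with hη
  have hη0 : 0 < η := lt_min one_pos (by
    have : 0 < -lam := by linarith
    positivity)
  obtain ⟨ψ, hψs, hψ0, hψ⟩ := hper.exists_weight hfin hη0
  choose j hj using ends_nonempty hconn
  set φ : V → ℝ := fun v => ψ (j v).1 with hφ
  have hφb : ∀ v, ∀ i ∈ G.ends v, ψ i.1 ≤ (1 + η) * φ v ∧ φ v ≤ (1 + η) * ψ i.1 := by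
    intro v i hi
    have h1 : v ∈ G.endpoints i.1 := mem_endpoints_iff.2 ⟨i.2, hi⟩
    have h2 : v ∈ G.endpoints (j v).1 := mem_endpoints_iff.2 ⟨(j v).2, hj v⟩
    exact ⟨hψ _ _ ⟨v, h1, h2⟩, hψ _ _ ⟨v, h2, h1⟩⟩
  set b : E × Bool → ℝ := fun i => (G.endVertex i).elim 0 φ * G.outDeriv u i with hb
  have hψ2 : Summable fun e => ψ e ^ 2 := by
    refine Summable.of_norm_bounded_eventually hψs ?_
    filter_upwards [hψs.tendsto_cofinite_zero.eventually (gt_mem_nhds one_pos)] with e he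
    rw [Real.norm_of_nonneg (sq_nonneg _)]
    nlinarith [hψ0 e]
  have hsome : ∀ i, ∃ v, i ∈ G.ends v := by
    rintro ⟨e, _ | _⟩
    · exact ⟨_, mem_ends_false e⟩
    · exact exists_mem_ends_true (hne e)
  have hsum : Summable b := by
    refine Summable.of_norm_bounded ((summable_of_comp_fst (hψ2.mul_left ((1 + η) ^ 2))).add
      (h.summable_outDeriv_sq_bound (ℓ := ℓ) (M := M))) fun i => ?_
    obtain ⟨v, hv⟩ := hsome i
    have h1 := (hφb v i hv).2
    have h2 := h.edgeDeriv_sq_le_edge hp hG hℓ hM (endCoord_mem hv)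
    rw [← outDeriv_sq] at h2
    have h0 : 0 < φ v := hψ0 _
    have h3 : φ v ^ 2 ≤ (1 + η) ^ 2 * ψ i.1 ^ 2 := by
      rw [← mul_pow]; exact pow_le_pow_left₀ h0.le h1 2
    simp only [hb, mem_ends_iff.1 hv, Option.elim_some, Real.norm_eq_abs]
    generalize G.outDeriv u i = d at *
    generalize φ v = s at *
    have h4 : |s * d| ≤ s ^ 2 + d ^ 2 :=
      abs_le.2 ⟨by nlinarith [sq_nonneg (s + d), sq_nonneg (s - d)],
        by nlinarith [sq_nonneg (s + d), sq_nonneg (s - d)]⟩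
    linarith
  have hzero : ∑' i, b i = 0 := tsum_ends_eq_zero hfin h hsum φ
    (fun v i hi => by simp [hb, mem_ends_iff.1 hi])
    (fun i hi => by simp [hb, hi])
  -- The contradiction: the boundary terms vanish in total, grouped by vertices, but are positive on
  -- each edge.
  have hpos : ∀ e, 0 < b (e, true) + b (e, false) := by
    intro e
    have hn := h.nlsOn e
    have hLℓ := hG.le_toReal (hne e)
    obtain ⟨v₁, hv₁⟩ := exists_mem_ends_true (hne e)
    have hv₀ := mem_ends_false (G := G) e
    have a0 := hφb _ _ hv₀
    have a1 := hφb _ _ hv₁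
    rw [interval_of_ne_top (hne e)] at hn
    set L := (G.length e).toReal with hL
    have hη1 : η ≤ 1 := min_le_left _ _
    have hη2 : η ≤ -lam * ℓ ^ 2 / 16 := min_le_right _ _
    have hm : 0 < ψ e / (1 + η) := div_pos (hψ0 e) (by linarith)
    have hmψ : ψ e / (1 + η) * (1 + η) = ψ e := div_mul_cancel₀ _ (by linarith)
    simp only at a0 a1
    set m := ψ e / (1 + η)
    have hηm : η * (η * m) ≤ η * m := by nlinarith [mul_pos hη0 hm]
    -- The weights at both vertices lie between `m` and `(1 + η)² m ≤ (1 + 3η) m`, as `η ≤ 1`.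
    have hup : ∀ s, s ≤ (1 + η) * ψ e → s ≤ m + 3 * η * m := fun s hs => by
      rw [← hmψ] at hs; linarith
    have hlo : ∀ s, ψ e ≤ (1 + η) * s → m ≤ s := fun s hs => by
      rw [← hmψ, mul_comm] at hs
      exact le_of_mul_le_mul_left hs (by linarith)
    have key := hn.le_of_affine_test (φ₀ := φ (G.source e)) (φ₁ := φ v₁) (m := m) (ε := 3 * η)
      hlam (by linarith) hm (hlo _ a0.1) (hlo _ a1.1)
      (abs_le.2 ⟨by linarith [hlo _ a1.1, hup _ a0.2], by linarith [hlo _ a0.1, hup _ a1.2]⟩)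
    have hint : 0 < ∫ x in (0 : ℝ)..L, u e x := intervalIntegral.intervalIntegral_pos_of_pos_on
      (hn.continuousOn.intervalIntegrable_of_Icc (by linarith))
      (fun x hx => hn.pos x (Ioo_subset_Icc_self hx)) (by linarith)
    have hcoef : 0 < -lam - 2 * (3 * η) / (L - 0) ^ 2 := by
      rw [sub_zero, sub_pos, div_lt_iff₀ (by nlinarith)]
      have : ℓ ^ 2 ≤ L ^ 2 := pow_le_pow_left₀ hℓ.le hLℓ 2
      nlinarith [mul_le_mul_of_nonneg_left this (by linarith : 0 ≤ -lam), pow_pos hℓ 2]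
    have hbe : b (e, true) + b (e, false) =
        φ (G.source e) * G.edgeDeriv u e 0 - φ v₁ * G.edgeDeriv u e L := by
      simp only [hb, mem_ends_iff.1 hv₁, mem_ends_iff.1 hv₀, Option.elim_some, outDeriv,
        endCoord_true, endCoord_false, edgeDeriv, hL, if_true, Bool.false_eq_true, if_false]
      ring
    rw [hbe]
    refine lt_of_lt_of_le ?_ key
    positivity
  have h1 := tsum_ends_eq hsum
  rw [hzero] at h1
  obtain ⟨e₁⟩ := (inferInstance : Nonempty E)
  exact absurd h1.2 (h1.1.tsum_pos (fun e => (hpos e).le) e₁ (hpos e₁)).ne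

/-! ### Gagliardo–Nirenberg inequality and size of the frequency -/

theorem exists_sq_lt (hnc : G.Noncompact) (h : G.IsPositiveSolution p lam u) (hG : G.LengthGE ℓ)
    (hℓ : 0 < ℓ) {t : ℝ} (ht : 0 < t) : ∃ e, ∃ x ∈ G.interval e, u e x ^ 2 < t := by
  rcases hnc with ⟨e, he⟩ | hinf
  · obtain ⟨x, hx, hx0⟩ := (((h.tendsto_zero_of_eq_top he).eventually (gt_mem_nhds ht)).and
      (eventually_ge_atTop (0 : ℝ))).exists
    exact ⟨e, x, by rw [interval_of_eq_top he]; exact hx0, hx⟩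
  · obtain ⟨e, he⟩ := (h.summable_edgeMass.tendsto_cofinite_zero.eventually
      (gt_mem_nhds (mul_pos ht hℓ))).exists
    have hsub : Icc 0 ℓ ⊆ G.interval e := fun x hx => mem_interval_of_le hG hx.1 hx.2
    obtain ⟨y, hy, hy2⟩ := exists_sq_le_average hℓ ((h.nlsOn e).continuousOn.mono hsub)
    refine ⟨e, y, hsub hy, ?_⟩
    have h1 := h.integral_le_edgeMass hℓ.le hsub
    rw [sub_zero] at hy2
    exact lt_of_mul_lt_mul_right (hy2.trans_lt (h1.trans_lt he)) hℓ.le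

/-- Every level below the maximum is attained. -/
theorem exists_sq_eq (hconn : G.Connected) (hnc : G.Noncompact) (h : G.IsPositiveSolution p lam u)
    (hG : G.LengthGE ℓ) (hℓ : 0 < ℓ) {e₀ : E} {x₀ t : ℝ} (hx₀ : x₀ ∈ G.interval e₀) (ht : 0 < t)
    (htM : t < u e₀ x₀ ^ 2) : ∃ e, ∃ x ∈ G.interval e, u e x ^ 2 = t := by
  by_contra! hne
  have hedge : ∀ e, ∀ x ∈ G.interval e, ∀ y ∈ G.interval e, t < u e x ^ 2 → t < u e y ^ 2 := by
    intro e x hx y hy hxt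
    by_contra hyt
    have hc : ContinuousOn (fun z => u e z ^ 2) (G.interval e) := (h.nlsOn e).continuousOn.pow 2
    obtain ⟨z, hz, hzt⟩ := (convex_interval e).isPreconnected.intermediate_value hy hx hc
      ⟨not_lt.1 hyt, hxt.le⟩
    exact hne e z hz hzt
  -- If the level `t` is never attained, being above it propagates along edges and through vertices
  -- to the whole connected graph; but `u²` takes arbitrarily small values.
  set S : V → Prop := fun v => ∀ i ∈ G.ends v, t < u i.1 (G.endCoord i) ^ 2 with hS
  have hSone : ∀ v, ∀ i ∈ G.ends v, t < u i.1 (G.endCoord i) ^ 2 → S v := fun v i hi hit k hk => by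
    rw [h.memH1.continuous.2 v k hk i hi]; exact hit
  have key : ∀ a b : V, Relation.EqvGen (fun a b => ∃ e, G.source e = a ∧ G.target e = some b) a b →
      (S a ↔ S b) := by
    intro a b hab
    induction hab with
    | rel a b hr =>
      obtain ⟨e, ha, hb⟩ := hr
      have h0 : (e, false) ∈ G.ends a := by rw [mem_ends_iff]; simp [endVertex, ha]
      have h1 : (e, true) ∈ G.ends b := by rw [mem_ends_iff]; simp [endVertex, hb]
      exact ⟨fun hs => hSone b _ h1 (hedge e _ (endCoord_mem h0) _ (endCoord_mem h1) (hs _ h0)),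
        fun hs => hSone a _ h0 (hedge e _ (endCoord_mem h1) _ (endCoord_mem h0) (hs _ h1))⟩
    | refl => rfl
    | symm _ _ _ ih => exact ih.symm
    | trans _ _ _ _ _ ih1 ih2 => exact ih1.trans ih2
  have hall : ∀ e, ∀ x ∈ G.interval e, t < u e x ^ 2 := by
    intro e x hx
    have h0 := endCoord_mem (mem_ends_false (G := G) e₀)
    have h1 := endCoord_mem (mem_ends_false (G := G) e)
    have h2 := hSone _ _ (mem_ends_false e₀) (hedge e₀ x₀ hx₀ _ h0 htM)
    have h3 := (key _ _ (hconn (G.source e₀) (G.source e))).1 h2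
    exact hedge e _ h1 x hx (h3 _ (mem_ends_false e))
  obtain ⟨e, x, hx, hlt⟩ := h.exists_sq_lt hnc hG hℓ ht
  exact absurd (hall e x hx) hlt.not_gt

/-- Integrates `|2 u u'| ≤ α u² + α⁻¹ u'²`. The weight `α` stays free, to be chosen from the maximum
of `u`. -/
theorem abs_sq_sub_sq_le (h : G.IsPositiveSolution p lam u) {α : ℝ} (hα : 0 < α) {x y : ℝ}
    (hx : x ∈ G.interval e) (hy : y ∈ G.interval e) :
    |u e y ^ 2 - u e x ^ 2| ≤ α * G.edgeMass u e + α⁻¹ * G.edgeKinetic u e := by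
  wlog hxy : x ≤ y generalizing x y
  · rw [abs_sub_comm]; exact this hy hx (le_of_not_ge hxy)
  have hsub := Icc_subset_interval hx hy
  have hn := (h.nlsOn e).mono hsub
  have i1 : ContinuousOn (fun z => α * u e z ^ 2) (Icc x y) :=
    continuousOn_const.mul (hn.continuousOn.pow 2)
  have i2 : ContinuousOn (fun z => α⁻¹ * G.edgeDeriv u e z ^ 2) (Icc x y) :=
    continuousOn_const.mul (hn.continuousOn_deriv.pow 2)
  have key := abs_sub_le_integral (F := fun z => u e z ^ 2)
    (F' := fun z => 2 * u e z * G.edgeDeriv u e z)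
    (φ := fun z => α * u e z ^ 2 + α⁻¹ * G.edgeDeriv u e z ^ 2) (x := x) (y := y)
    (fun z hz => by simpa using! (hn.fst z hz).pow 2) (i1.add i2)
    (fun z _ => by
      generalize u e z = s
      generalize G.edgeDeriv u e z = d
      have h1 : α * s ^ 2 + α⁻¹ * d ^ 2 - 2 * s * d = α⁻¹ * (α * s - d) ^ 2 := by field_simp; ring
      have h2 : α * s ^ 2 + α⁻¹ * d ^ 2 + 2 * s * d = α⁻¹ * (α * s + d) ^ 2 := by field_simp; ring
      have h3 : 0 ≤ α⁻¹ * (α * s - d) ^ 2 := by positivity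
      have h4 : 0 ≤ α⁻¹ * (α * s + d) ^ 2 := by positivity
      exact abs_le.2 ⟨by linarith, by linarith⟩)
    (left_mem_Icc.2 hxy) (right_mem_Icc.2 hxy)
  rw [intervalIntegral.integral_add (i1.intervalIntegrable_of_Icc hxy)
    (i2.intervalIntegrable_of_Icc hxy), intervalIntegral.integral_const_mul,
    intervalIntegral.integral_const_mul] at key
  have h1 := mul_le_mul_of_nonneg_left (h.integral_le_edgeMass hxy hsub) hα.le
  have h2 := mul_le_mul_of_nonneg_left (h.integral_le_edgeKinetic hxy hsub) (inv_pos.2 hα).le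
  linarith

/-- A Gagliardo–Nirenberg inequality on noncompact graphs. -/
theorem max_sq_le (hconn : G.Connected) [Countable E] (hnc : G.Noncompact)
    (h : G.IsPositiveSolution p lam u) (hG : G.LengthGE ℓ) (hℓ : 0 < ℓ) {e₀ : E} {x₀ α : ℝ}
    (hx₀ : x₀ ∈ G.interval e₀) (hα : 0 < α) :
    u e₀ x₀ ^ 2 ≤ α * (∑' e, G.edgeMass u e) + α⁻¹ * ∑' e, G.edgeKinetic u e := by
  set r : E → ℝ := fun e => α * G.edgeMass u e + α⁻¹ * G.edgeKinetic u e with hr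
  have hr0 : ∀ e, 0 ≤ r e := fun e => by
    have h1 := edgeMass_nonneg (G := G) u e
    have h2 := edgeKinetic_nonneg (G := G) u e
    positivity
  have hr1 := h.summable_edgeMass.mul_left α
  have hr2 := h.summable_edgeKinetic.mul_left α⁻¹
  have hsum : Summable r := hr1.add hr2
  -- The countably many edges cover all levels, so the length of this interval is at most the sum of
  -- the oscillations of `u²` on them; no path from the maximum is needed.
  have hcov : Ioo 0 (u e₀ x₀ ^ 2) ⊆ ⋃ e, (fun x => u e x ^ 2) '' G.interval e := by
    intro t ht
    obtain ⟨e, x, hx, hxt⟩ := h.exists_sq_eq hconn hnc hG hℓ hx₀ ht.1 ht.2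
    exact mem_iUnion.2 ⟨e, x, hx, hxt⟩
  have hvol : ∀ e, volume ((fun x => u e x ^ 2) '' G.interval e) ≤ ENNReal.ofReal (r e) := by
    intro e
    refine (Real.volume_le_diam _).trans (Metric.ediam_le ?_)
    rintro _ ⟨x, hx, rfl⟩ _ ⟨y, hy, rfl⟩
    rw [edist_dist, Real.dist_eq]
    exact ENNReal.ofReal_le_ofReal (h.abs_sq_sub_sq_le hα hy hx)
  have hle : ENNReal.ofReal (u e₀ x₀ ^ 2) ≤ ENNReal.ofReal (∑' e, r e) := by
    calc ENNReal.ofReal (u e₀ x₀ ^ 2) = volume (Ioo 0 (u e₀ x₀ ^ 2)) := by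
          rw [Real.volume_Ioo, sub_zero]
      _ ≤ ∑' e, volume ((fun x => u e x ^ 2) '' G.interval e) :=
        (measure_mono hcov).trans (measure_iUnion_le _)
      _ ≤ ∑' e, ENNReal.ofReal (r e) := ENNReal.tsum_le_tsum hvol
      _ = _ := (ENNReal.ofReal_tsum_of_nonneg hr0 hsum).symm
  rw [ENNReal.ofReal_le_ofReal_iff (tsum_nonneg hr0), hr1.tsum_add hr2, tsum_mul_left,
    tsum_mul_left] at hle
  exact hle

/-- Small mass forces a large maximum. -/
theorem one_le_mass_mul_max (hG' : G.InClass) (hnc : G.Noncompact)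
    (h : G.IsPositiveSolution p lam u) (hlam : 0 ≤ lam) (hp : 6 < p)
    (hG : G.LengthGE ℓ) (hℓ : 0 < ℓ) {e₀ : E} {x₀ : ℝ} (hx₀ : x₀ ∈ G.interval e₀)
    (hM : ∀ e, ∀ x ∈ G.interval e, u e x ≤ u e₀ x₀) :
    1 ≤ 2 * G.mass u * u e₀ x₀ ^ ((p - 6) / 2) := by
  have := hG'.countable
  have hpos := h.pos e₀ x₀ hx₀
  set m := u e₀ x₀ with hm
  -- The choice of `α` that balances the two terms, the kinetic term being at most `m ^ (p - 2)`
  -- times the mass.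
  have hα : 0 < m ^ ((p - 2) / 2) := by positivity
  have h1 := h.max_sq_le hG'.connected hnc hG hℓ hx₀ hα
  have h2 := h.nehari hG'.finite_ends (by linarith) hG hℓ hM
  have h3 : ∑' e, G.edgePower p u e ≤ m ^ (p - 2) * ∑' e, G.edgeMass u e := by
    rw [← tsum_mul_left]
    exact (h.summable_edgePower (by linarith) hM).tsum_le_tsum (h.edgePower_le (by linarith) hM)
      (h.summable_edgeMass.mul_left _)
  have h4 : 0 ≤ ∑' e, G.edgeMass u e := tsum_nonneg (edgeMass_nonneg u)
  have h5 : ∑' e, G.edgeKinetic u e ≤ m ^ (p - 2) * ∑' e, G.edgeMass u e := by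
    have := mul_nonneg hlam h4
    linarith
  have e1 : m ^ (p - 2) = m ^ ((p - 2) / 2) * m ^ ((p - 2) / 2) := by
    rw [← Real.rpow_add hpos]; ring_nf
  have e2 : m ^ ((p - 2) / 2) = m ^ ((p - 6) / 2) * m ^ 2 := by
    rw [← Real.rpow_natCast m 2, ← Real.rpow_add hpos]
    congr 1; push_cast; ring
  rw [← mass_eq] at h1 h4 h5
  set α := m ^ ((p - 2) / 2)
  have h6 : α⁻¹ * ∑' e, G.edgeKinetic u e ≤ α * G.mass u := by
    rw [inv_mul_le_iff₀ hα, ← mul_assoc, ← e1]; exact h5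
  have h7 : m ^ 2 * 1 ≤ m ^ 2 * (2 * G.mass u * m ^ ((p - 6) / 2)) := by
    rw [← hm] at h1
    have : m ^ 2 * (2 * G.mass u * m ^ ((p - 6) / 2)) = 2 * (α * G.mass u) := by
      rw [e2]; ring
    rw [this]; linarith
  exact le_of_mul_le_mul_left h7 (by positivity)

/-- A large maximum forces a large frequency. -/
theorem max_rpow_le_frequency (hfin : ∀ v, (G.ends v).Finite) (h : G.IsPositiveSolution p lam u)
    (hp : 6 < p) (hG : G.LengthGE ℓ) (hℓ : 0 < ℓ) {e₀ : E} {x₀ : ℝ}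
    (hx₀ : x₀ ∈ G.interval e₀) (hM : ∀ e, ∀ x ∈ G.interval e, u e x ≤ u e₀ x₀)
    (hlarge : 16 * Real.pi * p / ℓ < u e₀ x₀ ^ ((p - 2) / 2)) :
    u e₀ x₀ ^ (p - 2) ≤ p * lam := by
  by_contra! hlt
  have hd := h.edgeDeriv_eq_zero_of_max hfin hx₀ hM
  have hπ := Real.pi_pos
  have hp0 : 0 < p := by linarith
  have hpos := h.pos e₀ x₀ hx₀
  obtain ⟨a, hxa, hsub⟩ := exists_Icc_subset hG hℓ hx₀
  have hn := (h.nlsOn e₀).mono hsub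
  set m := u e₀ x₀ with hm
  set N := m ^ ((p - 2) / 2) with hN
  have hN0 : 0 < N := by positivity
  have e1 : m ^ (p - 2) = N ^ 2 := by
    rw [hN, pow_two, ← Real.rpow_add hpos]; ring_nf
  have hC : ∀ x ∈ Icc a (a + ℓ), nlsEnergy p lam (u e₀ x) (G.edgeDeriv u e₀ x) =
      nlsEnergy p lam m 0 := fun x hx => by
    rw [hn.energy_eq hp0.ne' (convex_Icc _ _) hx hxa, hd]
  -- If `p * lam < m ^ (p - 2)`, the quadratic term of the energy at the maximum, where the
  -- derivative vanishes, is at most half of the power term.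
  have hC1 : m ^ p * (1 / (2 * p)) ≤ nlsEnergy p lam m 0 := by
    have h1 : lam * m ^ 2 ≤ m ^ p / p := by
      rw [NLSOn.rpow_eq_mul_sq hpos p, le_div_iff₀ hp0]
      nlinarith [pow_pos hpos 2]
    rw [nlsEnergy]
    have h2 : m ^ p * (1 / (2 * p)) = m ^ p / p - m ^ p / p / 2 := by field_simp; ring
    rw [h2]; linarith
  have hC0 : 0 < nlsEnergy p lam m 0 := lt_of_lt_of_le (by positivity) hC1
  have h16 : 2 * Real.pi / ℓ ≤ N := by
    refine le_trans ?_ hlarge.le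
    rw [div_le_div_iff_of_pos_right hℓ]
    nlinarith
  -- `Λ = N² = m ^ (p - 2)` dominates `lam`. The outcome `N² / (2p) ≤ 8πN / ℓ` contradicts the size
  -- of `N`.
  have key := hn.energy_rpow_le (Λ := N ^ 2) hp (by linarith) hC hC0 (by rw [← e1]; nlinarith)
    (by rw [add_sub_cancel_left]; exact pow_le_pow_left₀ (by positivity) h16 2)
  rw [Real.sqrt_sq hN0.le, add_sub_cancel_left] at key
  have hθ : 0 ≤ (p - 2) / p := div_nonneg (by linarith) hp0.le
  have h3 : N ^ 2 * (1 / (2 * p)) ≤ nlsEnergy p lam m 0 ^ ((p - 2) / p) := by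
    calc N ^ 2 * (1 / (2 * p)) ≤ N ^ 2 * (1 / (2 * p)) ^ ((p - 2) / p) := by
          refine mul_le_mul_of_nonneg_left ?_ (sq_nonneg _)
          have := Real.rpow_le_rpow_of_exponent_ge (x := 1 / (2 * p)) (by positivity)
            ((div_le_one (by positivity)).2 (by linarith))
            (show (p - 2) / p ≤ 1 from (div_le_one hp0).2 (by linarith))
          rwa [Real.rpow_one] at this
      _ = (m ^ p * (1 / (2 * p))) ^ ((p - 2) / p) := by
          rw [Real.mul_rpow (by positivity) (by positivity), ← Real.rpow_mul hpos.le,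
            mul_div_cancel₀ _ hp0.ne', e1]
      _ ≤ _ := Real.rpow_le_rpow (by positivity) hC1 hθ
  have h4 : N ^ 2 * (1 / (2 * p)) ≤ 8 * Real.pi * N / ℓ := h3.trans key
  have h5 : N ≤ 16 * Real.pi * p / ℓ := by
    rw [mul_one_div, div_le_div_iff₀ (by positivity) hℓ] at h4
    rw [le_div_iff₀ hℓ]
    have : N * (N * ℓ) ≤ N * (16 * Real.pi * p) := by nlinarith
    exact le_of_mul_le_mul_left this hN0
  linarith

/-- The frequency is large when the mass is small. -/
theorem frequency_large (hG' : G.InClass) (hnc : G.Noncompact)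
    (h : G.IsPositiveSolution p lam u) (hlam : 0 ≤ lam) (hp : 6 < p)
    (hG : G.LengthGE ℓ) (hℓ : 0 < ℓ) {e₀ : E} {x₀ : ℝ} (hx₀ : x₀ ∈ G.interval e₀)
    (hM : ∀ e, ∀ x ∈ G.interval e, u e x ≤ u e₀ x₀)
    (hμ1 : 0 < G.mass u) (hμ2 : G.mass u ≤ 1 / 2) (hμ3 : 32 * Real.pi * p * G.mass u < ℓ) :
    1 ≤ u e₀ x₀ ∧ 1 ≤ 4 * p * G.mass u ^ 2 * lam := by
  have hπ := Real.pi_pos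
  have h1 := h.one_le_mass_mul_max hG' hnc hlam hp hG hℓ hx₀ hM
  have hpos := h.pos e₀ x₀ hx₀
  set m := u e₀ x₀ with hm
  set μ := G.mass u
  have hmp : 0 < m ^ ((p - 6) / 2) := by positivity
  have hge : 1 ≤ m := by
    by_contra! hlt
    have h2 := Real.rpow_lt_one hpos.le hlt (show 0 < (p - 6) / 2 by linarith)
    nlinarith
  have h2 : m ^ ((p - 6) / 2) ≤ m ^ ((p - 2) / 2) :=
    Real.rpow_le_rpow_of_exponent_le hge (by linarith)
  set N := m ^ ((p - 2) / 2) with hN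
  have h3 : 1 ≤ 2 * μ * N := h1.trans (mul_le_mul_of_nonneg_left h2 (by positivity))
  have hN0 : 0 < N := by positivity
  have h4 : 16 * Real.pi * p / ℓ < N := by
    rw [div_lt_iff₀ hℓ]
    have h5 : 32 * Real.pi * p * μ * N < ℓ * N := mul_lt_mul_of_pos_right hμ3 hN0
    have h6 : 16 * Real.pi * p * 1 ≤ 16 * Real.pi * p * (2 * μ * N) :=
      mul_le_mul_of_nonneg_left h3 (by positivity)
    linarith
  have h5 := h.max_rpow_le_frequency hG'.finite_ends hp hG hℓ hx₀ hM h4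
  have e1 : m ^ (p - 2) = N ^ 2 := by
    rw [hN, pow_two, ← Real.rpow_add hpos]; ring_nf
  rw [← hm, e1] at h5
  refine ⟨hge, ?_⟩
  have h6 : 1 ≤ (2 * μ * N) ^ 2 := one_le_pow₀ h3
  nlinarith [pow_pos hμ1 2]

end IsPositiveSolution

end MetricGraph

namespace MetricGraph

variable {V E : Type*} {G : MetricGraph V E} {p lam ℓ M : ℝ} {u : E → ℝ → ℝ} {e : E}

/-! ### Mass needed to descend from the maximum -/

/-- Without pendants every vertex has degree at least two, unless the graph is a half-line. -/
theorem two_le_degree [Nonempty E] (hconn : G.Connected) (hfin : ∀ v, (G.ends v).Finite)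
    (hpend : ¬ G.HasPendant) (hhalf : ¬ G.IsHalfLine) (v : V) : 2 ≤ G.degree v := by
  by_contra! hlt
  have h1 : 0 < G.degree v := (Set.ncard_pos (hfin v)).2 (ends_nonempty hconn v)
  have hdeg : G.degree v = 1 := by omega
  obtain ⟨⟨e, b⟩, hends⟩ := Set.ncard_eq_one.1 hdeg
  have hmem : (e, b) ∈ G.ends v := by rw [hends]; exact mem_singleton _
  have htop : G.length e = ⊤ := by
    by_contra he
    exact hpend ⟨e, he, v, mem_endpoints_iff.2 ⟨b, hmem⟩, hdeg⟩
  have htarget := (G.target_eq_none_iff e).2 htop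
  -- The only edge end at `v` belongs to a half-line, so no bounded edge meets `v` and `v` is the
  -- only vertex.
  have key : ∀ a b : V, Relation.EqvGen (fun a b => ∃ e, G.source e = a ∧ G.target e = some b) a b →
      (a = v ↔ b = v) := by
    intro a c hac
    induction hac with
    | rel a c hr =>
      obtain ⟨e', ha, hc⟩ := hr
      have hsame : ∀ k, (e', k) ∈ G.ends v → False := fun k hk => by
        rw [hends, mem_singleton_iff, Prod.mk.injEq] at hk
        rw [hk.1, htarget] at hc
        exact absurd hc (by simp)
      refine iff_of_false (fun h => hsame false ?_) (fun h => hsame true ?_)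
      · rw [mem_ends_iff]; simp [endVertex, ha, h]
      · rw [mem_ends_iff]; simp [endVertex, hc, h]
    | refl => rfl
    | symm _ _ _ ih => exact ih.symm
    | trans _ _ _ _ _ ih1 ih2 => exact ih1.trans ih2
  have hall : ∀ e', e' = e := fun e' => by
    have h2 := (key _ _ (hconn v (G.source e'))).1 rfl
    have h3 := mem_ends_false (G := G) e'
    rw [h2, hends, mem_singleton_iff, Prod.mk.injEq] at h3
    exact h3.1
  exact hhalf ⟨⟨fun a c => (hall a).trans (hall c).symm⟩, e, htop⟩

namespace IsPositiveSolution

theorem edgeMass_le_mass (h : G.IsPositiveSolution p lam u) (e : E) : G.edgeMass u e ≤ G.mass u :=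
  h.summable_edgeMass.le_tsum e fun e' _ => edgeMass_nonneg u e'

theorem edgeMass_add_le_mass (h : G.IsPositiveSolution p lam u) {e e' : E} (hne : e ≠ e') :
    G.edgeMass u e + G.edgeMass u e' ≤ G.mass u := by
  classical
  have := h.summable_edgeMass.sum_le_tsum {e, e'} fun i _ => edgeMass_nonneg u i
  rwa [Finset.sum_pair hne] at this

theorem mass_pos [Nonempty E] (h : G.IsPositiveSolution p lam u) (hG : G.LengthGE ℓ)
    (hℓ : 0 < ℓ) : 0 < G.mass u := by
  obtain ⟨e⟩ := ‹Nonempty E›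
  have hsub : Icc 0 ℓ ⊆ G.interval e := fun x hx => mem_interval_of_le hG hx.1 hx.2
  have hn := (h.nlsOn e).mono hsub
  refine lt_of_lt_of_le ?_ ((h.integral_le_edgeMass hℓ.le hsub).trans (h.edgeMass_le_mass e))
  exact intervalIntegral.intervalIntegral_pos_of_pos_on
    ((hn.continuousOn.pow 2).intervalIntegrable_of_Icc hℓ.le)
    (fun x hx => pow_pos (hn.pos x (Ioo_subset_Icc_self hx)) 2) hℓ

section Variation

variable {K : ℝ → ℝ} {κ x₀ : ℝ} {e₀ : E}

/-- Here `K` is the level function, and its drop to a low level `κ` is paid for with mass of the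
edge. -/
theorem variation_le_edgeMass (h : G.IsPositiveSolution p lam u)
    (hK : ∀ e, ∀ x ∈ G.interval e, ∀ y ∈ G.interval e, x ≤ y →
      |K (u e y) - K (u e x)| ≤ ∫ z in x..y, u e z ^ 2)
    {x y : ℝ} (hx : x ∈ G.interval e) (hy : y ∈ G.interval e) (hyκ : K (u e y) ≤ κ) :
    K (u e x) - κ ≤ G.edgeMass u e := by
  rcases le_total x y with hxy | hxy
  · have h1 := (abs_le.1 (hK e x hx y hy hxy)).1
    have h2 := h.integral_le_edgeMass hxy (Icc_subset_interval hx hy)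
    linarith
  · have h1 := (abs_le.1 (hK e y hy x hx hxy)).2
    have h2 := h.integral_le_edgeMass hxy (Icc_subset_interval hy hx)
    linarith

theorem variation_le_mass (h : G.IsPositiveSolution p lam u) (hG : G.LengthGE ℓ) (hℓ : 0 < ℓ)
    (hK : ∀ e, ∀ x ∈ G.interval e, ∀ y ∈ G.interval e, x ≤ y →
      |K (u e y) - K (u e x)| ≤ ∫ z in x..y, u e z ^ 2)
    (hκ : ∀ e a, Icc a (a + ℓ / 2) ⊆ G.interval e → ∃ y ∈ Icc a (a + ℓ / 2), K (u e y) ≤ κ)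
    (hx₀ : x₀ ∈ G.interval e₀) : K (u e₀ x₀) - κ ≤ G.mass u := by
  have hsub : Icc 0 (0 + ℓ / 2) ⊆ G.interval e₀ := fun x hx =>
    mem_interval_of_le hG hx.1 (by linarith [hx.2])
  obtain ⟨y, hy, hyκ⟩ := hκ e₀ 0 hsub
  exact (h.variation_le_edgeMass hK hx₀ (hsub hy) hyκ).trans (h.edgeMass_le_mass e₀)

/-- If all degrees are at least two, every level is crossed twice on the way down from the
maximum: on one side of it within its edge, and on the other side possibly beyond a vertex. -/
theorem two_mul_variation_le_mass
    (hdeg : ∀ v, 2 ≤ G.degree v) (h : G.IsPositiveSolution p lam u) (hG : G.LengthGE ℓ)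
    (hℓ : 0 < ℓ)
    (hK : ∀ e, ∀ x ∈ G.interval e, ∀ y ∈ G.interval e, x ≤ y →
      |K (u e y) - K (u e x)| ≤ ∫ z in x..y, u e z ^ 2)
    (hκ : ∀ e a, Icc a (a + ℓ / 2) ⊆ G.interval e → ∃ y ∈ Icc a (a + ℓ / 2), K (u e y) ≤ κ)
    (hx₀ : x₀ ∈ G.interval e₀) : 2 * (K (u e₀ x₀) - κ) ≤ G.mass u := by
  have hother : ∀ v, ∀ i ∈ G.ends v, ∃ j ∈ G.ends v, j ≠ i := fun v i _ =>
    Set.exists_ne_of_one_lt_ncard (hdeg v) i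
  have hlow : ∀ e, ∃ y ∈ G.interval e, K (u e y) ≤ κ := fun e => by
    have hsub : Icc 0 (0 + ℓ / 2) ⊆ G.interval e := fun x hx =>
      mem_interval_of_le hG hx.1 (by linarith [hx.2])
    obtain ⟨y, hy, hyκ⟩ := hκ e 0 hsub
    exact ⟨y, hsub hy, hyκ⟩
  have hint : ∀ x ∈ G.interval e₀, ∀ y ∈ G.interval e₀, x ≤ y →
      IntervalIntegrable (fun z => u e₀ z ^ 2) volume x y := fun x hx y hy hxy =>
    (((h.nlsOn e₀).continuousOn.mono (Icc_subset_interval hx hy)).pow 2).intervalIntegrable_of_Icc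
      hxy
  -- the case of a low point to the right of the maximum
  have hright : ∀ y ∈ G.interval e₀, x₀ ≤ y → K (u e₀ y) ≤ κ →
      2 * (K (u e₀ x₀) - κ) ≤ G.mass u := by
    intro y hy hxy hyκ
    obtain ⟨⟨e₁, b₁⟩, hj, hne⟩ := hother _ _ (mem_ends_false e₀)
    have hval := h.memH1.continuous.2 _ _ hj _ (mem_ends_false e₀)
    have h0 := zero_mem_interval (G := G) e₀
    simp only [endCoord_false] at hval
    have v1 := (abs_le.1 (hK e₀ 0 h0 x₀ hx₀ hx₀.1)).2
    have v2 := (abs_le.1 (hK e₀ x₀ hx₀ y hy hxy)).1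
    have s1 := intervalIntegral.integral_add_adjacent_intervals (hint 0 h0 x₀ hx₀ hx₀.1)
      (hint x₀ hx₀ y hy hxy)
    by_cases he : e₁ = e₀
    -- The edge is a loop: the second descent leaves through one end and comes back through the
    -- other, towards the same `y` from the opposite side. The two descents still use disjoint parts
    -- of the edge.
    · subst he
      have hb : b₁ = true := by
        cases b₁
        · exact absurd rfl hne
        · rfl
      subst hb
      have hL := length_ne_top_of_mem_ends hj
      rw [endCoord_true] at hval
      have hLm := endCoord_mem hj
      rw [endCoord_true] at hLm
      have hyL : y ≤ (G.length e₁).toReal := by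
        rw [interval_of_ne_top hL] at hy; exact hy.2
      have v3 := (abs_le.1 (hK e₁ y hy _ hLm hyL)).2
      have s2 := intervalIntegral.integral_add_adjacent_intervals
        (hint 0 h0 y hy (hx₀.1.trans hxy)) (hint y hy _ hLm hyL)
      have h4 := (h.integral_le_edgeMass ENNReal.toReal_nonneg
        (Icc_subset_interval h0 hLm)).trans (h.edgeMass_le_mass e₁)
      rw [hval] at v3
      linarith
    · obtain ⟨z, hz, hzκ⟩ := hlow e₁
      have v3 := h.variation_le_edgeMass hK (endCoord_mem hj) hz hzκ
      simp only at v3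
      rw [hval] at v3
      have h3 := h.integral_le_edgeMass (hx₀.1.trans hxy) (Icc_subset_interval h0 hy)
      have h4 := h.edgeMass_add_le_mass he
      linarith
  by_cases htop : G.length e₀ = ⊤
  · have hsub : Icc x₀ (x₀ + ℓ / 2) ⊆ G.interval e₀ := by
      rw [interval_of_eq_top htop]
      exact fun z hz => hx₀.1.trans hz.1
    obtain ⟨y, hy, hyκ⟩ := hκ e₀ x₀ hsub
    exact hright y (hsub hy) hy.1 hyκ
  have hLℓ := hG.le_toReal htop
  have hI := interval_of_ne_top htop
  obtain ⟨v, hv⟩ := exists_mem_ends_true htop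
  have hLm := endCoord_mem hv
  simp only [endCoord_true] at hLm
  set L := (G.length e₀).toReal with hL
  have h0 := zero_mem_interval (G := G) e₀
  -- The longer side of `x₀` has length at least `ℓ / 2` and contains a low point; the other descent
  -- goes through the vertex on the shorter side.
  rcases le_total x₀ (L / 2) with hhalf | hhalf
  · have hsub : Icc x₀ (x₀ + ℓ / 2) ⊆ G.interval e₀ := by
      rw [hI]; exact Icc_subset_Icc hx₀.1 (by linarith)
    obtain ⟨y, hy, hyκ⟩ := hκ e₀ x₀ hsub
    exact hright y (hsub hy) hy.1 hyκ
  -- a low point to the left of the maximum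
  have hx₀L : x₀ ≤ L := by rw [hI] at hx₀; exact hx₀.2
  have hsub : Icc (x₀ - ℓ / 2) (x₀ - ℓ / 2 + ℓ / 2) ⊆ G.interval e₀ := by
    rw [hI]; exact Icc_subset_Icc (by linarith) (by linarith)
  obtain ⟨y, hy', hyκ⟩ := hκ e₀ _ hsub
  have hy := hsub hy'
  have hyx : y ≤ x₀ := by linarith [hy'.2]
  obtain ⟨⟨e₁, b₁⟩, hj, hne⟩ := hother _ _ hv
  have hval := h.memH1.continuous.2 _ _ hj _ hv
  simp only [endCoord_true, ← hL] at hval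
  have v1 := (abs_le.1 (hK e₀ x₀ hx₀ L hLm hx₀L)).1
  have v2 := (abs_le.1 (hK e₀ y hy x₀ hx₀ hyx)).2
  have s1 := intervalIntegral.integral_add_adjacent_intervals (hint y hy x₀ hx₀ hyx)
    (hint x₀ hx₀ L hLm hx₀L)
  by_cases he : e₁ = e₀
  · subst he
    have hb : b₁ = false := by
      cases b₁
      · rfl
      · exact absurd rfl hne
    subst hb
    rw [endCoord_false] at hval
    have v3 := (abs_le.1 (hK e₁ 0 h0 y hy hy.1)).1
    have s2 := intervalIntegral.integral_add_adjacent_intervals (hint 0 h0 y hy hy.1)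
      (hint y hy L hLm (hyx.trans hx₀L))
    have h4 := (h.integral_le_edgeMass (hx₀.1.trans hx₀L)
      (Icc_subset_interval h0 hLm)).trans (h.edgeMass_le_mass e₁)
    rw [hval] at v3
    linarith
  · obtain ⟨z, hz, hzκ⟩ := hlow e₁
    have v3 := h.variation_le_edgeMass hK (endCoord_mem hj) hz hzκ
    simp only at v3
    rw [hval] at v3
    have h3 := h.integral_le_edgeMass (hyx.trans hx₀L) (Icc_subset_interval hy hLm)
    have h4 := h.edgeMass_add_le_mass he
    linarith

end Variation

/-! ### Energy, descent and height in terms of the frequency -/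

/-- The energy is bounded below by the frequency, up to terms of lower order. -/
theorem energy_ge (hfin : ∀ v, (G.ends v).Finite) (h : G.IsPositiveSolution p lam u)
    (hp : 6 < p) (hlam : 0 < lam) (hG : G.LengthGE ℓ) (hℓ : 0 < ℓ)
    (hM : ∀ e, ∀ x ∈ G.interval e, u e x ≤ M) :
    G.mass u * ((p - 6) / (2 * (p + 2)) * lam - (p - 2) / (p + 2) *
      ((2 * √lam + (p * lam / 2) ^ ((p - 4) / (p - 2)) * G.mass u) / (2 * ℓ))) ≤
      G.energy p u := by
  set D := (p * lam / 2) ^ ((p - 4) / (p - 2)) with hD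
  have hp0 : 0 < p := by linarith
  have hD0 : 0 ≤ D := by positivity
  have hμ0 : 0 ≤ G.mass u := tsum_nonneg (edgeMass_nonneg u)
  set B := (2 * √lam + D * G.mass u) / (2 * ℓ) with hB
  have hB0 : 0 ≤ B := by positivity
  -- The integrated mechanical energy: zero on a half-line, and at least `-B` times the edge mass on
  -- a bounded edge by `neg_energy_le`.
  have hedge : ∀ e, -(B * G.edgeMass u e) ≤
      G.edgeKinetic u e / 2 + G.edgePower p u e / p - lam * G.edgeMass u e / 2 := by
    intro e
    have hJ0 := edgeMass_nonneg (G := G) u e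
    have hn := h.nlsOn e
    by_cases he : G.length e = ⊤
    · have h1 := h.integrableOn_sq e
      have h2 := h.integrableOn_deriv_sq e
      have hMe := hM e
      have hI := interval_of_eq_top he
      rw [hI] at hn h1 h2 hMe
      have := hn.integral_energy_Ici (by linarith) hMe h1 h2
      simp only [edgeKinetic, edgePower, edgeMass, hI] at hJ0 ⊢
      rw [this, neg_nonpos]
      positivity
    · have hLℓ := hG.le_toReal he
      have hI := interval_of_ne_top he
      have hle := h.edgeMass_le_mass e
      rw [hI] at hn
      set L := (G.length e).toReal with hL
      have hL0 : 0 < L := by linarith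
      set C := nlsEnergy p lam (u e 0) (G.edgeDeriv u e 0)
      have hC : ∀ x ∈ Icc 0 L, nlsEnergy p lam (u e x) (G.edgeDeriv u e x) = C := fun x hx =>
        hn.energy_eq hp0.ne' (convex_Icc _ _) hx (left_mem_Icc.2 hL0.le)
      have h1 := hn.integral_energy_Icc hL0.le hC
      have h2 := hn.neg_energy_le hp hlam hL0 hC
      have hJ : ∫ x in (0 : ℝ)..L, u e x ^ 2 = G.edgeMass u e := by
        rw [edgeMass, hI, intervalIntegral.integral_of_le hL0.le, integral_Icc_eq_integral_Ioc]
      rw [hJ, sub_zero] at h2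
      rw [sub_zero] at h1
      simp only [edgeKinetic, edgePower, hI]
      rw [edgeMass, hI] at hJ0 h2 hle ⊢
      rw [h1]
      set J := ∫ x in Icc 0 L, u e x ^ 2
      have h3 : J * (2 * √lam + D * J) ≤ 2 * ℓ * B * J := by
        have : 2 * ℓ * B = 2 * √lam + D * G.mass u := by rw [hB]; field_simp
        rw [this, mul_comm]
        exact mul_le_mul_of_nonneg_right (by nlinarith) hJ0
      have h4 : 2 * (-C * L) * L ≤ 2 * (B * J) * L := by
        have : 2 * ℓ * B * J ≤ 2 * L * B * J := by
          have : 0 ≤ B * J := by positivity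
          nlinarith
        nlinarith
      have h5 := le_of_mul_le_mul_right h4 hL0
      linarith
  have s1 := h.summable_edgeMass
  have s2 := h.summable_edgeKinetic
  have s3 := h.summable_edgePower (by linarith) hM
  have s4 := (s2.div_const 2).add (s3.div_const p)
  have s5 := (s1.mul_left lam).div_const 2
  have hsum := (s1.mul_left B).neg.tsum_le_tsum hedge (s4.sub s5)
  rw [tsum_neg, tsum_mul_left, s4.tsum_sub s5, (s2.div_const 2).tsum_add (s3.div_const p),
    tsum_div_const, tsum_div_const, tsum_div_const, tsum_mul_left] at hsum
  have hneh := h.nehari hfin (by linarith) hG hℓ hM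
  rw [h.energy_eq]
  rw [← mass_eq] at hneh hsum
  set T := ∑' e, G.edgeKinetic u e
  set P := ∑' e, G.edgePower p u e
  set μ := G.mass u
  have hT : T = P - lam * μ := by linarith
  rw [hT] at hsum ⊢
  -- Nehari eliminates the kinetic term, so a lower bound on the power `P` is all that is needed.
  have h6 : lam * μ - B * μ ≤ (p + 2) / (2 * p) * P := by
    have : (p + 2) / (2 * p) * P = P / 2 + P / p := by field_simp
    linarith
  have h7 := mul_le_mul_of_nonneg_left h6
    (show 0 ≤ (p - 2) / (p + 2) from div_nonneg (by linarith) (by linarith))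
  have e1 : (p - 2) / (p + 2) * ((p + 2) / (2 * p) * P) = P / 2 - P / p := by
    field_simp
  rw [e1] at h7
  have e2 : μ * ((p - 6) / (2 * (p + 2)) * lam - (p - 2) / (p + 2) * B) =
      (p - 2) / (p + 2) * (lam * μ - B * μ) - lam * μ / 2 := by
    field_simp
    ring
  rw [e2]
  have e3 : 1 / 2 * (P - lam * μ) - 1 / p * P = P / 2 - P / p - lam * μ / 2 := by ring
  rw [e3]
  linarith

/-- The energy density is at most of lower order on all edges. -/
theorem nlsEnergy_le (h : G.IsPositiveSolution p lam u) (hp : 6 < p) (hlam : 0 < lam)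
    (hG : G.LengthGE ℓ) (hℓ : 0 < ℓ) {c : ℝ} (hc : 0 < c)
    (h1 : (2 * Real.pi / ℓ) ^ 2 ≤ lam)
    (h2 : 8 * Real.pi * √lam / ℓ ≤ c ^ ((p - 2) / p) * lam) {x : ℝ} (hx : x ∈ G.interval e) :
    nlsEnergy p lam (u e x) (G.edgeDeriv u e x) ≤ c * (lam * lam ^ (2 / (p - 2))) := by
  have hp0 : 0 < p := by linarith
  obtain ⟨a, hxa, hsub⟩ := exists_Icc_subset hG hℓ hx
  have hn := (h.nlsOn e).mono hsub
  set C := nlsEnergy p lam (u e x) (G.edgeDeriv u e x)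
  by_contra! hlt
  have hC0 : 0 < C := lt_trans (by positivity) hlt
  have key := hn.energy_rpow_le hp (by linarith)
    (fun z hz => hn.energy_eq hp0.ne' (convex_Icc _ _) hz hxa) hC0 le_rfl
    (by rw [add_sub_cancel_left]; exact h1)
  rw [add_sub_cancel_left] at key
  have h3 := Real.rpow_lt_rpow (by positivity) hlt
    (show 0 < (p - 2) / p from div_pos (by linarith) hp0)
  -- The exponents express that `lam ^ (p / (p - 2))` is the natural scale of the mechanical energy.
  have e1 : (c * (lam * lam ^ (2 / (p - 2)))) ^ ((p - 2) / p) = c ^ ((p - 2) / p) * lam := by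
    have hp2 : p - 2 ≠ 0 := by linarith
    rw [Real.mul_rpow hc.le (by positivity)]
    congr 1
    nth_rewrite 1 [← Real.rpow_one lam]
    rw [← Real.rpow_add hlam, ← Real.rpow_mul hlam.le,
      show (1 + 2 / (p - 2)) * ((p - 2) / p) = 1 by field_simp; ring, Real.rpow_one]
  rw [e1] at h3
  linarith

/-- The variation of a level function along an edge is controlled by the mass. -/
theorem level_variation_le (h : G.IsPositiveSolution p lam u) (hp : 6 < p) (hlam : 0 < lam)
    {c : ℝ} {H H' : ℝ → ℝ}
    (hC : ∀ x ∈ G.interval e, nlsEnergy p lam (u e x) (G.edgeDeriv u e x) ≤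
      c * (lam * lam ^ (2 / (p - 2))))
    (hH : ∀ t, HasDerivAt H (H' t) t) (hH0 : ∀ t, 0 ≤ H' t)
    (hHc : ∀ s d, 0 < s → d ^ 2 ≤ s ^ 2 - 2 / p * s ^ p + 2 * c → H' s * |d| ≤ s ^ 2)
    {x y : ℝ} (hx : x ∈ G.interval e) (hy : y ∈ G.interval e) (hxy : x ≤ y) :
    |lam ^ (2 / (p - 2)) / √lam * H (u e y / lam ^ (1 / (p - 2))) -
      lam ^ (2 / (p - 2)) / √lam * H (u e x / lam ^ (1 / (p - 2)))| ≤
      ∫ z in x..y, u e z ^ 2 := by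
  have hp2 : p - 2 ≠ 0 := by linarith
  have hsub := Icc_subset_interval hx hy
  have hn := (h.nlsOn e).mono hsub
  set Q := lam ^ (1 / (p - 2)) with hQ
  have hQ0 : 0 < Q := by positivity
  have hQ2 : lam ^ (2 / (p - 2)) = Q ^ 2 := by
    rw [hQ, ← Real.rpow_natCast, ← Real.rpow_mul hlam.le]; congr 1; push_cast; ring
  have hQp : Q ^ p = lam * Q ^ 2 := by
    rw [NLSOn.rpow_eq_mul_sq hQ0 p]
    congr 1
    rw [hQ, ← Real.rpow_mul hlam.le, one_div_mul_cancel hp2, Real.rpow_one]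
  rw [hQ2] at hC ⊢
  have hS0 := Real.sqrt_pos.2 hlam
  have hS2 := Real.sq_sqrt hlam.le
  set S := √lam
  refine abs_sub_le_integral (F := fun z => Q ^ 2 / S * H (u e z / Q))
    (F' := fun z => Q ^ 2 / S * (H' (u e z / Q) * (G.edgeDeriv u e z / Q)))
    (φ := fun z => u e z ^ 2)
    (fun z hz => ((hH _).comp_hasDerivWithinAt z ((hn.fst z hz).div_const Q)).const_mul _)
    (hn.continuousOn.pow 2) (fun z hz => ?_) (left_mem_Icc.2 hxy) (right_mem_Icc.2 hxy)
  have hs := hn.pos z hz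
  have hCz := hC z (hsub hz)
  set s := u e z
  set d := G.edgeDeriv u e z
  -- The scaling `u(x) = Q w(S x)` reduces to frequency one and energy at most `c`; `Q² / S` is the
  -- factor by which it multiplies the mass.
  have key := hHc (s / Q) (d / (Q * S)) (by positivity) (by
    rw [Real.div_rpow hs.le hQ0.le, hQp, div_pow, div_pow, mul_pow, hS2]
    rw [nlsEnergy] at hCz
    have e1 : s ^ 2 / Q ^ 2 - 2 / p * (s ^ p / (lam * Q ^ 2)) + 2 * c =
        (lam * s ^ 2 - 2 / p * s ^ p + 2 * c * (lam * Q ^ 2)) / (Q ^ 2 * lam) := by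
      field_simp
    rw [e1]
    refine div_le_div_of_nonneg_right ?_ (by positivity)
    have e2 : 2 / p * s ^ p = 2 * (s ^ p / p) := by ring
    rw [e2]; linarith)
  rw [abs_mul, abs_mul, abs_of_nonneg (hH0 _), abs_of_pos (by positivity : 0 < Q ^ 2 / S)]
  rw [abs_div, abs_of_pos (by positivity : 0 < Q * S)] at key
  rw [abs_div, abs_of_pos hQ0]
  have e3 : Q ^ 2 / S * (H' (s / Q) * (|d| / Q)) = Q ^ 2 * (H' (s / Q) * (|d| / (Q * S))) := by
    field_simp
  rw [e3]
  refine (mul_le_mul_of_nonneg_left key (sq_nonneg Q)).trans (le_of_eq ?_)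
  field_simp

/-- At a maximum the solution is almost as high as the soliton of the same frequency. -/
theorem max_ge (hfin : ∀ v, (G.ends v).Finite) (h : G.IsPositiveSolution p lam u) (hp : 6 < p)
    (hlam : 0 < lam) (hG : G.LengthGE ℓ) (hℓ : 0 < ℓ) {e₀ : E} {x₀ t : ℝ}
    (hx₀ : x₀ ∈ G.interval e₀) (hM : ∀ e, ∀ x ∈ G.interval e, u e x ≤ u e₀ x₀)
    (hM1 : 1 ≤ u e₀ x₀) (ht : 0 < t) (hμ : G.mass u / (2 * ℓ) < 1 / 2 - t ^ (p - 2) / p) :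
    t ≤ u e₀ x₀ / lam ^ (1 / (p - 2)) := by
  have hp0 : 0 < p := by linarith
  have hp2 : p - 2 ≠ 0 := by linarith
  have hQ0 : 0 < lam ^ (1 / (p - 2)) := by positivity
  obtain ⟨a, hxa, hsub⟩ := exists_Icc_subset hG hℓ hx₀
  have hn := (h.nlsOn e₀).mono hsub
  have h1 := hn.energy_ge hp0 hlam.le (by linarith)
    (fun z hz => hn.energy_eq hp0.ne' (convex_Icc _ _) hz hxa)
  rw [h.edgeDeriv_eq_zero_of_max hfin hx₀ hM, add_sub_cancel_left, nlsEnergy] at h1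
  have h2 := (h.integral_le_edgeMass (by linarith) hsub).trans (h.edgeMass_le_mass e₀)
  have hpos := h.pos e₀ x₀ hx₀
  set m := u e₀ x₀
  rw [le_div_iff₀ hQ0]
  -- A lower maximum would make the energy at most `-lam m² (1 / 2 - t ^ (p - 2) / p)` with `m ≥ 1`,
  -- below what the small mass allows.
  by_contra! hlt
  have h3 : m ^ (p - 2) ≤ t ^ (p - 2) * lam := by
    have := Real.rpow_le_rpow hpos.le hlt.le (show 0 ≤ p - 2 by linarith)
    rwa [Real.mul_rpow ht.le hQ0.le, ← Real.rpow_mul hlam.le, one_div_mul_cancel hp2,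
      Real.rpow_one] at this
  rw [NLSOn.rpow_eq_mul_sq hpos p] at h1
  have h4 : lam / (2 * ℓ) * (∫ x in a..a + ℓ, u e₀ x ^ 2) ≤ lam * (G.mass u / (2 * ℓ)) := by
    have := mul_le_mul_of_nonneg_left h2 (show 0 ≤ lam / (2 * ℓ) by positivity)
    refine this.trans (le_of_eq ?_)
    ring
  have h5 : m ^ (p - 2) * m ^ 2 / p ≤ t ^ (p - 2) * lam * m ^ 2 / p := by gcongr
  have h6 : lam * m ^ 2 * (1 / 2 - t ^ (p - 2) / p) ≤ lam * (G.mass u / (2 * ℓ)) := by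
    have e1 : lam * m ^ 2 * (1 / 2 - t ^ (p - 2) / p) =
      lam * m ^ 2 / 2 - t ^ (p - 2) * lam * m ^ 2 / p := by ring
    rw [e1]; linarith
  have h7 : lam * (G.mass u / (2 * ℓ)) < lam * (1 / 2 - t ^ (p - 2) / p) :=
    mul_lt_mul_of_pos_left hμ hlam
  have h8 : 0 < 1 / 2 - t ^ (p - 2) / p := by
    refine lt_of_le_of_lt ?_ hμ
    have : 0 ≤ G.mass u := tsum_nonneg (edgeMass_nonneg u)
    positivity
  have h9 : 1 ≤ m ^ 2 := one_le_pow₀ hM1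
  nlinarith [mul_pos hlam h8]

end IsPositiveSolution

end MetricGraph

/-! ### Comparison with the soliton and passage to the limit -/

/-- The soliton of frequency `lam` has mass proportional to `lam ^ ((6 - p) / (2 * (p - 2)))`. This
decreases for `p > 6`, so an upper bound on that mass becomes a lower bound on `lam`. -/
theorem solitonFrequency_le {p lam ν θ : ℝ} (hp : 6 < p) (hlam : 0 < lam) (hθ : 0 < θ)
    (h : θ * (∫ x, lineSolution p 1 x ^ 2) * (lam ^ (2 / (p - 2)) / √lam) ≤ ν) :
    θ ^ (2 * (p - 2) / (p - 6)) * solitonFrequency p ν ≤ lam := by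
  have hp2 : p - 2 ≠ 0 := by linarith
  have hp6 : p - 6 ≠ 0 := by linarith
  have hp6' : 6 - p ≠ 0 := by linarith
  have hm := integral_lineSolution_sq_pos (p := p) (by linarith) one_pos
  rw [solitonFrequency]
  set m := ∫ x, lineSolution p 1 x ^ 2
  have e1 : lam ^ (2 / (p - 2)) / √lam = lam ^ ((6 - p) / (2 * (p - 2))) := by
    rw [Real.sqrt_eq_rpow, ← Real.rpow_sub hlam]
    congr 1
    field_simp
    ring
  rw [e1] at h
  have h1 : θ * lam ^ ((6 - p) / (2 * (p - 2))) ≤ ν / m := by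
    rw [le_div_iff₀ hm]; linarith
  have h2 := Real.rpow_le_rpow_of_nonpos (by positivity) h1
    (show 2 * (p - 2) / (6 - p) ≤ 0 from div_nonpos_of_nonneg_of_nonpos (by linarith) (by linarith))
  rw [Real.mul_rpow hθ.le (by positivity), ← Real.rpow_mul hlam.le,
    show (6 - p) / (2 * (p - 2)) * (2 * (p - 2) / (6 - p)) = 1 by field_simp, Real.rpow_one] at h2
  calc θ ^ (2 * (p - 2) / (p - 6)) * (ν / m) ^ (2 * (p - 2) / (6 - p))
      ≤ θ ^ (2 * (p - 2) / (p - 6)) * (θ ^ (2 * (p - 2) / (6 - p)) * lam) :=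
        mul_le_mul_of_nonneg_left h2 (by positivity)
    _ = lam := by
      rw [← mul_assoc, ← Real.rpow_add hθ,
        show 2 * (p - 2) / (p - 6) + 2 * (p - 2) / (6 - p) = 0 by
          rw [← neg_sub p 6, div_neg, add_neg_cancel], Real.rpow_zero, one_mul]

theorem eventually_rpow_le_mul {θ c : ℝ} (hθ : θ < 1) (hc : 0 < c) :
    ∀ᶠ x : ℝ in atTop, x ^ θ ≤ c * x := by
  have h := (tendsto_rpow_neg_atTop (show 0 < 1 - θ by linarith)).eventually (gt_mem_nhds hc)
  filter_upwards [h, eventually_gt_atTop (0 : ℝ)] with x hx hx0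
  have e : x ^ θ = x ^ (-(1 - θ)) * x := by rw [← Real.rpow_add_one hx0.ne']; ring_nf
  rw [e]
  exact mul_le_mul_of_nonneg_right hx.le hx0.le

theorem eventually_small {a b : ℝ} (hb : 0 < b) : ∀ᶠ μ : ℝ in 𝓝[>] 0, a * μ < b := by
  have h : Tendsto (fun μ : ℝ => a * μ) (𝓝[>] 0) (𝓝 0) := by
    have : ContinuousAt (fun μ : ℝ => a * μ) 0 := by fun_prop
    simpa using this.tendsto.mono_left nhdsWithin_le_nhds
  exact h.eventually (gt_mem_nhds hb)

namespace MetricGraph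

variable {V E : Type*} {G : MetricGraph V E} {p : ℝ}

/-- The energy of positive solutions of small mass, compared to that of solitons of mass `N μ`:
`N = 1` if all degrees are at least two, `N = 2` in general. -/
theorem eventually_energy_ge (hG : G.InClass) (hfam : (Finite E ∧ G.Noncompact) ∨ G.Periodic)
    (hp : 6 < p) {N : ℝ} (hN : (N = 1 ∧ ∀ v, 2 ≤ G.degree v) ∨ N = 2) {r : ℝ} (hr : r < 1) :
    ∀ᶠ μ : ℝ in 𝓝[>] 0, ∀ u ∈ G.solutionSet p μ,
      r * ((p - 6) / (2 * (p + 2)) * (solitonFrequency p (N * μ) * μ)) ≤ G.energy p u := by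
  have hp0 : 0 < p := by linarith
  have hnc : G.Noncompact := hfam.elim (fun h => h.2) fun h => Or.inr h.1
  have hne : Nonempty E := hnc.elim (fun ⟨e, _⟩ => ⟨e⟩) fun h => inferInstance
  obtain ⟨ℓ, hℓ, hGℓ⟩ := exists_lengthGE hG.length_lower_bound
  -- the admissible error
  obtain ⟨ε, hε0, hε1, hεr⟩ : ∃ ε : ℝ, 0 < ε ∧ ε < 1 ∧
      r ≤ (1 - ε) * (1 - ε) ^ (2 * (p - 2) / (p - 6)) := by
    have hc : ContinuousAt (fun ε : ℝ => (1 - ε) * (1 - ε) ^ (2 * (p - 2) / (p - 6))) 0 := by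
      refine (by fun_prop : ContinuousAt (fun ε : ℝ => 1 - ε) 0).mul
        ((by fun_prop : ContinuousAt (fun ε : ℝ => 1 - ε) 0).rpow_const (Or.inl ?_))
      norm_num
    have ht : Tendsto (fun ε : ℝ => (1 - ε) * (1 - ε) ^ (2 * (p - 2) / (p - 6))) (𝓝[>] 0) (𝓝 1) := by
      simpa using hc.tendsto.mono_left nhdsWithin_le_nhds
    obtain ⟨ε, h3, h1, h2⟩ := ((ht.eventually (lt_mem_nhds hr)).and
      (Ioo_mem_nhdsGT (show (0 : ℝ) < 1 by norm_num))).exists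
    exact ⟨ε, h1, h2, h3.le⟩
  obtain ⟨c, t₁, t₂, H, H', hc, ht1, ht2, ht2p, hH, hH0, hHc, hHm⟩ :=
    exists_level_function hp hε0 hε1
  have hHmono : Monotone H := monotone_of_hasDerivAt_nonneg hH hH0
  have hd0 : 0 < 1 / 2 - t₂ ^ (p - 2) / p := by
    rw [sub_pos, div_lt_div_iff₀ hp0 (by norm_num)]; linarith
  set c₀ := (p - 6) / (2 * (p + 2)) with hc₀
  have hc₀0 : 0 < c₀ := div_pos (by linarith) (by linarith)
  -- Makes the lower order terms of the energy bound add up to at most `ε * c₀ * lam`.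
  set k := ε * c₀ * ((p + 2) / (p - 2)) * ℓ with hk
  have hk0 : 0 < k := by
    have : 0 < (p + 2) / (p - 2) := div_pos (by linarith) (by linarith)
    positivity
  -- conditions on the frequency
  have hev : ∀ᶠ lam : ℝ in atTop, 1 ≤ lam ∧ (2 * Real.pi / ℓ) ^ 2 ≤ lam ∧
      8 * Real.pi * √lam / ℓ ≤ c ^ ((p - 2) / p) * lam ∧
      √lam ≤ k / 2 * lam ∧ (p * lam / 2) ^ ((p - 4) / (p - 2)) ≤ k * lam := by
    have hcp : 0 < c ^ ((p - 2) / p) := by positivity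
    have hπ := Real.pi_pos
    have h1 := eventually_rpow_le_mul (θ := 1 / 2) (by norm_num)
      (show 0 < c ^ ((p - 2) / p) * ℓ / (8 * Real.pi) by positivity)
    have h2 := eventually_rpow_le_mul (θ := 1 / 2) (by norm_num) (half_pos hk0)
    have hθ : (p - 4) / (p - 2) < 1 := by rw [div_lt_one (by linarith)]; linarith
    have h3 := eventually_rpow_le_mul hθ
      (show 0 < k / (p / 2) ^ ((p - 4) / (p - 2)) by positivity)
    filter_upwards [eventually_ge_atTop 1, eventually_ge_atTop ((2 * Real.pi / ℓ) ^ 2), h1, h2, h3]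
      with x x1 x2 x3 x4 x5
    rw [← Real.sqrt_eq_rpow] at x3 x4
    refine ⟨x1, x2, ?_, x4, ?_⟩
    · rw [div_le_iff₀ hℓ]
      have := mul_le_mul_of_nonneg_left x3 (show 0 ≤ 8 * Real.pi by positivity)
      refine this.trans (le_of_eq ?_)
      field_simp
    · rw [show p * x / 2 = p / 2 * x by ring, Real.mul_rpow (by positivity) (by linarith)]
      have := mul_le_mul_of_nonneg_left x5
        (show 0 ≤ (p / 2) ^ ((p - 4) / (p - 2)) by positivity)
      refine this.trans (le_of_eq ?_)
      have : (p / 2) ^ ((p - 4) / (p - 2)) ≠ 0 := by positivity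
      field_simp
  obtain ⟨Λ, hΛ⟩ := eventually_atTop.1 hev
  filter_upwards [eventually_small (a := 1) (b := 1 / 2) (by norm_num),
    eventually_small (a := 32 * Real.pi * p) hℓ, eventually_small (a := 1 / (2 * ℓ)) hd0,
    eventually_small (a := 2 / ℓ) (b := t₁ ^ 2) (by positivity),
    eventually_small (a := 4 * p * |Λ|) one_pos] with μ h1 h2 h3 h4 h5
  rintro u ⟨hmass, lam, h⟩
  obtain ⟨e₀, x₀, hx₀, hM⟩ := h.exists_max hGℓ hℓ
  have hμ0 : 0 < μ := by rw [← hmass]; exact h.mass_pos hGℓ hℓ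
  have hlam0 : 0 ≤ lam := by
    rcases hfam with ⟨hfin, ⟨e, he⟩ | hinf⟩ | hper
    · exact (h.pos_of_length_eq_top (by linarith) hM he).le
    · exact absurd hinf (not_infinite_iff_finite.2 hfin)
    · exact h.nonneg_of_periodic hG.connected hG.finite_ends hper (by linarith) hGℓ hℓ hM
  obtain ⟨hM1, hlarge⟩ := h.frequency_large hG hnc hlam0 hp hGℓ hℓ hx₀ hM (by rwa [hmass])
    (by rw [hmass]; linarith) (by rwa [hmass])
  rw [hmass] at hlarge
  have hlamΛ : Λ ≤ lam := by
    have hx : 4 * p * μ ^ 2 * |Λ| ≤ 4 * p * μ ^ 2 * lam := by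
      refine le_trans ?_ hlarge
      have : 4 * p * μ ^ 2 * |Λ| = 4 * p * |Λ| * μ * μ := by ring
      rw [this]
      nlinarith
    exact (le_abs_self Λ).trans (le_of_mul_le_mul_left hx (by positivity))
  obtain ⟨l1, l2, l3, l4, l5⟩ := hΛ lam hlamΛ
  have hlam : 0 < lam := by linarith
  have hQ1 : 1 ≤ lam ^ (1 / (p - 2)) :=
    Real.one_le_rpow l1 (div_nonneg zero_le_one (by linarith))
  set Q := lam ^ (1 / (p - 2)) with hQ
  set W := lam ^ (2 / (p - 2)) / √lam with hW
  have hW0 : 0 < W := div_pos (by positivity) (Real.sqrt_pos.2 hlam)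
  -- the mass is at least the one of the soliton, or half of it
  set K : ℝ → ℝ := fun t => W * H (t / Q) with hK
  have hvar : ∀ e, ∀ x ∈ G.interval e, ∀ y ∈ G.interval e, x ≤ y →
      |K (u e y) - K (u e x)| ≤ ∫ z in x..y, u e z ^ 2 := fun e x hx y hy hxy =>
    h.level_variation_le hp hlam (fun z hz => h.nlsEnergy_le hp hlam hGℓ hℓ hc l2 l3 hz) hH hH0
      hHc hx hy hxy
  have hlow : ∀ e a, Icc a (a + ℓ / 2) ⊆ G.interval e →
      ∃ y ∈ Icc a (a + ℓ / 2), K (u e y) ≤ W * H t₁ := by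
    intro e a hsub
    obtain ⟨y, hy, hy2⟩ := exists_sq_le_average (by linarith)
      ((h.nlsOn e).continuousOn.mono hsub)
    refine ⟨y, hy, mul_le_mul_of_nonneg_left (hHmono ?_) hW0.le⟩
    have h6 := (h.integral_le_edgeMass (by linarith) hsub).trans (h.edgeMass_le_mass e)
    rw [hmass] at h6
    rw [add_sub_cancel_left] at hy2
    have h7 : u e y ^ 2 < t₁ ^ 2 := by
      refine lt_of_le_of_lt ?_ h4
      rw [div_mul_eq_mul_div, le_div_iff₀ hℓ]
      linarith
    rw [div_le_iff₀ (by linarith)]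
    have h8 := lt_of_pow_lt_pow_left₀ 2 ht1.le h7
    nlinarith
  have hpeak : W * H t₂ ≤ K (u e₀ x₀) := by
    refine mul_le_mul_of_nonneg_left (hHmono ?_) hW0.le
    refine h.max_ge hG.finite_ends hp hlam hGℓ hℓ hx₀ hM hM1 ht2 ?_
    rw [hmass, div_eq_inv_mul, ← one_div]
    exact h3
  -- `W` times the integral is the mass of the soliton of frequency `lam`; two descents give it in
  -- full, a single one gives half of it.
  have hNμ : (1 - ε) * (∫ x, lineSolution p 1 x ^ 2) * W ≤ N * μ := by
    have h6 : (1 - ε) * (∫ x, lineSolution p 1 x ^ 2) * W ≤ 2 * (W * H t₂ - W * H t₁) := by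
      have := mul_le_mul_of_nonneg_right hHm hW0.le
      linarith
    rcases hN with ⟨rfl, hdeg⟩ | rfl
    · have := h.two_mul_variation_le_mass hdeg hGℓ hℓ hvar hlow hx₀
      rw [hmass] at this
      linarith
    · have := h.variation_le_mass hGℓ hℓ hvar hlow hx₀
      rw [hmass] at this
      linarith
  have hfreq := solitonFrequency_le hp hlam (by linarith : 0 < 1 - ε) hNμ
  -- the energy in terms of the frequency
  have hE := h.energy_ge hG.finite_ends hp hlam hGℓ hℓ hM
  rw [hmass, ← hc₀] at hE
  have hB : (p - 2) / (p + 2) * ((2 * √lam + (p * lam / 2) ^ ((p - 4) / (p - 2)) * μ) / (2 * ℓ)) ≤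
      ε * c₀ * lam := by
    have h6 : 2 * √lam + (p * lam / 2) ^ ((p - 4) / (p - 2)) * μ ≤ 2 * k * lam := by
      have h7 : (p * lam / 2) ^ ((p - 4) / (p - 2)) * μ ≤ k * lam * 1 := by
        refine mul_le_mul l5 (by linarith) hμ0.le (by positivity)
      linarith
    have h8 : 0 ≤ (p - 2) / (p + 2) := div_nonneg (by linarith) (by linarith)
    calc (p - 2) / (p + 2) * ((2 * √lam + (p * lam / 2) ^ ((p - 4) / (p - 2)) * μ) / (2 * ℓ))
        ≤ (p - 2) / (p + 2) * (2 * k * lam / (2 * ℓ)) := by gcongr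
      _ = ε * c₀ * lam := by
        have : p - 2 ≠ 0 := by linarith
        rw [hk]; field_simp
  have hν : 0 ≤ solitonFrequency p (N * μ) := by
    have hN0 : 0 < N := by rcases hN with ⟨rfl, -⟩ | rfl <;> norm_num
    exact (soliton_mass hp (mul_pos hN0 hμ0)).1.le
  calc r * (c₀ * (solitonFrequency p (N * μ) * μ))
      ≤ (1 - ε) * (1 - ε) ^ (2 * (p - 2) / (p - 6)) *
        (c₀ * (solitonFrequency p (N * μ) * μ)) :=
        mul_le_mul_of_nonneg_right hεr (by positivity)
    _ = (1 - ε) * c₀ * μ *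
        ((1 - ε) ^ (2 * (p - 2) / (p - 6)) * solitonFrequency p (N * μ)) := by ring
    _ ≤ (1 - ε) * c₀ * μ * lam := by
      refine mul_le_mul_of_nonneg_left hfreq ?_
      have : 0 < 1 - ε := by linarith
      positivity
    _ = μ * (c₀ * lam - ε * c₀ * lam) := by ring
    _ ≤ μ * (c₀ * lam - (p - 2) / (p + 2) *
        ((2 * √lam + (p * lam / 2) ^ ((p - 4) / (p - 2)) * μ) / (2 * ℓ))) :=
        mul_le_mul_of_nonneg_left (by linarith) hμ0.le
    _ ≤ G.energy p u := hE

/-- In `EReal` the infimum over an empty solution set is `⊤`, as the convention requires; so an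
eventual bound for each `r < 1` is enough. -/
theorem one_le_liminf_energy_ratio {R : ℝ → ℝ} (hR : ∀ μ, 0 < μ → 0 < R μ)
    (h : ∀ r < 1, ∀ᶠ μ : ℝ in 𝓝[>] 0, ∀ u ∈ G.solutionSet p μ, r * R μ ≤ G.energy p u) :
    1 ≤ liminf (fun μ : ℝ => ⨅ u ∈ G.solutionSet p μ,
      ((G.energy p u / R μ : ℝ) : EReal)) (𝓝[>] 0) := by
  refine le_of_forall_lt fun c hc => ?_
  obtain ⟨r, hcr, hr⟩ := EReal.lt_iff_exists_real_btwn.1 hc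
  refine hcr.trans_le (le_liminf_of_le (by isBoundedDefault) ?_)
  have hr1 : r < 1 := by exact_mod_cast hr
  filter_upwards [h r hr1, self_mem_nhdsWithin] with μ hμ hμ0
  refine le_iInf₂ fun u hu => ?_
  rw [EReal.coe_le_coe_iff, le_div_iff₀ (hR μ hμ0)]
  exact hμ u hu

end MetricGraph

theorem proposition3p1 {V E : Type*} (G : MetricGraph V E) (hG : G.InClass)
    (hfam : (Finite E ∧ G.Noncompact) ∨ G.Periodic) (p : ℝ) (hp : 6 < p) :
    (¬ G.HasPendant → ¬ G.IsHalfLine →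
      1 ≤ liminf (fun μ : ℝ => ⨅ u ∈ G.solutionSet p μ,
        ((G.energy p u / lineEnergy p univ (soliton p μ) : ℝ) : EReal)) (𝓝[>] 0)) ∧
    (G.HasPendant →
      1 ≤ liminf (fun μ : ℝ => ⨅ u ∈ G.solutionSet p μ,
        ((G.energy p u / lineEnergy p (Ioi 0) (soliton p (2 * μ)) : ℝ) : EReal)) (𝓝[>] 0)) := by
  have hc : 0 < (p - 6) / (2 * (p + 2)) := div_pos (by linarith) (by linarith)
  refine ⟨fun hpend hhalf => ?_, fun _ => ?_⟩
  · have hnc : G.Noncompact := hfam.elim (fun h => h.2) fun h => Or.inr h.1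
    have hne : Nonempty E := hnc.elim (fun ⟨e, _⟩ => ⟨e⟩) fun h => inferInstance
    refine MetricGraph.one_le_liminf_energy_ratio (fun μ hμ => ?_) fun r hr => ?_
    · have := (soliton_mass hp hμ).1
      rw [lineEnergy_univ_soliton hp hμ]
      positivity
    · filter_upwards [MetricGraph.eventually_energy_ge hG hfam hp (N := 1) (Or.inl ⟨rfl,
        MetricGraph.two_le_degree hG.connected hG.finite_ends hpend hhalf⟩) hr,
        self_mem_nhdsWithin] with μ hμ hμ0
      rw [lineEnergy_univ_soliton hp hμ0]
      simpa using hμ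
  · refine MetricGraph.one_le_liminf_energy_ratio
      (R := fun μ => lineEnergy p (Ioi 0) (soliton p (2 * μ))) (fun μ hμ => ?_) fun r hr => ?_
    · have := (soliton_mass hp (by positivity : 0 < 2 * μ)).1
      rw [lineEnergy_Ioi_soliton hp hμ]
      positivity
    · filter_upwards [MetricGraph.eventually_energy_ge hG hfam hp (N := 2) (Or.inr rfl) hr,
        self_mem_nhdsWithin] with μ hμ hμ0
      rw [lineEnergy_Ioi_soliton hp hμ0]
      exact hμ
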